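/- Let $X$ be a real Banach space, let $1\le p<\infty$, let $\mathbb{D}$ be the open unit disc of $\mathbb{R}^2$, and let $f:\overline{\mathbb{D}}\to X$ be $C^\infty$ up to the boundary and harmonic in $\mathbb{D}$. For $x\in[0,1)$ and $k\ge 0$ let $\varepsilon_k(x)=-1$ if $\lfloor 2^{k+1}x\rfloor$ is even and $\varepsilon_k(x)=+1$ otherwise; thus $(\varepsilon_k)_{k\ge0}$ are independent symmetric signs on $[0,1)$ with Lebesgue measure. Given $T>0$ and $N\in\mathbb{N}$, $N\ge 1$, put $\varepsilon=1/N$ and $\delta=T/N^5$, and let $B_0=0$, $B_k=\sum_{l=1}^k dB_l$, where $$dB_l=\sqrt{2\delta}\,\varepsilon_l\,\bigl(\mathbf 1_{\{\varepsilon_{l-1}=-1\}},\ \mathbf 1_{\{\varepsilon_{l-1}=+1\}}\bigr).$$ Let $n_\varepsilon=\inf\{n\ge 0:\ B_{nN}\notin(1-\varepsilon)\mathbb{D}\}\in\mathbb{N}\cup\{\infty\}$, let $\tilde B_k=B_{k\wedge Nn_\varepsilon}$ be the stopped walk, and let $$M_T^f=f(0)+\sum_{k=1}^{N^5}\nabla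 f(\tilde B_{k-1})\cdot(\tilde B_k-\tilde B_{k-1}).$$ (For fixed $T$ and all large $N$, every $\tilde B_{k-1}$ with $\tilde B_k\ne\tilde B_{k-1}$ lies in $\mathbb{D}$.) Let $W$ be a standard planar Brownian motion started at the origin and $\tau=\inf\{t>0:\ W_t\notin\mathbb{D}\}$, which is almost surely finite. Then, for every $T>0$, the limit $\lim_{\varepsilon\to0}\mathbb{E}|M_T^f|^p$ (along $\varepsilon=1/N$, $N\to\infty$) exists and is finite, and $$\lim_{T\to\infty}\lim_{\varepsilon\to0}\mathbb{E}|M_T^f|^p=\mathbb{E}|f(W_\tau)|^p=\frac1{2\pi}\int_0^{2\pi}|f(e^{i\theta})|^p\,d\theta ,$$ where $|\cdot|$ is the norm of $X$. -/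

import Mathlib

open MeasureTheory ProbabilityTheory Filter Topology
open scoped NNReal

namespace DyadicWalk

/-- The sign `ε_k` on `[0, 1)`: it is `-1` on the left children and `+1` on the right children
among the dyadic intervals `[m 2^{-(k+1)}, (m+1) 2^{-(k+1)})` of generation `k + 1`
(left children are those with `m` even). -/
noncomputable def sign (k : ℕ) (x : ℝ) : ℝ :=
  if Even ⌊(2 : ℝ) ^ (k + 1) * x⌋ then -1 else 1

/-- The increment `dB_{l+1} = B_{l+1} - B_l` of the planar dyadic walk with time step `δ`
(the plane is `ℂ`): a step `± √(2δ)` with sign `ε_{l+1}`, horizontal if `ε_l = -1` and vertical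
if `ε_l = +1`. -/
noncomputable def increment (δ : ℝ) (l : ℕ) (x : ℝ) : ℂ :=
  ⟨if sign l x = -1 then sign (l + 1) x * √(2 * δ) else 0,
   if sign l x = 1 then sign (l + 1) x * √(2 * δ) else 0⟩

/-- The planar dyadic random walk `B_k = ∑_{l=1}^k dB_l`, with `B_0 = 0`. -/
noncomputable def walk (δ : ℝ) (k : ℕ) (x : ℝ) : ℂ :=
  ∑ l ∈ Finset.range k, increment δ l x

/-- The walk `X_n = B_{nN}`, sampled at the multiples of `N`. -/
noncomputable def sampledWalk (δ : ℝ) (N : ℕ) (n : ℕ) (x : ℝ) : ℂ :=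
  walk δ (n * N) x

/-- The index `n_ε`, `ε = 1/N`: the least `n` with `X_n ∉ (1 - ε) 𝔻`, or `⊤` if there is none. -/
noncomputable def exitIndex (δ : ℝ) (N : ℕ) : ℝ → WithTop ℕ :=
  hittingAfter (sampledWalk δ N) (Metric.ball (0 : ℂ) (1 - 1 / (N : ℝ)))ᶜ 0

/-- The walk `B` stopped at the index `k_ε = N n_ε`. -/
noncomputable def stoppedWalk (δ : ℝ) (N : ℕ) : ℕ → ℝ → ℂ :=
  stoppedProcess (walk δ) (fun x => (exitIndex δ N x).map (fun n => N * n))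

/-- The time step `δ` determined by `T = N ^ 5 δ`. -/
noncomputable def timeStep (T : ℝ) (N : ℕ) : ℝ := T / (N : ℝ) ^ 5

/-- The martingale transform
`M^f_T = f(0) + ∑_{k=1}^{N^5} ∇f(B_{k-1}) · dB_k` of the stopped walk, at the final time
`T = N ^ 5 δ`. -/
noncomputable def martingaleTransform {X : Type*} [NormedAddCommGroup X] [NormedSpace ℝ X]
    (f : ℂ → X) (T : ℝ) (N : ℕ) (x : ℝ) : X :=
  f 0 + ∑ k ∈ Finset.range (N ^ 5),
    fderiv ℝ f (stoppedWalk (timeStep T N) N k x)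
      (stoppedWalk (timeStep T N) N (k + 1) x - stoppedWalk (timeStep T N) N k x)

end DyadicWalk

/-- A standard planar Brownian motion started at the origin (the plane is `ℂ`): the two
coordinates are independent standard real Brownian motions (with almost surely continuous
paths). -/
structure IsPlanarBrownian {Ω : Type*} [MeasurableSpace Ω] (W : ℝ≥0 → Ω → ℂ) (P : Measure Ω) :
    Prop where
  re : IsBrownianReal (fun t ω => (W t ω).re) P
  im : IsBrownianReal (fun t ω => (W t ω).im) P
  indep : IndepFun (fun ω (t : ℝ≥0) => (W t ω).re) (fun ω (t : ℝ≥0) => (W t ω).im) P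

/-- The exit time `τ = inf {t > 0 ; W_t ∉ 𝔻}` from the open unit disc. -/
noncomputable def exitTime {Ω : Type*} (W : ℝ≥0 → Ω → ℂ) (ω : Ω) : ℝ≥0 :=
  sInf {t : ℝ≥0 | 0 < t ∧ W t ω ∉ Metric.ball (0 : ℂ) 1}

/-! For harmonic `f` the transform is almost `f` of the stopped walk. A step of the walk samples one
of the two pure second derivatives of `f`, chosen by the previous sign, so its second order Taylor
term is `δ/2` times the Laplacian minus `δ/2` times that sign times a difference of second
derivatives. With the second derivative frozen at the start of each block of `N` steps, the signs of
a block sum to `O(√N)` in mean, and over `N⁴` blocks with `δ = T/N⁵` the error vanishes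
(`integral_norm_itoRemainder_le`). Everything stays bounded, so `E‖M‖^p` and `E‖f(stopped walk)‖^p`
have the same limit, and from there on `X` enters only through the scalar function `‖f‖^p`,
continuous on the closed disc.

It remains to see that for continuous `φ` the mean of `φ` at the stopped walk converges as `N → ∞`,
and that this limit tends to the circle average as `T → ∞` (`HasExitLimit.of_continuousOn`). No
invariance principle is used. By Stone-Weierstrass `φ` may be a monomial in `z` and its conjugate,
hence up to conjugation `z^m g(|z|²)`, on which half the Laplacian acts as the ordinary differential
operator `L = radialOp m`. Removing the harmonic part `g(1) z^m` and approximating, one may take `g`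
divisible by `(1 - s)³`. Then a backward Euler scheme for the Dirichlet heat equation, `u_{j+1} - τ
L u_{j+1} = u_j` with `τ = T/n`, moves the mean back to time `0` with total error `O(T²/n)` and
compares it with a number that does not depend on `N`; the maximum principle keeps `L² u_j` bounded.
For `T → ∞`, Dynkin's formula for `1 - |z|²` bounds the probability of not being stopped by about
`1/(2T)`, so functions vanishing on the circle have limit `0`.

On the Brownian side the exit law is uniform because it is rotation invariant. The invariance passes
from finite-dimensional laws to the exit position through first passage values on dyadic grids. -/

/-! ### Functions constant on dyadic intervals. -/

/-- `G x` depends only on the dyadic interval of length `2 ^ (-K)` that contains `x`. -/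
def DyadicAt {α : Type*} (K : ℕ) (G : ℝ → α) : Prop :=
  ∀ x y : ℝ, ⌊(2 : ℝ) ^ K * x⌋ = ⌊(2 : ℝ) ^ K * y⌋ → G x = G y

lemma floor_eq_floor_two_mul_ediv (y : ℝ) : ⌊y⌋ = ⌊2 * y⌋ / 2 := by
  rw [Int.floor_eq_iff]
  have h1 := Int.floor_le (2 * y)
  have h2 := Int.lt_floor_add_one (2 * y)
  have h3 : (⌊2 * y⌋ / 2) * 2 ≤ ⌊2 * y⌋ := by omega
  have h4 : ⌊2 * y⌋ ≤ (⌊2 * y⌋ / 2) * 2 + 1 := by omega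
  have h3' : ((⌊2 * y⌋ / 2 : ℤ) : ℝ) * 2 ≤ ⌊2 * y⌋ := by exact_mod_cast h3
  have h4' : (⌊2 * y⌋ : ℝ) ≤ ((⌊2 * y⌋ / 2 : ℤ) : ℝ) * 2 + 1 := by exact_mod_cast h4
  constructor <;> linarith

lemma floor_two_pow_eq_of_le {x y : ℝ} {K K' : ℕ} (hK : K ≤ K')
    (h : ⌊(2 : ℝ) ^ K' * x⌋ = ⌊(2 : ℝ) ^ K' * y⌋) :
    ⌊(2 : ℝ) ^ K * x⌋ = ⌊(2 : ℝ) ^ K * y⌋ := by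
  induction K', hK using Nat.le_induction with
  | base => exact h
  | succ k hk ih =>
    apply ih
    rw [floor_eq_floor_two_mul_ediv, floor_eq_floor_two_mul_ediv (2 ^ k * y),
      ← mul_assoc, ← mul_assoc, ← pow_succ', h]

namespace DyadicAt

variable {α β γ : Type*} {K K' : ℕ}

lemma mono {G : ℝ → α} (hG : DyadicAt K G) (h : K ≤ K') : DyadicAt K' G :=
  fun x y hxy => hG x y (floor_two_pow_eq_of_le h hxy)

lemma comp {G : ℝ → α} (hG : DyadicAt K G) (φ : α → β) : DyadicAt K (fun x => φ (G x)) :=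
  fun x y hxy => congrArg φ (hG x y hxy)

lemma comp₂ {G : ℝ → α} {H : ℝ → β} (hG : DyadicAt K G) (hH : DyadicAt K H) (φ : α → β → γ) :
    DyadicAt K (fun x => φ (G x) (H x)) :=
  fun x y hxy => congrArg₂ φ (hG x y hxy) (hH x y hxy)

lemma sum {E ι : Type*} [AddCommMonoid E] {s : Finset ι} {G : ι → ℝ → E}
    (hG : ∀ i ∈ s, DyadicAt K (G i)) : DyadicAt K (fun x => ∑ i ∈ s, G i x) :=
  fun x y hxy => Finset.sum_congr rfl fun i hi => hG i hi x y hxy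

lemma eq_left {G : ℝ → α} (hG : DyadicAt K G) (x : ℝ) :
    G x = G ((⌊(2 : ℝ) ^ K * x⌋ : ℝ) / 2 ^ K) := by
  apply hG
  rw [mul_div_cancel₀ _ (by positivity), Int.floor_intCast]

lemma stronglyMeasurable [TopologicalSpace α] {G : ℝ → α} (hG : DyadicAt K G) :
    StronglyMeasurable G := by
  have h : G = (fun n : ℤ => G ((n : ℝ) / 2 ^ K)) ∘ fun x : ℝ => ⌊(2 : ℝ) ^ K * x⌋ :=
    funext hG.eq_left
  rw [h]
  exact StronglyMeasurable.of_discrete.comp_measurable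
    (Int.measurable_floor.comp (measurable_const_mul _))

variable {E : Type*} [NormedAddCommGroup E]

lemma exists_norm_le {G : ℝ → E} (hG : DyadicAt K G) :
    ∃ C : ℝ, ∀ x ∈ Set.Ico (0 : ℝ) 1, ‖G x‖ ≤ C := by
  refine ⟨∑ n ∈ Finset.range (2 ^ K), ‖G ((n : ℝ) / 2 ^ K)‖, fun x hx => ?_⟩
  have h0 : 0 ≤ (2 : ℝ) ^ K * x := mul_nonneg (by positivity) hx.1
  have h1 : (2 : ℝ) ^ K * x < (2 ^ K : ℕ) := by
    push_cast
    nlinarith [hx.2, pow_pos (two_pos (α := ℝ)) K]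
  have h2 : (⌊(2 : ℝ) ^ K * x⌋ : ℝ) = (⌊(2 : ℝ) ^ K * x⌋₊ : ℝ) :=
    (natCast_floor_eq_intCast_floor h0).symm
  rw [hG.eq_left x, h2]
  exact Finset.single_le_sum (f := fun n : ℕ => ‖G ((n : ℝ) / 2 ^ K)‖)
    (fun _ _ => norm_nonneg _) (Finset.mem_range.2 ((Nat.floor_lt h0).2 h1))

/-- Only finitely many intervals of generation `K` meet `[0, 1)`, so any function of finitely many
signs is integrable, with no regularity asked of the test function composed with the walk. -/
lemma integrableOn {G : ℝ → E} (hG : DyadicAt K G) : IntegrableOn G (Set.Ico (0 : ℝ) 1) := by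
  obtain ⟨C, hC⟩ := hG.exists_norm_le
  exact Measure.integrableOn_of_bounded (by simp) hG.stronglyMeasurable.aestronglyMeasurable
    ((ae_restrict_iff' measurableSet_Ico).2 (ae_of_all _ hC))

end DyadicAt

/-! ### Orthogonality of the dyadic signs. -/

namespace DyadicWalk

lemma dyadicAt_sign (k : ℕ) : DyadicAt (k + 1) (sign k) := fun x y h => by
  simp only [sign, h]

lemma sign_eq_or (k : ℕ) (x : ℝ) : sign k x = -1 ∨ sign k x = 1 := by
  unfold sign; split_ifs <;> simp

lemma sign_mul_self (k : ℕ) (x : ℝ) : sign k x * sign k x = 1 := by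
  rcases sign_eq_or k x with h | h <;> simp [h]

lemma abs_sign (k : ℕ) (x : ℝ) : |sign k x| = 1 := by
  rcases sign_eq_or k x with h | h <;> simp [h]

variable {E : Type*} [NormedAddCommGroup E] [NormedSpace ℝ E]

/-- The sign of generation `K` has conditional mean zero given the coarser dyadic intervals. -/
lemma integral_sign_smul_eq_zero [CompleteSpace E] {K : ℕ} {G : ℝ → E} (hG : DyadicAt K G) :
    ∫ x in Set.Ico (0 : ℝ) 1, sign K x • G x = 0 := by
  have hF : DyadicAt (K + 1) fun x => sign K x • G x :=
    (dyadicAt_sign K).comp₂ (hG.mono (Nat.le_succ K)) _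
  have hK : (0 : ℝ) < 2 ^ K := by positivity
  set h : ℝ := 1 / 2 ^ (K + 1) with hh
  have hpos : 0 < h := by positivity
  have hp : (2 : ℝ) ^ (K + 1) * h = 1 := by rw [hh]; field_simp
  -- The points `a n` start the intervals of generation `K`, of length `2h`. There `G` is constant
  -- while the sign is `-1` on the left half and `+1` on the right half, so the two halves cancel.
  let a : ℕ → ℝ := fun n => n / 2 ^ K
  have ha : ∀ n, a (n + 1) = a n + h + h := fun n => by
    simp only [a, hh, pow_succ]; push_cast; field_simp; ring
  have ha2 : ∀ n, (2 : ℝ) ^ (K + 1) * a n = 2 * n := fun n => by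
    simp only [a, pow_succ]; field_simp
  have hloc : ∀ (n : ℕ) (x : ℝ), x ∈ Set.Ioo (a n) (a n + h) →
      sign K x • G x = -G (a n) := fun n x hx => by
    have hfl : ⌊(2 : ℝ) ^ (K + 1) * x⌋ = 2 * n := by
      rw [Int.floor_eq_iff]; push_cast
      constructor
      · rw [← ha2]; gcongr; exact hx.1.le
      · rw [← ha2, ← hp, ← mul_add]; gcongr; exact hx.2
    have hs : sign K x = -1 := by simp [sign, hfl]
    have : G x = G (a n) := hG.mono (Nat.le_succ K) _ _ (by
      rw [hfl, ha2]; exact_mod_cast (Int.floor_intCast (R := ℝ) (2 * n : ℤ)).symm)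
    rw [hs, this, neg_one_smul]
  have hloc' : ∀ (n : ℕ) (x : ℝ), x ∈ Set.Ioo (a n + h) (a n + h + h) →
      sign K x • G x = G (a n) := fun n x hx => by
    have hfl : ⌊(2 : ℝ) ^ (K + 1) * x⌋ = 2 * n + 1 := by
      rw [Int.floor_eq_iff]; push_cast
      constructor
      · rw [← ha2, ← hp, ← mul_add]; gcongr; exact hx.1.le
      · calc (2 : ℝ) ^ (K + 1) * x < 2 ^ (K + 1) * (a n + h + h) := by gcongr; exact hx.2
          _ = _ := by rw [mul_add, mul_add, ha2, hp]
    have hs : sign K x = 1 := by simp [sign, hfl]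
    have : G x = G (a n) := hG _ _ (by
      rw [floor_eq_floor_two_mul_ediv, floor_eq_floor_two_mul_ediv (2 ^ K * a n),
        ← mul_assoc, ← mul_assoc, ← pow_succ', hfl, ha2]
      have : ⌊(2 * n : ℝ)⌋ = (2 * n : ℤ) := by
        exact_mod_cast (Int.floor_intCast (R := ℝ) (2 * n : ℤ))
      rw [this]; omega)
    rw [hs, this, one_smul]
  have hint : ∀ x ∈ Set.Icc (0 : ℝ) 1, ∀ y ∈ Set.Icc (0 : ℝ) 1,
      IntervalIntegrable (fun x => sign K x • G x) volume x y := fun x hx y hy =>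
    (((integrableOn_Icc_iff_integrableOn_Ico (by simp)).2 hF.integrableOn).mono_set
      (Set.uIcc_subset_Icc hx hy)).intervalIntegrable
  have ha1 : ∀ n < 2 ^ K, a n + h + h ≤ 1 := fun n hn => by
    rw [← ha, div_le_one hK]; exact_mod_cast hn
  have ha0 : ∀ n, 0 ≤ a n := fun n => by positivity
  rw [integral_Ico_eq_integral_Ioc, ← intervalIntegral.integral_of_le zero_le_one]
  have hsum := intervalIntegral.sum_integral_adjacent_intervals (a := a) (n := 2 ^ K)
    (f := fun x => sign K x • G x) (μ := volume) (fun k hk => by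
      have := ha1 k hk
      exact hint _ ⟨ha0 k, by linarith⟩ _ ⟨ha0 _, by rw [ha]; linarith⟩)
  have h0 : a 0 = 0 := by simp [a]
  have h1 : a (2 ^ K) = 1 := by simp [a]
  rw [h0, h1] at hsum
  rw [← hsum]
  refine Finset.sum_eq_zero fun n hn => ?_
  have h2 := ha1 n (Finset.mem_range.1 hn)
  have h3 := ha0 n
  have hm : a n + h ∈ Set.Icc (0 : ℝ) 1 := ⟨by linarith, by linarith⟩
  rw [ha, ← intervalIntegral.integral_add_adjacent_intervals
    (hint _ ⟨h3, by linarith⟩ _ hm) (hint _ hm _ ⟨by linarith, h2⟩),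
    intervalIntegral.integral_congr_Ioo_of_le (by linarith) (hloc n),
    intervalIntegral.integral_congr_Ioo_of_le (by linarith) (hloc' n)]
  simp

/-- Expanding the square by its last sign, the cross term is that sign times a coarser function,
hence has mean zero. -/
lemma integral_sq_sum_sign (k n : ℕ) :
    ∫ x in Set.Ico (0 : ℝ) 1, (∑ i ∈ Finset.range n, sign (k + i) x) ^ 2 = n := by
  induction n with
  | zero => simp
  | succ n ih =>
    have hS : DyadicAt (k + n) fun x => ∑ i ∈ Finset.range n, sign (k + i) x :=
      DyadicAt.sum fun i hi => (dyadicAt_sign _).mono (by have := Finset.mem_range.1 hi; omega)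
    have h1 := integral_sign_smul_eq_zero (hS.comp fun y => 2 * y)
    have h2 : ∀ x, (∑ i ∈ Finset.range (n + 1), sign (k + i) x) ^ 2 =
        (∑ i ∈ Finset.range n, sign (k + i) x) ^ 2 +
          (sign (k + n) x • (2 * ∑ i ∈ Finset.range n, sign (k + i) x) + 1) := fun x => by
      rw [Finset.sum_range_succ, smul_eq_mul]; linear_combination sign_mul_self (k + n) x
    have hI : IntegrableOn (fun x => sign (k + n) x • (2 * ∑ i ∈ Finset.range n, sign (k + i) x))
        (Set.Ico (0 : ℝ) 1) :=
      ((dyadicAt_sign (k + n)).comp₂ (hS.mono (Nat.le_succ _)) fun a b => a • (2 * b)).integrableOn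
    simp_rw [h2]
    rw [integral_add (g := fun x => _ + (1 : ℝ)) (hS.comp fun y => y ^ 2).integrableOn (hI.add (g := fun _ => (1 : ℝ)) (by simp)),
      integral_add hI (by simp), ih, h1]
    simp

lemma integral_abs_sum_sign_le (k n : ℕ) :
    ∫ x in Set.Ico (0 : ℝ) 1, |∑ i ∈ Finset.range n, sign (k + i) x| ≤ √n := by
  rcases Nat.eq_zero_or_pos n with rfl | hn
  · simp
  have hS : DyadicAt (k + n) fun x => ∑ i ∈ Finset.range n, sign (k + i) x :=
    DyadicAt.sum fun i hi => (dyadicAt_sign _).mono (by have := Finset.mem_range.1 hi; omega)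
  have hn' : 0 < √(n : ℝ) := Real.sqrt_pos.2 (by exact_mod_cast hn)
  have hsq : √(n : ℝ) * √n = n := Real.mul_self_sqrt (Nat.cast_nonneg n)
  -- Cauchy-Schwarz in pointwise form: `|S| ≤ S²/(2√n) + √n/2`.
  calc _ ≤ ∫ x in Set.Ico (0 : ℝ) 1,
        ((2 * √n)⁻¹ * (∑ i ∈ Finset.range n, sign (k + i) x) ^ 2 + √n / 2) := by
        refine integral_mono (hS.comp abs).integrableOn
          (hS.comp fun y => (2 * √n)⁻¹ * y ^ 2 + √n / 2).integrableOn fun x => ?_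
        set S := ∑ i ∈ Finset.range n, sign (k + i) x
        have : (2 * √(n : ℝ))⁻¹ * S ^ 2 + √n / 2 = (2 * √(n : ℝ))⁻¹ * (S ^ 2 + √n * √n) := by
          field_simp
        change |S| ≤ _
        rw [this, inv_mul_eq_div, le_div_iff₀ (by positivity), ← sq_abs S]
        nlinarith [sq_nonneg (|S| - √n)]
    _ = √n := by
        rw [integral_add ((hS.comp fun y => (2 * √n)⁻¹ * y ^ 2).integrableOn) (by simp),
          integral_const_mul, integral_sq_sum_sign]
        simp only [integral_const, MeasurableSet.univ, measureReal_restrict_apply, Set.univ_inter,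
          Real.volume_real_Ico, sub_zero, zero_le_one, sup_of_le_left, smul_eq_mul, one_mul]
        rw [inv_mul_eq_div, div_add_div _ _ (by positivity) two_ne_zero,
          div_eq_iff (by positivity)]
        linear_combination (-2) * hsq

end DyadicWalk

/-! ### The walk and its stopping at block ends. -/

namespace DyadicWalk

/-- Splits off the fresh sign `ε_{l+1}`. The other factor depends on `ε_l` alone, so the increment
is a martingale difference, and quadratic expressions in it see only `ε_l`. -/
lemma increment_eq (δ : ℝ) (l : ℕ) (x : ℝ) :
    increment δ l x = sign (l + 1) x •
      ((√(2 * δ) : ℝ) • (if sign l x = -1 then (1 : ℂ) else Complex.I)) := by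
  unfold increment
  rcases sign_eq_or l x with h | h
  · apply Complex.ext <;> simp [h]; norm_num
  · have : ¬ ((1 : ℝ) = -1) := by norm_num
    apply Complex.ext <;> simp [h, this]

lemma norm_increment (δ : ℝ) (l : ℕ) (x : ℝ) : ‖increment δ l x‖ = √(2 * δ) := by
  rw [increment_eq, norm_smul, norm_smul, Real.norm_eq_abs, abs_sign, one_mul, Real.norm_eq_abs,
    abs_of_nonneg (Real.sqrt_nonneg _)]
  split_ifs <;> simp

lemma dyadicAt_increment (δ : ℝ) (l : ℕ) : DyadicAt (l + 2) (increment δ l) := by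
  have := ((dyadicAt_sign l).mono (Nat.le_succ _)).comp₂ (dyadicAt_sign (l + 1))
    (fun s t => t • ((√(2 * δ) : ℝ) • (if s = -1 then (1 : ℂ) else Complex.I)))
  intro x y h
  rw [increment_eq, increment_eq]
  exact this x y h

/-- `B_k` uses the signs `ε_0, …, ε_k`, and `ε_k` is read off intervals of generation `k + 1`; the
next fresh sign is `ε_{k+1}`. -/
lemma dyadicAt_walk (δ : ℝ) (k : ℕ) : DyadicAt (k + 1) (walk δ k) :=
  DyadicAt.sum fun i hi => (dyadicAt_increment δ i).mono (by have := Finset.mem_range.1 hi; omega)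

lemma walk_succ (δ : ℝ) (k : ℕ) (x : ℝ) : walk δ (k + 1) x = walk δ k x + increment δ k x :=
  Finset.sum_range_succ _ _

lemma norm_walk_add_sub_le (δ : ℝ) (k i : ℕ) (x : ℝ) :
    ‖walk δ (k + i) x - walk δ k x‖ ≤ i * √(2 * δ) := by
  induction i with
  | zero => simp
  | succ i ih =>
    have : walk δ (k + (i + 1)) x - walk δ k x =
        (walk δ (k + i) x - walk δ k x) + increment δ (k + i) x := by
      rw [← add_assoc, walk_succ]; ring
    rw [this]
    refine (norm_add_le _ _).trans ?_
    rw [norm_increment]; push_cast; linarith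

/-- The sampled walk has not left the disc `(1 - 1 / N) 𝔻` up to the index `c`. -/
def Inside (δ : ℝ) (N c : ℕ) (x : ℝ) : Prop :=
  ∀ j ≤ c, sampledWalk δ N j x ∈ Metric.ball (0 : ℂ) (1 - 1 / (N : ℝ))

lemma Inside.mono {δ : ℝ} {N c c' : ℕ} {x : ℝ} (h : Inside δ N c x) (hc : c' ≤ c) :
    Inside δ N c' x := fun j hj => h j (hj.trans hc)

lemma dyadicAt_inside (δ : ℝ) (N c : ℕ) : DyadicAt (N * c + 1) (Inside δ N c) := by
  intro x y h
  refine propext (forall₂_congr fun j hj => ?_)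
  have : sampledWalk δ N j x = sampledWalk δ N j y :=
    (dyadicAt_walk δ (j * N)).mono (by rw [mul_comm N c]; gcongr) x y h
  rw [this]

lemma inside_iff_lt_exitIndex (δ : ℝ) (N c : ℕ) (x : ℝ) :
    Inside δ N c x ↔ WithTop.some c < exitIndex δ N x := by
  unfold exitIndex
  constructor
  · intro h
    by_contra hlt
    rw [not_lt] at hlt
    obtain ⟨n, hn⟩ := WithTop.ne_top_iff_exists.1 (ne_top_of_le_ne_top (WithTop.coe_ne_top) hlt)
    rw [← hn] at hlt
    have hex := hittingAfter_mem_set (u := sampledWalk δ N)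
      (s := (Metric.ball (0 : ℂ) (1 - 1 / (N : ℝ)))ᶜ) (n := 0) (ω := x)
      (by
        by_contra hne
        have := (hittingAfter_eq_top_iff (u := sampledWalk δ N)
          (s := (Metric.ball (0 : ℂ) (1 - 1 / (N : ℝ)))ᶜ) (n := 0) (ω := x)).2
          (by push Not at hne; exact hne)
        rw [← hn] at this
        exact WithTop.coe_ne_top this)
    rw [← hn] at hex
    exact hex (h n (WithTop.coe_le_coe.1 hlt))
  · intro h j hj
    have := notMem_of_lt_hittingAfter (k := j)
      (lt_of_le_of_lt (WithTop.coe_le_coe.2 hj) h) (Nat.zero_le _)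
    simpa only [Set.mem_compl_iff, not_not] using this

/-- Stopping is decided only at multiples of `N`: a walk still inside at index `c` runs freely
through the whole next block, its endpoint `i = N` included. -/
lemma stoppedWalk_of_inside {δ : ℝ} {N c : ℕ} {x : ℝ} (h : Inside δ N c x) {i : ℕ} (hi : i ≤ N) :
    stoppedWalk δ N (N * c + i) x = walk δ (N * c + i) x := by
  apply stoppedProcess_eq_of_le
  rw [inside_iff_lt_exitIndex] at h
  cases hn : exitIndex δ N x with
  | top => simp
  | coe n =>
    rw [hn] at h
    have h' : c + 1 ≤ n := WithTop.coe_lt_coe.1 h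
    simp only [WithTop.map_coe]
    have : N * c + i ≤ N * n := (by nlinarith : N * c + i ≤ N * (c + 1)).trans (by gcongr)
    exact WithTop.coe_le_coe.2 this

lemma exists_of_not_inside {δ : ℝ} {N c : ℕ} {x : ℝ} (h : ¬ Inside δ N c x) :
    ∃ n ≤ c, (∀ j < n, Inside δ N j x) ∧ ¬ Inside δ N n x ∧
      sampledWalk δ N n x ∉ Metric.ball (0 : ℂ) (1 - 1 / (N : ℝ)) ∧
      ∀ k, N * n ≤ k → stoppedWalk δ N k x = walk δ (N * n) x := by
  have h' := h
  rw [inside_iff_lt_exitIndex, not_lt] at h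
  cases hn : exitIndex δ N x with
  | top => simp [hn] at h
  | coe n =>
    rw [hn] at h
    have hlt : ∀ j < n, Inside δ N j x := fun j hj => by
      rw [inside_iff_lt_exitIndex, hn]; exact WithTop.coe_lt_coe.2 hj
    have hni : ¬ Inside δ N n x := by
      rw [inside_iff_lt_exitIndex, hn]; simp
    refine ⟨n, WithTop.coe_le_coe.1 h, hlt, hni, fun hmem => hni fun j hj => ?_, fun k hk => ?_⟩
    · rcases hj.lt_or_eq with hj | rfl
      · exact hlt j hj j le_rfl
      · exact hmem
    · have hk' : (exitIndex δ N x).map (fun n => N * n) ≤ WithTop.some k := by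
        rw [hn]; exact WithTop.coe_le_coe.2 hk
      refine (stoppedProcess_eq_of_ge (τ := fun x => (exitIndex δ N x).map fun n => N * n)
        hk').trans ?_
      rw [hn]; rfl

lemma stoppedWalk_of_not_inside {δ : ℝ} {N c : ℕ} {x : ℝ} (h : ¬ Inside δ N c x) (i : ℕ) :
    stoppedWalk δ N (N * c + i) x = stoppedWalk δ N (N * c) x := by
  obtain ⟨n, hn, -, -, -, hs⟩ := exists_of_not_inside h
  rw [hs _ (by nlinarith), hs _ (by nlinarith)]

lemma stoppedWalk_zero (δ : ℝ) (N : ℕ) (x : ℝ) : stoppedWalk δ N 0 x = 0 := by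
  have : stoppedWalk δ N 0 x = walk δ 0 x := stoppedProcess_eq_of_le (by simp)
  rw [this]; simp [walk]

/-- The stopping time property: whether and where the walk has stopped by step `k` is decided by the
signs up to `ε_k`. -/
lemma dyadicAt_stoppedWalk (δ : ℝ) {N : ℕ} (hN : 0 < N) (k : ℕ) :
    DyadicAt (k + 1) (stoppedWalk δ N k) := by
  intro x y h
  obtain ⟨c, i, hi, rfl⟩ : ∃ c i, i < N ∧ k = N * c + i :=
    ⟨k / N, k % N, Nat.mod_lt _ hN, (Nat.div_add_mod _ _).symm⟩
  have hins : ∀ j ≤ c, (Inside δ N j x ↔ Inside δ N j y) := fun j hj =>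
    iff_of_eq ((dyadicAt_inside δ N j).mono
      (by have : N * j ≤ N * c := by gcongr
          omega) x y h)
  by_cases hx : Inside δ N c x
  · rw [stoppedWalk_of_inside hx hi.le, stoppedWalk_of_inside ((hins c le_rfl).1 hx) hi.le]
    exact dyadicAt_walk δ _ x y h
  · obtain ⟨n, hn, h1, h2, -, h4⟩ := exists_of_not_inside hx
    obtain ⟨n', hn', h1', h2', -, h4'⟩ := exists_of_not_inside (mt (hins c le_rfl).2 hx)
    have : n = n' := by
      apply le_antisymm <;> by_contra! hlt
      · exact h2' ((hins n' hn').1 (h1 _ hlt))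
      · exact h2 ((hins n hn).2 (h1' _ hlt))
    subst this
    have hle : N * n ≤ N * c + i := by nlinarith
    rw [h4 _ hle, h4' _ hle]
    exact (dyadicAt_walk δ _).mono (by omega) x y h

/-- The time step is small enough for the stopped walk not to leave the unit disc. -/
def SmallStep (δ : ℝ) (N : ℕ) : Prop := 2 ≤ N ∧ N * √(2 * δ) < 1 / (N : ℝ)

namespace SmallStep

variable {δ : ℝ} {N : ℕ}

lemma pos (h : SmallStep δ N) : 0 < N := by have := h.1; omega

/-- A block starts within `1 - 1/N` of the origin and its total displacement is at most `N√(2δ) <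
1/N`. -/
lemma walk_mem_ball (h : SmallStep δ N) {c i : ℕ} {x : ℝ} (hc : Inside δ N c x) (hi : i ≤ N) :
    walk δ (N * c + i) x ∈ Metric.ball (0 : ℂ) 1 := by
  have h1 := hc c le_rfl
  rw [sampledWalk, mul_comm, mem_ball_zero_iff] at h1
  have h2 := norm_walk_add_sub_le δ (N * c) i x
  have h3 : (i : ℝ) * √(2 * δ) ≤ N * √(2 * δ) := by gcongr
  rw [mem_ball_zero_iff]
  have h4 := norm_add_le (walk δ (N * c) x) (walk δ (N * c + i) x - walk δ (N * c) x)
  rw [add_sub_cancel] at h4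
  have := h.2
  linarith

lemma stoppedWalk_mem_ball (h : SmallStep δ N) (k : ℕ) (x : ℝ) :
    stoppedWalk δ N k x ∈ Metric.ball (0 : ℂ) 1 := by
  obtain ⟨c, i, hi, rfl⟩ : ∃ c i, i < N ∧ k = N * c + i :=
    ⟨k / N, k % N, Nat.mod_lt _ h.pos, (Nat.div_add_mod _ _).symm⟩
  by_cases hx : Inside δ N c x
  · rw [stoppedWalk_of_inside hx hi.le]
    exact h.walk_mem_ball hx hi.le
  · obtain ⟨n, hn, h1, -, h3, h4⟩ := exists_of_not_inside hx
    rw [h4 _ (by nlinarith)]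
    cases n with
    | zero => simp [walk]
    | succ n =>
      have := h.walk_mem_ball (h1 n (Nat.lt_succ_self n)) le_rfl
      rwa [mul_add, mul_one]

lemma le_norm_stoppedWalk (_h : SmallStep δ N) {c : ℕ} {x : ℝ} (hc : ¬ Inside δ N c x) :
    1 - 1 / (N : ℝ) ≤ ‖stoppedWalk δ N (N * c) x‖ := by
  obtain ⟨n, hn, -, -, h3, h4⟩ := exists_of_not_inside hc
  rw [h4 _ (by nlinarith)]
  rw [sampledWalk, mul_comm, mem_ball_zero_iff, not_lt] at h3
  exact h3

end SmallStep

/-- With `δ = T/N⁵` the condition `N√(2δ) < 1/N` becomes `2T < N` after squaring. -/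
lemma eventually_smallStep (T : ℝ) :
    ∀ᶠ N : ℕ in atTop, SmallStep (timeStep T N) N := by
  filter_upwards [eventually_ge_atTop 2, eventually_gt_atTop ⌈2 * T⌉₊] with N h2 hN
  have hN0 : (0 : ℝ) < N := by positivity
  have hN' : 2 * T < N := (Nat.le_ceil _).trans_lt (by exact_mod_cast hN)
  refine ⟨h2, ?_⟩
  rw [← lt_div_iff₀' hN0, Real.sqrt_lt' (by positivity), timeStep]
  rw [div_div, div_pow, one_pow, mul_div_assoc', div_lt_div_iff₀ (by positivity) (by positivity)]
  calc 2 * T * (N * N : ℝ) ^ 2 < N * (N * N : ℝ) ^ 2 := by gcongr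
    _ = _ := by ring

end DyadicWalk

/-! ### Second order Taylor expansion on the disc. -/

section Taylor

variable {E : Type*} [NormedAddCommGroup E] [NormedSpace ℝ E]

/-- Second order control of `f` on the open unit disc: `f` and its second derivative are bounded,
the second derivative is Lipschitz, and the Taylor remainder of order two is cubic. -/
structure SecondOrderBound (f : ℂ → E) (C : ℝ) : Prop where
  nonneg : 0 ≤ C
  bound : ∀ z ∈ Metric.ball (0 : ℂ) 1, ‖f z‖ ≤ C
  bound_snd : ∀ z ∈ Metric.ball (0 : ℂ) 1, ‖fderiv ℝ (fderiv ℝ f) z‖ ≤ C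
  lipschitz_snd : ∀ z ∈ Metric.ball (0 : ℂ) 1, ∀ w ∈ Metric.ball (0 : ℂ) 1,
    ‖fderiv ℝ (fderiv ℝ f) w - fderiv ℝ (fderiv ℝ f) z‖ ≤ C * ‖w - z‖
  taylor : ∀ z ∈ Metric.ball (0 : ℂ) 1, ∀ w ∈ Metric.ball (0 : ℂ) 1,
    ‖f w - f z - fderiv ℝ f z (w - z) -
      (1 / 2 : ℝ) • fderiv ℝ (fderiv ℝ f) z (w - z) (w - z)‖ ≤ C * ‖w - z‖ ^ 3

/-- The mean value inequality is used twice: for the derivative of `f`, then for `f` minus its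
Taylor polynomial, whose derivative is the first error. Symmetry of the second derivative enters
when the quadratic term is differentiated. -/
lemma norm_taylor_two_le {f : ℂ → E} {C : ℝ} {B : Set ℂ} (hB : IsOpen B) (hconv : Convex ℝ B)
    (hf : ContDiffOn ℝ 2 f B)
    (hlip : ∀ z ∈ B, ∀ w ∈ B,
      ‖fderiv ℝ (fderiv ℝ f) w - fderiv ℝ (fderiv ℝ f) z‖ ≤ C * ‖w - z‖) (hC : 0 ≤ C)
    {z w : ℂ} (hz : z ∈ B) (hw : w ∈ B) :
    ‖f w - f z - fderiv ℝ f z (w - z) -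
      (1 / 2 : ℝ) • fderiv ℝ (fderiv ℝ f) z (w - z) (w - z)‖ ≤ C * ‖w - z‖ ^ 3 := by
  have hcd : ∀ u ∈ B, ContDiffAt ℝ 2 f u := fun u hu => hf.contDiffAt (hB.mem_nhds hu)
  have hd1 : ∀ u ∈ B, HasFDerivAt f (fderiv ℝ f u) u := fun u hu =>
    ((hcd u hu).differentiableAt (by norm_num)).hasFDerivAt
  have hd2 : ∀ u ∈ B, HasFDerivAt (fderiv ℝ f) (fderiv ℝ (fderiv ℝ f) u) u := fun u hu =>
    (((hcd u hu).fderiv_right (m := 1) (by norm_num)).differentiableAt (by norm_num)).hasFDerivAt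
  have hseg : ∀ y ∈ B, segment ℝ z y ⊆ B := fun y hy => hconv.segment_subset hz hy
  have hnorm : ∀ y, ∀ u ∈ segment ℝ z y, ‖u - z‖ ≤ ‖y - z‖ := fun y u hu => by
    obtain ⟨t, ⟨ht0, ht1⟩, rfl⟩ := (segment_eq_image' ℝ z y ▸ hu :)
    simp only [add_sub_cancel_left, norm_smul, Real.norm_eq_abs, abs_of_nonneg ht0]
    exact mul_le_of_le_one_left (norm_nonneg _) ht1
  have h1 : ∀ y ∈ B, ‖fderiv ℝ f y - fderiv ℝ f z - fderiv ℝ (fderiv ℝ f) z (y - z)‖ ≤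
      C * ‖y - z‖ * ‖y - z‖ := fun y hy =>
    (convex_segment z y).norm_image_sub_le_of_norm_hasFDerivWithin_le'
      (fun u hu => (hd2 u (hseg y hy hu)).hasFDerivWithinAt)
      (fun u hu => (hlip z hz u (hseg y hy hu)).trans (by gcongr; exact hnorm y u hu))
      (left_mem_segment ℝ z y) (right_mem_segment ℝ z y)
  have hsymm : IsSymmSndFDerivAt ℝ f z :=
    (hcd z hz).isSymmSndFDerivAt (by simp)
  set D := fderiv ℝ (fderiv ℝ f) z
  have h2 : ∀ u ∈ B, HasFDerivAt
      (fun u => f u - fderiv ℝ f z (u - z) - (1 / 2 : ℝ) • D (u - z) (u - z))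
      (fderiv ℝ f u - fderiv ℝ f z - D (u - z)) u := fun u hu => by
    have hid : HasFDerivAt (fun u : ℂ => u - z) (ContinuousLinearMap.id ℝ ℂ) u :=
      (hasFDerivAt_id u).sub_const z
    have hq := ((D.hasFDerivAt.comp u hid).clm_apply hid).const_smul (1 / 2 : ℝ)
    refine (((hd1 u hu).sub ((fderiv ℝ f z).hasFDerivAt.comp u hid)).sub hq).congr_fderiv ?_
    ext v
    have := hsymm v (u - z)
    simp only [Function.comp_apply, sub_apply, ContinuousLinearMap.comp_apply,
      smul_apply, add_apply,
      ContinuousLinearMap.flip_apply, ContinuousLinearMap.id_apply, D, this]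
    module
  have h3 := (convex_segment z w).norm_image_sub_le_of_norm_hasFDerivWithin_le (C := C * ‖w - z‖ ^ 2)
    (fun u hu => (h2 u (hseg w hw hu)).hasFDerivWithinAt)
    (fun u hu => (h1 u (hseg w hw hu)).trans (by
      rw [mul_assoc, ← sq]; gcongr; exact hnorm w u hu))
    (left_mem_segment ℝ z w) (right_mem_segment ℝ z w)
  have e : ∀ a b c d : E, a - b - c - d = (a - c - d) - b := fun _ _ _ _ => by abel
  rw [e]
  simp only [sub_self, map_zero, smul_zero, sub_zero] at h3
  calc _ ≤ _ := h3
    _ = _ := by ring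

/-- Derivatives within the closed disc are continuous on a compact set, hence bounded up to third
order, and they agree with the ordinary derivatives in the open disc. -/
lemma exists_secondOrderBound {f : ℂ → E}
    (hf : ContDiffOn ℝ (⊤ : ℕ∞) f (Metric.closedBall (0 : ℂ) 1)) :
    ∃ C, SecondOrderBound f C := by
  set S := Metric.closedBall (0 : ℂ) 1 with hS
  set B := Metric.ball (0 : ℂ) 1 with hBdef
  have hBo : IsOpen B := Metric.isOpen_ball
  have hBS : B ⊆ S := Metric.ball_subset_closedBall
  have hSn : ∀ z ∈ B, S ∈ 𝓝 z := fun z hz => mem_of_superset (hBo.mem_nhds hz) hBS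
  have hu : UniqueDiffOn ℝ S := uniqueDiffOn_convex (convex_closedBall 0 1)
    ⟨0, by rw [hS, interior_closedBall _ one_ne_zero]; simp⟩
  have hSc : IsCompact S := isCompact_closedBall 0 1
  have htop : ((⊤ : ℕ∞) : WithTop ℕ∞) + 1 ≤ ((⊤ : ℕ∞) : WithTop ℕ∞) := by simp
  have c1 := hf.fderivWithin hu htop
  have c2 := c1.fderivWithin hu htop
  have c3 := c2.fderivWithin hu htop
  obtain ⟨C0, hC0⟩ := hSc.exists_bound_of_continuousOn hf.continuousOn
  obtain ⟨C2, hC2⟩ := hSc.exists_bound_of_continuousOn c2.continuousOn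
  obtain ⟨C3, hC3⟩ := hSc.exists_bound_of_continuousOn c3.continuousOn
  have e1 : Set.EqOn (fderiv ℝ f) (fderivWithin ℝ f S) B := fun z hz =>
    (fderivWithin_of_mem_nhds (hSn z hz)).symm
  have e2 : Set.EqOn (fderiv ℝ (fderiv ℝ f)) (fderivWithin ℝ (fderivWithin ℝ f S) S) B :=
    fun z hz => by
      rw [fderivWithin_of_mem_nhds (hSn z hz)]
      exact (e1.eventuallyEq_of_mem (hBo.mem_nhds hz)).fderiv_eq
  have hd : ∀ z ∈ B, HasFDerivWithinAt (fderiv ℝ (fderiv ℝ f))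
      (fderivWithin ℝ (fderivWithin ℝ (fderivWithin ℝ f S) S) S z) B z := fun z hz => by
    have := ((c2.differentiableOn (by simp)) z (hBS hz)).hasFDerivWithinAt.mono hBS
    exact this.congr (fun y hy => e2 hy) (e2 hz)
  set C := max (max C0 C2) (max C3 0)
  have hC30 : C3 ≤ C := (le_max_left _ _).trans (le_max_right _ _)
  have hCpos : 0 ≤ C := (le_max_right _ _).trans (le_max_right _ _)
  have hlip : ∀ z ∈ B, ∀ w ∈ B,
      ‖fderiv ℝ (fderiv ℝ f) w - fderiv ℝ (fderiv ℝ f) z‖ ≤ C * ‖w - z‖ := fun z hz w hw =>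
    (convex_ball (0 : ℂ) 1).norm_image_sub_le_of_norm_hasFDerivWithin_le hd
      (fun y hy => (hC3 y (hBS hy)).trans hC30) hz hw
  refine ⟨C, hCpos, fun z hz => (hC0 z (hBS hz)).trans ((le_max_left _ _).trans (le_max_left _ _)),
    fun z hz => ?_, hlip, fun z hz w hw => ?_⟩
  · rw [e2 hz]
    exact (hC2 z (hBS hz)).trans ((le_max_right _ _).trans (le_max_left _ _))
  · exact norm_taylor_two_le hBo (convex_ball 0 1)
      ((hf.mono hBS).of_le (WithTop.coe_le_coe.2 (le_top : (2 : ℕ∞) ≤ ⊤))) hlip hCpos hz hw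

/-- The Laplacian of `f` on the plane, in terms of iterated derivatives. -/
noncomputable def planarLaplacian (f : ℂ → E) (z : ℂ) : E :=
  fderiv ℝ (fderiv ℝ f) z 1 1 + fderiv ℝ (fderiv ℝ f) z Complex.I Complex.I

lemma planarLaplacian_eq_zero_of_harmonicAt {f : ℂ → E} {z : ℂ}
    (h : InnerProductSpace.HarmonicAt f z) : planarLaplacian f z = 0 := by
  have := h.2.self_of_nhds
  rw [InnerProductSpace.laplacian_eq_iteratedFDeriv_complexPlane] at this
  simpa [iteratedFDeriv_two_apply, planarLaplacian] using this

end Taylor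

/-! ### Discrete Itô and Dynkin formulas. -/

namespace DyadicWalk

variable {E : Type*} [NormedAddCommGroup E] [NormedSpace ℝ E]

/-- The summand of index `k` of the martingale transform. -/
noncomputable def transformStep (f : ℂ → E) (δ : ℝ) (N k : ℕ) (x : ℝ) : E :=
  fderiv ℝ f (stoppedWalk δ N k x) (stoppedWalk δ N (k + 1) x - stoppedWalk δ N k x)

/-- The contribution of the Laplacian in the block of index `c`, without the factor `δ N / 2`. -/
noncomputable def driftTerm {E : Type*} [NormedAddCommGroup E] (g : ℂ → E) (δ : ℝ) (N c : ℕ) : ℝ → E :=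
  {x | Inside δ N c x}.indicator fun x => g (stoppedWalk δ N (N * c) x)

/-- The remainder in the discrete Itô formula for `f` at the end of the block of index `b`. -/
noncomputable def itoRemainder (f : ℂ → E) (δ : ℝ) (N b : ℕ) (x : ℝ) : E :=
  f (stoppedWalk δ N (N * b) x) - f 0 - ∑ k ∈ Finset.range (N * b), transformStep f δ N k x -
    ∑ c ∈ Finset.range b, (δ * N / 2) • driftTerm (planarLaplacian f) δ N c x

/-- Steps are parallel to an axis, so no mixed derivative occurs. The chosen pure derivative is the
average of the two, up to half their difference with the sign that made the choice. -/
lemma snd_fderiv_increment (D : ℂ →L[ℝ] ℂ →L[ℝ] E) {δ : ℝ} (hδ : 0 ≤ δ) (l : ℕ) (x : ℝ) :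
    (1 / 2 : ℝ) • D (increment δ l x) (increment δ l x) =
      (δ / 2) • (D 1 1 + D Complex.I Complex.I) -
        (δ / 2 * sign l x) • (D 1 1 - D Complex.I Complex.I) := by
  have hr2 : √(2 * δ) * √(2 * δ) = 2 * δ := Real.mul_self_sqrt (by linarith)
  have e1 : ∀ e : ℂ, D (sign (l + 1) x • (√(2 * δ) • e)) (sign (l + 1) x • (√(2 * δ) • e)) =
      (2 * δ) • D e e := fun e => by
    simp only [map_smul, smul_apply, smul_smul]
    congr 1
    linear_combination (√(2 * δ) * √(2 * δ)) * sign_mul_self (l + 1) x + hr2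
  rw [increment_eq, e1]
  rcases sign_eq_or l x with hs | hs
  · simp only [hs, if_true]; module
  · have : ¬ ((1 : ℝ) = -1) := by norm_num
    simp only [hs, if_neg this]; module

lemma norm_half_smul_apply_sub_le (D D' : ℂ →L[ℝ] ℂ →L[ℝ] E) {A r : ℝ} {w : ℂ}
    (hD : ‖D - D'‖ ≤ A) (hw : ‖w‖ = r) :
    ‖(1 / 2 : ℝ) • D w w - (1 / 2 : ℝ) • D' w w‖ ≤ A * r ^ 2 := by
  have h := (D - D').le_opNorm₂ w w
  rw [hw, sub_apply, sub_apply] at h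
  have hr : 0 ≤ r := hw ▸ norm_nonneg w
  rw [← smul_sub, norm_smul]
  calc _ ≤ 1 * (A * r * r) := by
        refine mul_le_mul ?_ (h.trans (by gcongr)) (norm_nonneg _) zero_le_one
        rw [Real.norm_eq_abs, abs_of_pos] <;> norm_num
    _ = _ := by ring

/-- Freezing the second derivative at the block start costs its Lipschitz constant times `N√(2δ)`;
with the cubic Taylor error this gives the bound. -/
lemma norm_step_sub_le {f : ℂ → E} {C δ : ℝ} {N : ℕ} (hf : SecondOrderBound f C)
    (hδ : 0 ≤ δ) (h : SmallStep δ N) {c i : ℕ} {x : ℝ} (hc : Inside δ N c x) (hi : i < N) :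
    ‖f (walk δ (N * c + i + 1) x) - f (walk δ (N * c + i) x) -
      fderiv ℝ f (walk δ (N * c + i) x) (increment δ (N * c + i) x) -
      ((δ / 2) • planarLaplacian f (walk δ (N * c) x) - (δ / 2 * sign (N * c + i) x) •
        (fderiv ℝ (fderiv ℝ f) (walk δ (N * c) x) 1 1 -
          fderiv ℝ (fderiv ℝ f) (walk δ (N * c) x) Complex.I Complex.I))‖ ≤
      2 * C * N * √(2 * δ) ^ 3 := by
  have hN : (1 : ℝ) ≤ N := by exact_mod_cast h.pos
  have hC := hf.nonneg
  have h0 := h.walk_mem_ball hc (Nat.zero_le N)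
  have h1 := h.walk_mem_ball hc hi.le
  have h2 := h.walk_mem_ball hc (i := i + 1) hi
  rw [add_zero] at h0
  rw [← add_assoc] at h2
  have hw : walk δ (N * c + i + 1) x - walk δ (N * c + i) x = increment δ (N * c + i) x := by
    rw [walk_succ]; ring
  have ht := hf.taylor _ h1 _ h2
  rw [hw, norm_increment] at ht
  have hl : ‖fderiv ℝ (fderiv ℝ f) (walk δ (N * c + i) x) -
      fderiv ℝ (fderiv ℝ f) (walk δ (N * c) x)‖ ≤ C * (N * √(2 * δ)) := by
    refine (hf.lipschitz_snd _ h0 _ h1).trans ?_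
    gcongr
    exact (norm_walk_add_sub_le δ (N * c) i x).trans (by gcongr)
  have hdiff := norm_half_smul_apply_sub_le _ _ hl (norm_increment δ (N * c + i) x)
  rw [planarLaplacian, ← snd_fderiv_increment _ hδ]
  have hadd := (norm_add_le _ _).trans (add_le_add ht hdiff)
  rw [sub_add_sub_cancel] at hadd
  refine hadd.trans ?_
  have hC3 : 0 ≤ C * √(2 * δ) ^ 3 := by positivity
  have := mul_le_mul_of_nonneg_left hN hC3
  calc _ = C * √(2 * δ) ^ 3 * 1 + C * √(2 * δ) ^ 3 * N := by ring
    _ ≤ C * √(2 * δ) ^ 3 * N + C * √(2 * δ) ^ 3 * N := by gcongr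
    _ = _ := by ring

/-- Since the second derivative is frozen, the sign terms of a block add up to a scalar sum times
one fixed vector. This keeps the cancellation among the signs visible. After stopping every term is
zero. -/
lemma norm_block_le {f : ℂ → E} {C δ : ℝ} {N : ℕ} (hf : SecondOrderBound f C)
    (hδ : 0 ≤ δ) (h : SmallStep δ N) (c : ℕ) (x : ℝ) :
    ‖f (stoppedWalk δ N (N * (c + 1)) x) - f (stoppedWalk δ N (N * c) x) -
      ∑ i ∈ Finset.range N, transformStep f δ N (N * c + i) x -
      (δ * N / 2) • driftTerm (planarLaplacian f) δ N c x‖ ≤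
      C * δ * |∑ i ∈ Finset.range N, sign (N * c + i) x| + 2 * C * N ^ 2 * √(2 * δ) ^ 3 := by
  have hC := hf.nonneg
  by_cases hc : Inside δ N c x
  · have hY0 : stoppedWalk δ N (N * c) x = walk δ (N * c) x := by
      have := stoppedWalk_of_inside hc (Nat.zero_le N); rwa [add_zero] at this
    have hY1 : stoppedWalk δ N (N * (c + 1)) x = walk δ (N * c + N) x :=
      stoppedWalk_of_inside hc le_rfl
    have hstep : ∀ i ∈ Finset.range N, transformStep f δ N (N * c + i) x =
        fderiv ℝ f (walk δ (N * c + i) x) (increment δ (N * c + i) x) := fun i hi => by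
      rw [Finset.mem_range] at hi
      have e := stoppedWalk_of_inside hc (i := i + 1) hi
      rw [← add_assoc] at e
      rw [transformStep, stoppedWalk_of_inside hc hi.le, e, walk_succ, add_sub_cancel_left]
    rw [driftTerm, Set.indicator_of_mem (by exact hc), hY0, hY1, Finset.sum_congr rfl hstep]
    set L := planarLaplacian f (walk δ (N * c) x)
    set q := fderiv ℝ (fderiv ℝ f) (walk δ (N * c) x) 1 1 -
      fderiv ℝ (fderiv ℝ f) (walk δ (N * c) x) Complex.I Complex.I with hq
    have hqb : ‖q‖ ≤ 2 * C := by
      have h0 := h.walk_mem_ball hc (Nat.zero_le N)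
      rw [add_zero] at h0
      have hb := hf.bound_snd _ h0
      have h1 := (fderiv ℝ (fderiv ℝ f) (walk δ (N * c) x)).le_opNorm₂ 1 1
      have h2 := (fderiv ℝ (fderiv ℝ f) (walk δ (N * c) x)).le_opNorm₂ Complex.I Complex.I
      simp only [norm_one, Complex.norm_I, mul_one] at h1 h2
      exact (norm_sub_le _ _).trans (by linarith)
    have htel : f (walk δ (N * c + N) x) - f (walk δ (N * c) x) =
        ∑ i ∈ Finset.range N,
          (f (walk δ (N * c + i + 1) x) - f (walk δ (N * c + i) x)) :=
      (Finset.sum_range_sub (fun i => f (walk δ (N * c + i) x)) N).symm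
    have hsum : f (walk δ (N * c + N) x) - f (walk δ (N * c) x) -
        ∑ i ∈ Finset.range N, fderiv ℝ f (walk δ (N * c + i) x) (increment δ (N * c + i) x) -
        (δ * N / 2) • L =
        ∑ i ∈ Finset.range N, (f (walk δ (N * c + i + 1) x) - f (walk δ (N * c + i) x) -
          fderiv ℝ f (walk δ (N * c + i) x) (increment δ (N * c + i) x) -
          ((δ / 2) • L - (δ / 2 * sign (N * c + i) x) • q)) -
        (δ / 2 * ∑ i ∈ Finset.range N, sign (N * c + i) x) • q := by
      simp only [Finset.sum_sub_distrib, Finset.sum_const, Finset.card_range, ← htel,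
        ← Finset.sum_smul, ← Finset.mul_sum]
      module
    rw [hsum]
    refine (norm_sub_le _ _).trans ?_
    have hA := norm_sum_le_of_le (Finset.range N) fun i hi =>
      norm_step_sub_le hf hδ h hc (Finset.mem_range.1 hi)
    rw [Finset.sum_const, Finset.card_range, nsmul_eq_mul] at hA
    have hB : ‖(δ / 2 * ∑ i ∈ Finset.range N, sign (N * c + i) x) • q‖ ≤
        δ / 2 * |∑ i ∈ Finset.range N, sign (N * c + i) x| * (2 * C) := by
      rw [norm_smul, Real.norm_eq_abs, abs_mul, abs_of_nonneg (by linarith : 0 ≤ δ / 2)]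
      gcongr
    calc _ ≤ _ := add_le_add hA hB
      _ = _ := by ring
  · have hstep : ∀ i ∈ Finset.range N, transformStep f δ N (N * c + i) x = 0 := fun i _ => by
      rw [transformStep, add_assoc, stoppedWalk_of_not_inside hc, stoppedWalk_of_not_inside hc,
        sub_self, map_zero]
    rw [driftTerm, Set.indicator_of_notMem (by exact hc), Finset.sum_eq_zero hstep, mul_add,
      mul_one, stoppedWalk_of_not_inside hc]
    simp only [sub_self, smul_zero, norm_zero]
    positivity

lemma norm_itoRemainder_le {f : ℂ → E} {C δ : ℝ} {N : ℕ} (hf : SecondOrderBound f C)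
    (hδ : 0 ≤ δ) (h : SmallStep δ N) (b : ℕ) (x : ℝ) :
    ‖itoRemainder f δ N b x‖ ≤ ∑ c ∈ Finset.range b,
      (C * δ * |∑ i ∈ Finset.range N, sign (N * c + i) x| + 2 * C * N ^ 2 * √(2 * δ) ^ 3) := by
  induction b with
  | zero => simp [itoRemainder, stoppedWalk_zero]
  | succ b ih =>
    have : itoRemainder f δ N (b + 1) x = itoRemainder f δ N b x +
        (f (stoppedWalk δ N (N * (b + 1)) x) - f (stoppedWalk δ N (N * b) x) -
        ∑ i ∈ Finset.range N, transformStep f δ N (N * b + i) x -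
        (δ * N / 2) • driftTerm (planarLaplacian f) δ N b x) := by
      simp only [itoRemainder]
      rw [mul_add, mul_one, Finset.sum_range_add, Finset.sum_range_succ _ b]
      abel
    rw [this, Finset.sum_range_succ]
    exact (norm_add_le _ _).trans (add_le_add ih (norm_block_le hf hδ h b x))

/-- The bound for the mean of the remainder in the discrete Itô formula up to time `T`. -/
noncomputable def itoError (C T : ℝ) (N : ℕ) : ℝ :=
  C * T * √((N : ℝ)⁻¹) + 4 * C * T * √(2 * T * (N : ℝ)⁻¹ ^ 3)

lemma tendsto_itoError (C T : ℝ) : Tendsto (itoError C T) atTop (𝓝 0) := by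
  have h : Tendsto (fun N : ℕ => (N : ℝ)⁻¹) atTop (𝓝 0) := tendsto_inv_atTop_nhds_zero_nat
  have h1 := (h.sqrt.const_mul (C * T)).add
    (((h.pow 3).const_mul (2 * T)).sqrt.const_mul (4 * C * T))
  have e : C * T * √0 + 4 * C * T * √(2 * T * 0 ^ 3) = 0 := by simp
  rw [e] at h1
  exact h1

/-- The scaling `δ = T/N⁵` acts here: over `N⁴` blocks the sign fluctuation totals `CT/√N` and the
Taylor and freezing errors are of order `N^(-3/2)`. -/
lemma block_error_eq {C T : ℝ} {N : ℕ} (hN : 0 < N) (hT : 0 ≤ T) :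
    (N : ℝ) ^ 4 * (C * timeStep T N * √N + 2 * C * N ^ 2 * √(2 * timeStep T N) ^ 3) =
      itoError C T N := by
  have hN0 : (0 : ℝ) < N := by exact_mod_cast hN
  have hs : √(N : ℝ) = N * √((N : ℝ)⁻¹) := by
    rw [Real.sqrt_inv]
    field_simp
    exact Real.sq_sqrt hN0.le
  have h2 : √(2 * timeStep T N) ^ 2 = 2 * timeStep T N :=
    Real.sq_sqrt (by unfold timeStep; positivity)
  have h3 : √(2 * timeStep T N) = √(2 * T * (N : ℝ)⁻¹ ^ 3) / N := by
    rw [eq_div_iff hN0.ne', ← Real.sqrt_sq hN0.le, ← Real.sqrt_mul (by unfold timeStep; positivity),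
      Real.sqrt_sq hN0.le]
    congr 1
    unfold timeStep; field_simp
  rw [pow_succ (√(2 * timeStep T N)) 2, h2, h3, hs, itoError, timeStep]
  field_simp
  ring

lemma dyadicAt_driftTerm {F : Type*} [NormedAddCommGroup F] (g : ℂ → F) (δ : ℝ) {N : ℕ} (hN : 0 < N) (c : ℕ) :
    DyadicAt (N * c + 1) (driftTerm g δ N c) := by
  intro x y h
  have h1 : Inside δ N c x = Inside δ N c y := dyadicAt_inside δ N c x y h
  have h2 := dyadicAt_stoppedWalk δ hN _ x y h
  by_cases hc : Inside δ N c x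
  · rw [driftTerm, Set.indicator_of_mem (by exact hc), Set.indicator_of_mem (by exact h1.mp hc), h2]
  · rw [driftTerm, Set.indicator_of_notMem (by exact hc),
      Set.indicator_of_notMem (by exact mt h1.mpr hc)]

lemma dyadicAt_transformStep (f : ℂ → E) (δ : ℝ) {N : ℕ} (hN : 0 < N) (k : ℕ) :
    DyadicAt (k + 2) (transformStep f δ N k) :=
  ((dyadicAt_stoppedWalk δ hN k).mono (Nat.le_succ _)).comp₂ (dyadicAt_stoppedWalk δ hN (k + 1))
    fun z w => fderiv ℝ f z (w - z)

lemma dyadicAt_itoRemainder (f : ℂ → E) (δ : ℝ) {N : ℕ} (hN : 0 < N) (b : ℕ) :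
    DyadicAt (N * b + 2) (itoRemainder f δ N b) := by
  have h1 : DyadicAt (N * b + 2) fun x => ∑ k ∈ Finset.range (N * b), transformStep f δ N k x :=
    DyadicAt.sum fun k hk => (dyadicAt_transformStep f δ hN k).mono
      (by have := Finset.mem_range.1 hk; omega)
  have h2 : DyadicAt (N * b + 2) fun x => ∑ c ∈ Finset.range b,
      (δ * N / 2) • driftTerm (planarLaplacian f) δ N c x :=
    DyadicAt.sum fun c hc => ((dyadicAt_driftTerm _ δ hN c).mono (by
      have : N * c ≤ N * b := by gcongr; exact (Finset.mem_range.1 hc).le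
      omega)).comp _
  have h3 := (dyadicAt_stoppedWalk δ hN (N * b)).mono (Nat.le_succ _)
  exact ((h3.comp fun z => f z - f 0).comp₂ h1 fun a b => a - b).comp₂ h2 fun a b => a - b

lemma integral_norm_itoRemainder_le {f : ℂ → E} {C T : ℝ} {N : ℕ} (hf : SecondOrderBound f C)
    (hT : 0 ≤ T) (h : SmallStep (timeStep T N) N) {b : ℕ} (hb : b ≤ N ^ 4) :
    ∫ x in Set.Ico (0 : ℝ) 1, ‖itoRemainder f (timeStep T N) N b x‖ ≤ itoError C T N := by
  have hδ : 0 ≤ timeStep T N := by unfold timeStep; positivity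
  have hC := hf.nonneg
  set δ := timeStep T N with hδd
  have hS : ∀ c, DyadicAt (N * c + N) fun x => ∑ i ∈ Finset.range N, sign (N * c + i) x :=
    fun c => DyadicAt.sum fun i hi => (dyadicAt_sign _).mono
      (by have := Finset.mem_range.1 hi; omega)
  have hI : ∀ c, IntegrableOn (fun x => C * δ * |∑ i ∈ Finset.range N, sign (N * c + i) x| +
      2 * C * N ^ 2 * √(2 * δ) ^ 3) (Set.Ico (0 : ℝ) 1) := fun c =>
    ((hS c).comp fun s => C * δ * |s| + 2 * C * N ^ 2 * √(2 * δ) ^ 3).integrableOn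
  calc _ ≤ ∫ x in Set.Ico (0 : ℝ) 1, ∑ c ∈ Finset.range b,
        (C * δ * |∑ i ∈ Finset.range N, sign (N * c + i) x| +
          2 * C * N ^ 2 * √(2 * δ) ^ 3) :=
        integral_mono (dyadicAt_itoRemainder f δ h.pos b).integrableOn.norm
          (integrable_finsetSum _ fun c _ => hI c) (norm_itoRemainder_le hf hδ h b)
    _ = ∑ c ∈ Finset.range b, ∫ x in Set.Ico (0 : ℝ) 1,
        (C * δ * |∑ i ∈ Finset.range N, sign (N * c + i) x| +
          2 * C * N ^ 2 * √(2 * δ) ^ 3) := integral_finsetSum _ fun c _ => hI c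
    _ ≤ ∑ c ∈ Finset.range b, (C * δ * √N + 2 * C * N ^ 2 * √(2 * δ) ^ 3) := by
        refine Finset.sum_le_sum fun c _ => ?_
        rw [integral_add (((hS c).comp fun s => C * δ * |s|).integrableOn)
          (integrable_const _), integral_const_mul]
        have := integral_abs_sum_sign_le (N * c) N
        have : C * δ * ∫ x in Set.Ico (0 : ℝ) 1, |∑ i ∈ Finset.range N, sign (N * c + i) x| ≤
          C * δ * √N := by gcongr
        simpa using this
    _ ≤ (N : ℝ) ^ 4 * (C * δ * √N + 2 * C * N ^ 2 * √(2 * δ) ^ 3) := by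
        rw [Finset.sum_const, Finset.card_range, nsmul_eq_mul]
        have : (b : ℝ) ≤ (N : ℝ) ^ 4 := by exact_mod_cast hb
        gcongr
    _ = _ := block_error_eq h.pos hT

/-- A crude bound from `|∑ ε| ≤ N`, not small but uniform in `x`: it confines the transform to a
fixed ball, where `t ↦ t^p` is Lipschitz. -/
lemma norm_itoRemainder_le_const {f : ℂ → E} {C T : ℝ} {N : ℕ} (hf : SecondOrderBound f C)
    (hT : 0 ≤ T) (h : SmallStep (timeStep T N) N) {b : ℕ} (hb : b ≤ N ^ 4) (x : ℝ) :
    ‖itoRemainder f (timeStep T N) N b x‖ ≤ C * T + itoError C T N := by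
  have hδ : 0 ≤ timeStep T N := by unfold timeStep; positivity
  have hC := hf.nonneg
  have hN : (0 : ℝ) < N := by exact_mod_cast h.pos
  refine (norm_itoRemainder_le hf hδ h b x).trans ?_
  have hS : ∀ c, |∑ i ∈ Finset.range N, sign (N * c + i) x| ≤ N := fun c => by
    refine (Finset.abs_sum_le_sum_abs _ _).trans ?_
    simp [abs_sign]
  calc _ ≤ ∑ c ∈ Finset.range b, (C * timeStep T N * N +
        (C * timeStep T N * √N + 2 * C * N ^ 2 * √(2 * timeStep T N) ^ 3)) := by
        refine Finset.sum_le_sum fun c _ => ?_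
        have h1 : C * timeStep T N * |∑ i ∈ Finset.range N, sign (N * c + i) x| ≤
          C * timeStep T N * N := by gcongr; exact hS c
        have h2 : 0 ≤ C * timeStep T N * √N := by positivity
        linarith
    _ ≤ (N : ℝ) ^ 4 * (C * timeStep T N * N +
        (C * timeStep T N * √N + 2 * C * N ^ 2 * √(2 * timeStep T N) ^ 3)) := by
        rw [Finset.sum_const, Finset.card_range, nsmul_eq_mul]
        have : (b : ℝ) ≤ (N : ℝ) ^ 4 := by exact_mod_cast hb
        gcongr
    _ = _ := by
        rw [mul_add, block_error_eq h.pos hT, timeStep]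
        field_simp

lemma integral_transformStep [CompleteSpace E] (f : ℂ → E) (δ : ℝ) {N : ℕ} (hN : 0 < N) (k : ℕ) :
    ∫ x in Set.Ico (0 : ℝ) 1, transformStep f δ N k x = 0 := by
  classical
  obtain ⟨c, i, hi, rfl⟩ : ∃ c i, i < N ∧ k = N * c + i :=
    ⟨k / N, k % N, Nat.mod_lt _ hN, (Nat.div_add_mod _ _).symm⟩
  -- A step equals `ε_{k+1}` times this function, which depends only on generation `k + 1`.
  set G : ℝ → E := fun x => if Inside δ N c x then fderiv ℝ f (walk δ (N * c + i) x)
    ((√(2 * δ) : ℝ) • (if sign (N * c + i) x = -1 then (1 : ℂ) else Complex.I)) else 0 with hG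
  have hGd : DyadicAt (N * c + i + 1) G := fun x y h => by
    have h1 : Inside δ N c x = Inside δ N c y :=
      (dyadicAt_inside δ N c).mono (by omega) x y h
    simp only [hG, h1, dyadicAt_walk δ _ x y h, dyadicAt_sign _ x y h]
  rw [← integral_sign_smul_eq_zero hGd]
  congr 1 with x
  by_cases hc : Inside δ N c x
  · have e := stoppedWalk_of_inside hc (i := i + 1) hi
    rw [← add_assoc] at e
    simp only [hG, if_pos hc]
    rw [transformStep, stoppedWalk_of_inside hc hi.le, e, walk_succ, add_sub_cancel_left,
      increment_eq, map_smul]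
  · simp only [hG, if_neg hc]
    rw [transformStep, add_assoc, stoppedWalk_of_not_inside hc, stoppedWalk_of_not_inside hc,
        sub_self, map_zero, smul_zero]

/-- Discrete Dynkin formula, with an error that tends to zero as `N → ∞`. -/
lemma norm_integral_sub_drift_le [CompleteSpace E] {f : ℂ → E} {C T : ℝ} {N : ℕ}
    (hf : SecondOrderBound f C)
    (hT : 0 ≤ T) (h : SmallStep (timeStep T N) N) {b : ℕ} (hb : b ≤ N ^ 4) :
    ‖(∫ x in Set.Ico (0 : ℝ) 1, f (stoppedWalk (timeStep T N) N (N * b) x)) - f 0 -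
      ∑ c ∈ Finset.range b, (timeStep T N * N / 2) • ∫ x in Set.Ico (0 : ℝ) 1,
        driftTerm (planarLaplacian f) (timeStep T N) N c x‖ ≤ itoError C T N := by
  refine le_trans (le_of_eq ?_) ((norm_integral_le_integral_norm _).trans
    (integral_norm_itoRemainder_le hf hT h hb))
  congr 1
  set δ := timeStep T N
  have i1 : IntegrableOn (fun x => f (stoppedWalk δ N (N * b) x)) (Set.Ico (0 : ℝ) 1) :=
    ((dyadicAt_stoppedWalk δ h.pos (N * b)).comp f).integrableOn
  have i2 : ∀ k ∈ Finset.range (N * b), IntegrableOn (transformStep f δ N k) (Set.Ico (0 : ℝ) 1) :=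
    fun k _ => (dyadicAt_transformStep f δ h.pos k).integrableOn
  have i3 : ∀ c ∈ Finset.range b, IntegrableOn
      (fun x => (δ * N / 2) • driftTerm (planarLaplacian f) δ N c x) (Set.Ico (0 : ℝ) 1) :=
    fun c _ => ((dyadicAt_driftTerm _ δ h.pos c).comp fun z => (δ * N / 2) • z).integrableOn
  have i4 : IntegrableOn (fun _ => f 0) (Set.Ico (0 : ℝ) 1) := by simp
  simp only [itoRemainder]
  have i5 : IntegrableOn (fun x => f (stoppedWalk δ N (N * b) x) - f 0) (Set.Ico (0 : ℝ) 1) :=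
    i1.sub i4
  have i6 : IntegrableOn (fun x => f (stoppedWalk δ N (N * b) x) - f 0 -
      ∑ k ∈ Finset.range (N * b), transformStep f δ N k x) (Set.Ico (0 : ℝ) 1) :=
    i5.sub (integrable_finsetSum _ i2)
  rw [integral_sub i6 (integrable_finsetSum _ i3),
    integral_sub i5 (integrable_finsetSum _ i2), integral_sub i1 i4,
    integral_finsetSum _ i2, integral_finsetSum _ i3]
  simp [integral_transformStep f δ h.pos, integral_smul]

end DyadicWalk

/-! ### The Laplacian on functions `z^m g(|z|²)`. -/

open Polynomial in
/-- The radial part of half the Laplacian: `(1 / 2) Δ (z ^ m g(|z|²)) = z ^ m (L g)(|z|²)`. -/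
noncomputable def radialOp (m : ℕ) : ℝ[X] →ₗ[ℝ] ℝ[X] where
  toFun g := C 2 * (X * derivative (derivative g) + C (m + 1 : ℝ) * derivative g)
  map_add' g h := by simp only [derivative_add]; ring
  map_smul' c g := by simp only [derivative_smul]; simp only [smul_eq_C_mul, RingHom.id_apply]; ring

section Sector

open Polynomial

lemma radialOp_apply (m : ℕ) (g : ℝ[X]) :
    radialOp m g = C 2 * (X * derivative (derivative g) + C (m + 1 : ℝ) * derivative g) := rfl

lemma eval_radialOp (m : ℕ) (g : ℝ[X]) (s : ℝ) : (radialOp m g).eval s =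
    2 * (s * (derivative (derivative g)).eval s + (m + 1) * (derivative g).eval s) := by
  simp [radialOp_apply]

/-- `L` lowers degrees by exactly one, so the resolvent equation becomes a two-term recursion for
coefficients. -/
lemma radialOp_monomial_succ (m j : ℕ) (c : ℝ) : radialOp m (monomial (j + 1) c) =
    monomial j (2 * c * (j + 1) * (j + 1 + m)) := by
  rw [radialOp_apply]
  rcases j with _ | j
  · simp only [derivative_monomial, C_mul_monomial, zero_add, Nat.sub_self,
      Nat.cast_zero, mul_zero, map_zero]
    congr 1
    push_cast
    ring
  · simp only [derivative_monomial, X_mul_monomial, C_mul_monomial, Nat.add_sub_cancel,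
      ← (monomial (j + 1)).map_add]
    congr 1
    push_cast
    ring

/-- The function `z ^ m g(|z|²)` on the plane. -/
noncomputable def sectorFun (m : ℕ) (g : ℝ[X]) (z : ℂ) : ℂ :=
  z ^ m * ((g.eval (Complex.normSq z) : ℝ) : ℂ)

/-- The monomial `z ^ a (conj z) ^ b`. -/
noncomputable def conjMonomial (a b : ℕ) (z : ℂ) : ℂ := z ^ a * (starRingEnd ℂ z) ^ b

lemma hasFDerivAt_conjMonomial (a b : ℕ) (z : ℂ) :
    HasFDerivAt (conjMonomial a b)
      ((a * conjMonomial (a - 1) b z) • ContinuousLinearMap.id ℝ ℂ +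
        (b * conjMonomial a (b - 1) z) • (Complex.conjCLE : ℂ →L[ℝ] ℂ)) z := by
  have h1 := (hasDerivAt_pow a z).hasFDerivAt.restrictScalars ℝ
  have h2 := ((hasDerivAt_pow b (Complex.conjCLE z)).hasFDerivAt.restrictScalars ℝ).comp z
    (Complex.conjCLE.hasFDerivAt (x := z))
  refine (h1.mul h2).congr_fderiv ?_
  ext v
  simp [conjMonomial]
  ring

lemma planarLaplacian_conjMonomial (a b : ℕ) (z : ℂ) :
    planarLaplacian (conjMonomial a b) z = 4 * a * b * conjMonomial (a - 1) (b - 1) z := by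
  have h1 : fderiv ℝ (conjMonomial a b) = fun z =>
      (a * conjMonomial (a - 1) b z) • ContinuousLinearMap.id ℝ ℂ +
        (b * conjMonomial a (b - 1) z) • (Complex.conjCLE : ℂ →L[ℝ] ℂ) :=
    funext fun z => (hasFDerivAt_conjMonomial a b z).fderiv
  have h2 := (((hasFDerivAt_conjMonomial (a - 1) b z).const_mul (a : ℂ)).smul_const
    (ContinuousLinearMap.id ℝ ℂ)).fun_add
    (((hasFDerivAt_conjMonomial a (b - 1) z).const_mul (b : ℂ)).smul_const
    (Complex.conjCLE : ℂ →L[ℝ] ℂ))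
  rw [planarLaplacian, h1]
  have h3 := h2.fderiv
  simp only [h3]
  simp
  linear_combination (↑a * (↑(a - 1) * conjMonomial (a - 1 - 1) b z)+
    b * ((b - 1 : ℕ) * conjMonomial a (b - 1 - 1) z) - 2 * a * b * conjMonomial (a - 1) (b - 1) z) * Complex.I_mul_I

lemma contDiff_conjMonomial (a b : ℕ) {n : WithTop ℕ∞} : ContDiff ℝ n (conjMonomial a b) := by
  have h : ContDiff ℝ n fun z : ℂ => starRingEnd ℂ z := Complex.conjCLE.contDiff
  exact (contDiff_id.pow a).mul (h.pow b)

lemma sectorFun_monomial (m j : ℕ) (c : ℝ) :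
    sectorFun m (monomial j c) = fun z => (c : ℂ) * conjMonomial (m + j) j z := by
  ext z
  rw [sectorFun, conjMonomial, eval_monomial]
  push_cast
  rw [← Complex.mul_conj]
  ring

lemma sectorFun_add (m : ℕ) (g h : ℝ[X]) :
    sectorFun m (g + h) = fun z => sectorFun m g z + sectorFun m h z := by
  ext z; simp [sectorFun]; ring

lemma sectorFun_smul (m : ℕ) (c : ℝ) (g : ℝ[X]) :
    sectorFun m (c • g) = fun z => (c : ℂ) * sectorFun m g z := by
  ext z; simp [sectorFun]; ring

lemma contDiff_sectorFun (m : ℕ) (g : ℝ[X]) {n : WithTop ℕ∞} : ContDiff ℝ n (sectorFun m g) := by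
  induction g using Polynomial.induction_on' with
  | add g h hg hh => rw [sectorFun_add]; exact hg.add hh
  | monomial j c => rw [sectorFun_monomial]; exact contDiff_const.mul (contDiff_conjMonomial _ _)

lemma planarLaplacian_add {f g : ℂ → ℂ} (hf : ContDiff ℝ 2 f) (hg : ContDiff ℝ 2 g) (z : ℂ) :
    planarLaplacian (fun z => f z + g z) z = planarLaplacian f z + planarLaplacian g z := by
  have h1 : fderiv ℝ (fun z => f z + g z) = fun z => fderiv ℝ f z + fderiv ℝ g z := by
    ext1 z
    exact fderiv_fun_add (hf.differentiable (by norm_num) z) (hg.differentiable (by norm_num) z)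
  have h2 : fderiv ℝ (fun z => fderiv ℝ f z + fderiv ℝ g z) z =
      fderiv ℝ (fderiv ℝ f) z + fderiv ℝ (fderiv ℝ g) z :=
    fderiv_fun_add ((hf.fderiv_right (m := 1) (by norm_num)).differentiable (by norm_num) z)
      ((hg.fderiv_right (m := 1) (by norm_num)).differentiable (by norm_num) z)
  simp only [planarLaplacian, h1, h2, add_apply]
  ring

lemma planarLaplacian_const_mul {f : ℂ → ℂ} (hf : ContDiff ℝ 2 f) (c z : ℂ) :
    planarLaplacian (fun z => c * f z) z = c * planarLaplacian f z := by
  have h1 : fderiv ℝ (fun z => c * f z) = fun z => c • fderiv ℝ f z := by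
    ext1 z
    exact fderiv_const_mul (hf.differentiable (by norm_num) z) c
  have h2 : fderiv ℝ (fun z => c • fderiv ℝ f z) z = c • fderiv ℝ (fderiv ℝ f) z :=
    fderiv_fun_const_smul
      ((hf.fderiv_right (m := 1) (by norm_num)).differentiable (by norm_num) z) c
  simp only [planarLaplacian, h1, h2, smul_apply, smul_eq_mul]
  ring

lemma planarLaplacian_sectorFun (m : ℕ) (g : ℝ[X]) (z : ℂ) :
    planarLaplacian (sectorFun m g) z = 2 * sectorFun m (radialOp m g) z := by
  induction g using Polynomial.induction_on' with
  | add g h hg hh =>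
    rw [sectorFun_add, planarLaplacian_add (contDiff_sectorFun _ _) (contDiff_sectorFun _ _),
      hg, hh, map_add, sectorFun_add]
    ring
  | monomial j c =>
    rw [sectorFun_monomial, planarLaplacian_const_mul (contDiff_conjMonomial _ _),
      planarLaplacian_conjMonomial]
    rcases j with _ | j
    · simp [radialOp_apply, sectorFun]
    · rw [radialOp_monomial_succ, sectorFun_monomial]
      simp only [← add_assoc, Nat.add_sub_cancel]
      push_cast
      ring

lemma exists_secondOrderBound_sectorFun (m : ℕ) (g : ℝ[X]) :
    ∃ C, SecondOrderBound (sectorFun m g) C :=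
  exists_secondOrderBound (contDiff_sectorFun m g).contDiffOn

lemma norm_sectorFun_le {m : ℕ} {g : ℝ[X]} {z : ℂ} {A : ℝ} (hz : ‖z‖ ≤ 1)
    (hA : |g.eval (Complex.normSq z)| ≤ A) : ‖sectorFun m g z‖ ≤ A := by
  rw [sectorFun, norm_mul, norm_pow, Complex.norm_real]
  exact (mul_le_of_le_one_left (norm_nonneg _) (pow_le_one₀ (norm_nonneg _) hz)).trans hA

end Sector

/-! ### The resolvent equation `g - τ L g = h` with Dirichlet condition. -/

section Resolvent

open Polynomial

/-- `|g| ≤ A` on the unit interval. -/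
def UnitBounded (g : ℝ[X]) (A : ℝ) : Prop := ∀ s ∈ Set.Icc (0 : ℝ) 1, |g.eval s| ≤ A

lemma exists_unitBounded (g : ℝ[X]) : ∃ A, 0 ≤ A ∧ UnitBounded g A := by
  obtain ⟨A, hA⟩ := (isCompact_Icc (a := (0 : ℝ)) (b := 1)).exists_bound_of_continuousOn
    g.continuous.continuousOn
  exact ⟨A, (norm_nonneg _).trans (hA 0 (by simp)), hA⟩

/-- At a maximum point `s₀ < 1` one has `L g ≤ 0`: inside, `g' = 0` and `g'' ≤ 0`; at `s₀ = 0` the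
second order term degenerates and `g'(0) ≤ 0` is enough. So no boundary condition is needed at `0`.
-/
lemma eval_le_of_resolvent_le {m : ℕ} {τ A : ℝ} {g : ℝ[X]} (hτ : 0 ≤ τ)
    (h : ∀ s ∈ Set.Icc (0 : ℝ) 1, (g - τ • radialOp m g).eval s ≤ A) (h1 : g.eval 1 ≤ A)
    {s : ℝ} (hs : s ∈ Set.Icc (0 : ℝ) 1) : g.eval s ≤ A := by
  obtain ⟨s₀, hs₀, hmax⟩ := (isCompact_Icc (a := (0 : ℝ)) (b := 1)).exists_isMaxOn
    ⟨0, by simp⟩ g.continuous.continuousOn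
  refine (hmax hs).trans ?_
  rcases hs₀.2.eq_or_lt with rfl | hlt
  · exact h1
  have hkey : s₀ * (derivative (derivative g)).eval s₀ + (m + 1) * (derivative g).eval s₀ ≤ 0 := by
    rcases hs₀.1.eq_or_lt with rfl | hpos
    · have hd : (derivative g).eval 0 ≤ 0 := by
        have hd := (g.hasDerivAt 0).hasDerivWithinAt (s := Set.Ioi 0)
        rw [hasDerivWithinAt_iff_tendsto_slope' (by simp)] at hd
        refine le_of_tendsto hd ?_
        filter_upwards [Ioo_mem_nhdsGT (zero_lt_one (α := ℝ))] with t ht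
        rw [slope_def_field]
        exact div_nonpos_of_nonpos_of_nonneg
          (sub_nonpos.2 (hmax ⟨ht.1.le, ht.2.le⟩)) (by linarith [ht.1])
      rw [zero_mul, zero_add]
      exact mul_nonpos_of_nonneg_of_nonpos (by positivity) hd
    · have hloc : IsLocalMax (fun t => g.eval t) s₀ := hmax.isLocalMax (Icc_mem_nhds hpos hlt)
      have hD : ∀ p : ℝ[X], deriv (fun t => p.eval t) = fun t => (derivative p).eval t :=
        fun p => funext fun t => p.deriv
      have hd : (derivative g).eval s₀ = 0 := by
        have := hloc.deriv_eq_zero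
        rwa [hD] at this
      have hdd : (derivative (derivative g)).eval s₀ ≤ 0 := by
        -- With `g'' > 0` the point would also be a local minimum, so `g` would be locally constant
        -- and `g'' = 0`.
        by_contra! hcon
        have hmin : IsLocalMin (fun t => g.eval t) s₀ :=
          isLocalMin_of_deriv_deriv_pos (by simpa only [hD] using hcon)
            (by simpa only [hD] using hd) g.continuous.continuousAt
        have hconst : (fun t => g.eval t) =ᶠ[𝓝 s₀] fun _ => g.eval s₀ := by
          filter_upwards [hloc, hmin] with t h1 h2 using le_antisymm h1 h2
        have h0 := hconst.deriv.deriv.self_of_nhds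
        simp only [hD, deriv_const'] at h0
        exact hcon.ne' h0
      rw [hd, mul_zero, add_zero]
      exact mul_nonpos_of_nonneg_of_nonpos hpos.le hdd
  have := h s₀ hs₀
  rw [eval_sub, eval_smul, eval_radialOp, smul_eq_mul] at this
  nlinarith [mul_nonpos_of_nonneg_of_nonpos hτ hkey]

/-- Maximum principle for `g - τ L g = h`. -/
lemma UnitBounded.of_resolvent {m : ℕ} {τ A : ℝ} {g : ℝ[X]} (hτ : 0 ≤ τ)
    (h : UnitBounded (g - τ • radialOp m g) A) (h1 : |g.eval 1| ≤ A) : UnitBounded g A := by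
  intro s hs
  rw [abs_le]
  constructor
  · have := eval_le_of_resolvent_le (m := m) (g := -g) (A := A) hτ (fun t ht => by
      have := (abs_le.1 (h t ht)).1
      have e : -g - τ • radialOp m (-g) = -(g - τ • radialOp m g) := by
        rw [map_neg]; simp; ring
      rw [e, eval_neg]; linarith) (by rw [eval_neg]; linarith [(abs_le.1 h1).1]) hs
    rw [eval_neg] at this; linarith
  · exact eval_le_of_resolvent_le hτ (fun t ht => (abs_le.1 (h t ht)).2) (abs_le.1 h1).2 hs

/-- Coefficients of the power series solution of `g - τ L g = ∑ h_j X ^ j` with `g(0) = θ`. -/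
noncomputable def resolventCoeff (m : ℕ) (τ : ℝ) (h : ℕ → ℝ) (θ : ℝ) : ℕ → ℝ
  | 0 => θ
  | j + 1 => (resolventCoeff m τ h θ j - h j) / (2 * τ * (j + 1) * (j + 1 + m))

/-- The solution is affine in its free parameter `θ`, which leaves `θ` available to enforce the
boundary condition at `1`. -/
lemma resolventCoeff_eq (m : ℕ) (τ : ℝ) (h : ℕ → ℝ) (θ : ℝ) (j : ℕ) :
    resolventCoeff m τ h θ j =
      resolventCoeff m τ h 0 j + θ * resolventCoeff m τ (fun _ => 0) 1 j := by
  induction j with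
  | zero => simp [resolventCoeff]
  | succ j ih => simp only [resolventCoeff]; rw [ih]; ring

lemma resolventCoeff_nonneg (m : ℕ) {τ : ℝ} (hτ : 0 < τ) (j : ℕ) :
    0 ≤ resolventCoeff m τ (fun _ => 0) 1 j := by
  induction j with
  | zero => simp [resolventCoeff]
  | succ j ih => simp only [resolventCoeff]; rw [sub_zero]; positivity

/-- Coefficients decay superexponentially. The weight dominates the factors that `L` and `L²` put on
a monomial of degree `j`. -/
lemma summable_of_resolvent_recursion {m : ℕ} {τ : ℝ} (hτ : 0 < τ) {x : ℕ → ℝ} {J : ℕ}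
    (hx : ∀ j ≥ J, x (j + 1) = x j / (2 * τ * (j + 1) * (j + 1 + m))) :
    Summable fun j : ℕ => (2 * (j : ℝ) * (j + m) + 1) ^ 2 * |x j| := by
  refine summable_of_ratio_norm_eventually_le (r := 1 / 2) (by norm_num) ?_
  filter_upwards [eventually_ge_atTop J, eventually_ge_atTop 1,
    eventually_ge_atTop ⌈32 / τ⌉₊] with j hJ h1 hj
  have h1' : (1 : ℝ) ≤ j := by exact_mod_cast h1
  have hm : (0 : ℝ) ≤ m := Nat.cast_nonneg m
  have hj' : 32 / τ ≤ j := (Nat.le_ceil _).trans (by exact_mod_cast hj)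
  rw [div_le_iff₀ hτ] at hj'
  rw [Real.norm_of_nonneg (by positivity), Real.norm_of_nonneg (by positivity), hx j hJ]
  push_cast
  set p : ℝ := 2 * j * (j + m) with hp
  set q : ℝ := 2 * ((j : ℝ) + 1) * (j + 1 + m) with hq
  have hjm : 0 ≤ (j : ℝ) * m := by positivity
  have hjm' : (m : ℝ) ≤ j * m := by nlinarith
  have hp0 : 0 ≤ p := by positivity
  have hqp : q ≤ 4 * p := by rw [hq, hp]; nlinarith
  have hqj : (j : ℝ) ≤ q := by rw [hq]; nlinarith
  have hq0 : 0 < q := by positivity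
  have e : 2 * τ * ((j : ℝ) + 1) * (j + 1 + m) = τ * q := by rw [hq]; ring
  rw [e, abs_div, abs_of_pos (by positivity : 0 < τ * q), mul_div_assoc', div_le_iff₀ (by positivity)]
  have h2 : (q + 1) ^ 2 ≤ 16 * (p + 1) ^ 2 := by nlinarith
  have h3 : 32 ≤ τ * q := by nlinarith
  calc (q + 1) ^ 2 * |x j| ≤ 16 * (p + 1) ^ 2 * |x j| := by gcongr
    _ = 1 / 2 * ((p + 1) ^ 2 * |x j|) * 32 := by ring
    _ ≤ _ := by gcongr

lemma unitBounded_monomial (j : ℕ) (c : ℝ) : UnitBounded (monomial j c) |c| := by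
  intro s hs
  rw [eval_monomial, abs_mul, abs_pow, abs_of_nonneg hs.1]
  exact mul_le_of_le_one_right (abs_nonneg _) (pow_le_one₀ hs.1 hs.2)

lemma UnitBounded.mono {g : ℝ[X]} {A B : ℝ} (h : UnitBounded g A) (hAB : A ≤ B) :
    UnitBounded g B := fun s hs => (h s hs).trans hAB

/-- Because the recursion has two terms, truncating the series spoils the equation only by its top
monomial. -/
lemma resolvent_sum_eq {m : ℕ} {τ : ℝ} (hτ : 0 < τ) (h : ℝ[X]) (θ : ℝ) {K : ℕ}
    (hK : h.natDegree < K) :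
    (∑ j ∈ Finset.range (K + 1), monomial j (resolventCoeff m τ h.coeff θ j)) -
      τ • radialOp m (∑ j ∈ Finset.range (K + 1), monomial j (resolventCoeff m τ h.coeff θ j)) =
    h + monomial K (resolventCoeff m τ h.coeff θ K) := by
  set x := resolventCoeff m τ h.coeff θ with hx
  have h0 : radialOp m (monomial 0 (x 0)) = 0 := by simp [radialOp_apply]
  have h1 : ∀ j, τ • radialOp m (monomial (j + 1) (x (j + 1))) =
      monomial j (x j) - monomial j (h.coeff j) := fun j => by
    rw [radialOp_monomial_succ, smul_monomial, ← map_sub]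
    congr 1
    simp only [hx, resolventCoeff, smul_eq_mul]
    field_simp
  rw [map_sum, Finset.sum_range_succ' (fun j => radialOp m (monomial j (x j))), h0, add_zero,
    Finset.smul_sum, Finset.sum_congr rfl fun j _ => h1 j, Finset.sum_sub_distrib,
    Finset.sum_range_succ, ← h.as_sum_range' K hK]
  ring

/-- Approximate polynomial solution of the resolvent equation with Dirichlet boundary condition. -/
lemma exists_approx_resolvent (m : ℕ) {τ η : ℝ} (hτ : 0 < τ) (hη : 0 < η) (h : ℝ[X]) :
    ∃ g e : ℝ[X], g.eval 1 = 0 ∧ g - τ • radialOp m g = h + e ∧ UnitBounded e η ∧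
      UnitBounded (radialOp m e) η ∧ UnitBounded (radialOp m (radialOp m e)) η := by
  set a := resolventCoeff m τ h.coeff 0 with ha
  set b := resolventCoeff m τ (fun _ => 0) 1 with hb
  have hb0 : ∀ j, 0 ≤ b j := resolventCoeff_nonneg m hτ
  have sa : Summable fun j : ℕ => (2 * (j : ℝ) * (j + m) + 1) ^ 2 * |a j| :=
    summable_of_resolvent_recursion hτ (J := h.natDegree + 1) fun j hj => by
      simp only [ha, resolventCoeff]
      rw [coeff_eq_zero_of_natDegree_lt (by omega), sub_zero]
  have sb : Summable fun j : ℕ => (2 * (j : ℝ) * (j + m) + 1) ^ 2 * |b j| :=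
    summable_of_resolvent_recursion hτ (J := 0) fun j _ => by
      simp only [hb, resolventCoeff]; rw [sub_zero]
  have sa' : Summable fun j : ℕ => |a j| := by
    refine Summable.of_nonneg_of_le (fun _ => abs_nonneg _) (fun j => ?_) sa
    refine le_mul_of_one_le_left (abs_nonneg _) (one_le_pow₀ ?_)
    have : 0 ≤ 2 * (j : ℝ) * (j + m) := by positivity
    linarith
  set S := ∑' j, |a j|
  have hS0 : 0 ≤ S := tsum_nonneg fun _ => abs_nonneg _
  have hlim := sa.tendsto_atTop_zero.add (sb.tendsto_atTop_zero.const_mul S)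
  rw [mul_zero, add_zero] at hlim
  obtain ⟨K, hKη, hKh⟩ := ((hlim.eventually_le_const hη).and
    (eventually_gt_atTop (h.natDegree + 1))).exists
  have hB : 1 ≤ ∑ j ∈ Finset.range (K + 1), b j := by
    have := Finset.single_le_sum (f := b) (fun j _ => hb0 j) (Finset.mem_range.2 (Nat.succ_pos K))
    simpa [hb, resolventCoeff] using this
  -- The choice of `θ` that makes the truncated sum vanish at `1`. The homogeneous coefficients are
  -- nonnegative and start with `1`, so the denominator is at least `1` and `|θ| ≤ S` for every
  -- truncation `K`.
  set θ := -(∑ j ∈ Finset.range (K + 1), a j) / ∑ j ∈ Finset.range (K + 1), b j with hθ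
  have hθS : |θ| ≤ S := by
    rw [hθ, abs_div, abs_neg, div_le_iff₀ (by positivity),
      abs_of_pos (by linarith : 0 < ∑ j ∈ Finset.range (K + 1), b j)]
    calc _ ≤ ∑ j ∈ Finset.range (K + 1), |a j| := Finset.abs_sum_le_sum_abs _ _
      _ ≤ S := sa'.sum_le_tsum _ fun _ _ => abs_nonneg _
      _ ≤ _ := le_mul_of_one_le_right hS0 hB
  set x := resolventCoeff m τ h.coeff θ with hx
  have hxab : ∀ j, x j = a j + θ * b j := resolventCoeff_eq m τ h.coeff θ
  have hxK : (2 * (K : ℝ) * (K + m) + 1) ^ 2 * |x K| ≤ η := by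
    refine le_trans ?_ hKη
    have : |x K| ≤ |a K| + S * |b K| := by
      rw [hxab]
      refine (abs_add_le _ _).trans ?_
      rw [abs_mul]
      gcongr
    calc _ ≤ (2 * (K : ℝ) * (K + m) + 1) ^ 2 * (|a K| + S * |b K|) := by gcongr
      _ = _ := by ring
  obtain ⟨k, rfl⟩ : ∃ k, K = k + 2 := ⟨K - 2, by omega⟩
  refine ⟨∑ j ∈ Finset.range (k + 2 + 1), monomial j (x j), monomial (k + 2) (x (k + 2)), ?_,
    resolvent_sum_eq hτ h θ (by omega), ?_, ?_, ?_⟩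
  · rw [eval_finsetSum]
    simp only [eval_monomial, one_pow, mul_one, hxab, Finset.sum_add_distrib, ← Finset.mul_sum, hθ]
    field_simp
    ring
  all_goals
    have hp : 0 ≤ 2 * ((k : ℝ) + 2) * (k + 2 + m) := by positivity
    push_cast at hxK
  · refine (unitBounded_monomial _ _).mono (le_trans ?_ hxK)
    exact le_mul_of_one_le_left (abs_nonneg _) (one_le_pow₀ (by linarith))
  · rw [radialOp_monomial_succ]
    refine (unitBounded_monomial _ _).mono (le_trans (le_of_eq ?_) ((mul_le_mul_of_nonneg_right
      (by nlinarith : 2 * ((k : ℝ) + 2) * (k + 2 + m) ≤ (2 * ((k : ℝ) + 2) * (k + 2 + m) + 1) ^ 2)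
      (abs_nonneg (x (k + 2)))).trans hxK))
    rw [← abs_of_nonneg hp, ← abs_mul]
    congr 1
    push_cast; ring
  · rw [radialOp_monomial_succ, radialOp_monomial_succ]
    have hq : 0 ≤ 2 * ((k : ℝ) + 1) * (k + 1 + m) := by positivity
    have hqp : 2 * ((k : ℝ) + 1) * (k + 1 + m) ≤ 2 * ((k : ℝ) + 2) * (k + 2 + m) := by
      gcongr <;> linarith
    refine (unitBounded_monomial _ _).mono (le_trans (le_of_eq ?_) ((mul_le_mul_of_nonneg_right
      (by nlinarith : (2 * ((k : ℝ) + 2) * (k + 2 + m)) * (2 * ((k : ℝ) + 1) * (k + 1 + m)) ≤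
        (2 * ((k : ℝ) + 2) * (k + 2 + m) + 1) ^ 2)
      (abs_nonneg (x (k + 2)))).trans hxK))
    rw [← abs_of_nonneg (mul_nonneg hp hq), ← abs_mul]
    congr 1
    push_cast; ring

end Resolvent

/-! ### Means of the stopped walk and one Euler step. -/

namespace DyadicWalk

open Polynomial

/-- The mean of `φ` at the stopped walk sampled at the end of the block of index `b`. -/
noncomputable def stoppedMean (T : ℝ) (N b : ℕ) (φ : ℂ → ℂ) : ℂ :=
  ∫ x in Set.Ico (0 : ℝ) 1, φ (stoppedWalk (timeStep T N) N (N * b) x)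

/-- The mean of `φ` at the walk on the event that it has not been stopped. -/
noncomputable def insideMean (T : ℝ) (N c : ℕ) (φ : ℂ → ℂ) : ℂ :=
  ∫ x in Set.Ico (0 : ℝ) 1, driftTerm φ (timeStep T N) N c x

variable {T : ℝ} {N : ℕ}

lemma integrableOn_stoppedWalk {F : Type*} [NormedAddCommGroup F] (T : ℝ) (hN : 0 < N) (b : ℕ)
    (φ : ℂ → F) :
    IntegrableOn (fun x => φ (stoppedWalk (timeStep T N) N (N * b) x)) (Set.Ico (0 : ℝ) 1) :=
  ((dyadicAt_stoppedWalk (timeStep T N) hN (N * b)).comp φ).integrableOn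

lemma norm_setIntegral_Ico_le {F : Type*} [NormedAddCommGroup F] [NormedSpace ℝ F]
    {g : ℝ → F} {A : ℝ} (hg : ∀ x, ‖g x‖ ≤ A) : ‖∫ x in Set.Ico (0 : ℝ) 1, g x‖ ≤ A := by
  have := norm_setIntegral_le_of_norm_le_const (μ := volume) (s := Set.Ico (0 : ℝ) 1) (f := g)
    (C := A) (by simp) fun x _ => hg x
  simpa using this

lemma stoppedMean_add (hN : 0 < N) (b : ℕ) (φ ψ : ℂ → ℂ) :
    stoppedMean T N b (fun z => φ z + ψ z) = stoppedMean T N b φ + stoppedMean T N b ψ :=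
  integral_add (integrableOn_stoppedWalk T hN b φ) (integrableOn_stoppedWalk T hN b ψ)

lemma stoppedMean_const_mul (b : ℕ) (c : ℂ) (φ : ℂ → ℂ) :
    stoppedMean T N b (fun z => c * φ z) = c * stoppedMean T N b φ :=
  integral_const_mul _ _

lemma stoppedMean_sectorFun_sub (hN : 0 < N) (b m : ℕ) (g h : ℝ[X]) :
    stoppedMean T N b (sectorFun m (g - h)) =
      stoppedMean T N b (sectorFun m g) - stoppedMean T N b (sectorFun m h) := by
  rw [eq_sub_iff_add_eq, ← stoppedMean_add hN, ← sectorFun_add, sub_add_cancel]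

lemma stoppedMean_sectorFun_smul (b m : ℕ) (c : ℝ) (g : ℝ[X]) :
    stoppedMean T N b (sectorFun m (c • g)) = c * stoppedMean T N b (sectorFun m g) := by
  rw [sectorFun_smul, stoppedMean_const_mul]

lemma norm_stoppedMean_le {φ : ℂ → ℂ} {A : ℝ} (h : SmallStep (timeStep T N) N)
    (hφ : ∀ z ∈ Metric.ball (0 : ℂ) 1, ‖φ z‖ ≤ A) (b : ℕ) : ‖stoppedMean T N b φ‖ ≤ A :=
  norm_setIntegral_Ico_le fun x => hφ _ (h.stoppedWalk_mem_ball _ x)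

lemma norm_sectorFun_le_of_unitBounded {m : ℕ} {g : ℝ[X]} {A : ℝ} (hg : UnitBounded g A)
    {z : ℂ} (hz : z ∈ Metric.ball (0 : ℂ) 1) : ‖sectorFun m g z‖ ≤ A := by
  rw [mem_ball_zero_iff] at hz
  refine norm_sectorFun_le hz.le (hg _ ⟨Complex.normSq_nonneg z, ?_⟩)
  rw [Complex.normSq_eq_norm_sq]
  exact pow_le_one₀ (norm_nonneg _) hz.le

lemma norm_insideMean_le {φ : ℂ → ℂ} {A : ℝ} (h : SmallStep (timeStep T N) N) (hA : 0 ≤ A)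
    (hφ : ∀ z ∈ Metric.ball (0 : ℂ) 1, ‖φ z‖ ≤ A) (c : ℕ) : ‖insideMean T N c φ‖ ≤ A := by
  refine norm_setIntegral_Ico_le fun x => ?_
  rw [driftTerm]
  by_cases hc : Inside (timeStep T N) N c x
  · rw [Set.indicator_of_mem (by exact hc)]
    exact hφ _ (h.stoppedWalk_mem_ball _ x)
  · rw [Set.indicator_of_notMem (by exact hc), norm_zero]
    exact hA

/-- The two means differ only on paths already stopped, which sit in the annulus `1 - 1/N ≤ |z| <
1`. -/
lemma norm_insideMean_sub_stoppedMean_le {φ : ℂ → ℂ} {A : ℝ} (h : SmallStep (timeStep T N) N)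
    (hA : 0 ≤ A) (hφ : ∀ z ∈ Metric.ball (0 : ℂ) 1, 1 - 1 / (N : ℝ) ≤ ‖z‖ → ‖φ z‖ ≤ A) (c : ℕ) :
    ‖insideMean T N c φ - stoppedMean T N c φ‖ ≤ A := by
  rw [insideMean, stoppedMean, ← integral_sub
    (dyadicAt_driftTerm φ (timeStep T N) h.pos c).integrableOn
    (integrableOn_stoppedWalk T h.pos c φ)]
  refine norm_setIntegral_Ico_le fun x => ?_
  rw [driftTerm]
  by_cases hc : Inside (timeStep T N) N c x
  · rw [Set.indicator_of_mem (by exact hc), sub_self, norm_zero]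
    exact hA
  · rw [Set.indicator_of_notMem (by exact hc), zero_sub, norm_neg]
    exact hφ _ (h.stoppedWalk_mem_ball _ x) (h.le_norm_stoppedWalk hc)

lemma exists_abs_eval_le_add (g : ℝ[X]) :
    ∃ Λ, 0 ≤ Λ ∧ ∀ s ∈ Set.Icc (0 : ℝ) 1, |g.eval s| ≤ |g.eval 1| + Λ * (1 - s) := by
  obtain ⟨q, hq⟩ := X_sub_C_dvd_sub_C_eval (a := (1 : ℝ)) (p := g)
  obtain ⟨Λ, h0, hΛ⟩ := exists_unitBounded q
  refine ⟨Λ, h0, fun s hs => ?_⟩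
  have h1 : g.eval s = g.eval 1 + (s - 1) * q.eval s := by
    have := congrArg (eval s) hq
    simp at this
    linarith
  rw [h1]
  refine (abs_add_le _ _).trans ?_
  rw [abs_mul, abs_sub_comm, abs_of_nonneg (sub_nonneg.2 hs.2), mul_comm]
  gcongr
  · linarith [hs.2]
  · exact hΛ s hs

lemma one_sub_normSq_le {z : ℂ} (h : SmallStep (timeStep T N) N)
    (hz : 1 - 1 / (N : ℝ) ≤ ‖z‖) : 1 - Complex.normSq z ≤ 2 / N := by
  rw [Complex.normSq_eq_norm_sq]
  have h2 : (2 : ℝ) ≤ N := by exact_mod_cast h.1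
  have h3 : 1 / (N : ℝ) ≤ 1 := by rw [div_le_one (by linarith)]; linarith
  have h4 : 2 / (N : ℝ) = 2 * (1 / N) := by ring
  nlinarith [sq_nonneg (1 / (N : ℝ))]

/-- The difference of the Dynkin formulas from time `0` to `b` and to `a`, whence the factor `2`. -/
lemma norm_dynkin_le (m : ℕ) {g : ℝ[X]} {C : ℝ} (hC : SecondOrderBound (sectorFun m g) C)
    (hT : 0 ≤ T) (h : SmallStep (timeStep T N) N) {a b : ℕ} (hab : a ≤ b) (hb : b ≤ N ^ 4) :
    ‖stoppedMean T N b (sectorFun m g) - stoppedMean T N a (sectorFun m g) -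
      (timeStep T N * N : ℝ) * ∑ c ∈ Finset.Ico a b, insideMean T N c (sectorFun m (radialOp m g))‖
      ≤ 2 * itoError C T N := by
  have hd : ∀ c, (timeStep T N * N / 2) • (∫ x in Set.Ico (0 : ℝ) 1,
        driftTerm (planarLaplacian (sectorFun m g)) (timeStep T N) N c x) =
      ((timeStep T N * N : ℝ) : ℂ) * insideMean T N c (sectorFun m (radialOp m g)) := fun c => by
    have e : driftTerm (planarLaplacian (sectorFun m g)) (timeStep T N) N c = fun x =>
        2 * driftTerm (sectorFun m (radialOp m g)) (timeStep T N) N c x := by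
      ext x
      rw [driftTerm, driftTerm, ← Set.indicator_const_mul]
      simp only [planarLaplacian_sectorFun]
    rw [e, integral_const_mul, insideMean, Complex.real_smul]
    push_cast
    ring
  have h1 := norm_integral_sub_drift_le hC hT h hb
  have h2 := norm_integral_sub_drift_le hC hT h (hab.trans hb)
  simp only [hd, ← Finset.mul_sum] at h1 h2
  have hsum := Finset.sum_range_add_sum_Ico
    (fun c => insideMean T N c (sectorFun m (radialOp m g))) hab
  rw [← hsum] at h1
  have := (norm_sub_le _ _).trans (add_le_add h1 h2)
  rw [two_mul]
  refine le_trans (le_of_eq ?_) this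
  congr 1
  rw [stoppedMean, stoppedMean]
  ring

/-- One backward Euler step for the means of the stopped walk. -/
lemma exists_euler_step (hT : 0 ≤ T) (m : ℕ) (g : ℝ[X]) {A : ℝ}
    (hA : UnitBounded (radialOp m (radialOp m g)) A) :
    ∃ ρ : ℕ → ℝ, Tendsto ρ atTop (𝓝 0) ∧ ∀ᶠ N : ℕ in atTop, ∀ a b : ℕ, a ≤ b → b ≤ N ^ 4 →
      ∀ t : ℝ, t = timeStep T N * N * (b - a : ℕ) →
      ‖stoppedMean T N b (sectorFun m g) - stoppedMean T N a (sectorFun m g) -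
        t * stoppedMean T N b (sectorFun m (radialOp m g))‖ ≤
        ρ N + t * |(radialOp m g).eval 1| + t ^ 2 * A := by
  have hA0 : 0 ≤ A := (abs_nonneg _).trans (hA 0 (by simp))
  obtain ⟨C, hC⟩ := exists_secondOrderBound_sectorFun m g
  obtain ⟨C', hC'⟩ := exists_secondOrderBound_sectorFun m (radialOp m g)
  obtain ⟨Λ, hΛ0, hΛ⟩ := exists_abs_eval_le_add (radialOp m g)
  refine ⟨fun N => 2 * itoError C T N + T * (2 * Λ * (N : ℝ)⁻¹ + 2 * itoError C' T N), ?_, ?_⟩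
  · have := ((tendsto_itoError C T).const_mul 2).add
      ((((tendsto_inv_atTop_nhds_zero_nat (𝕜 := ℝ)).const_mul (2 * Λ)).add
        ((tendsto_itoError C' T).const_mul 2)).const_mul T)
    simpa using this
  filter_upwards [eventually_smallStep T] with N h a b hab hb t ht
  have hN : (0 : ℝ) < N := by exact_mod_cast h.pos
  have hδ : 0 ≤ timeStep T N * N := by unfold timeStep; positivity
  have ht0 : 0 ≤ t := by rw [ht]; positivity
  have htT : t ≤ T := by
    have : ((b - a : ℕ) : ℝ) ≤ (N : ℝ) ^ 4 := by exact_mod_cast (Nat.sub_le b a).trans hb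
    calc t ≤ timeStep T N * N * (N : ℝ) ^ 4 := by rw [ht]; gcongr
      _ = T := by unfold timeStep; field_simp
  have hIto : ∀ {C : ℝ} {f : ℂ → ℂ}, SecondOrderBound f C → 0 ≤ itoError C T N := fun hf => by
    have := hf.nonneg
    unfold itoError; positivity
  -- Two replacements in the drift at time `c`: including the stopped paths costs about `|L g(1)|`,
  -- and moving from `c` to `b` costs `t A` by Dynkin's formula for `L g`.
  have hter : ∀ c ∈ Finset.Ico a b, ‖insideMean T N c (sectorFun m (radialOp m g)) -
      stoppedMean T N b (sectorFun m (radialOp m g))‖ ≤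
      (|(radialOp m g).eval 1| + 2 * Λ * (N : ℝ)⁻¹) + (2 * itoError C' T N + t * A) := by
    intro c hc
    rw [Finset.mem_Ico] at hc
    have h1 := norm_insideMean_sub_stoppedMean_le (φ := sectorFun m (radialOp m g))
      (A := |(radialOp m g).eval 1| + 2 * Λ * (N : ℝ)⁻¹) h (by positivity) (fun z hz hzN => by
        rw [mem_ball_zero_iff] at hz
        have hs1 : Complex.normSq z ≤ 1 := by
          rw [Complex.normSq_eq_norm_sq]; exact pow_le_one₀ (norm_nonneg _) hz.le
        refine norm_sectorFun_le hz.le ((hΛ _ ⟨Complex.normSq_nonneg z, hs1⟩).trans ?_)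
        have := mul_le_mul_of_nonneg_left (one_sub_normSq_le h hzN) hΛ0
        have e : Λ * (2 / N) = 2 * Λ * (N : ℝ)⁻¹ := by ring
        linarith) c
    have h2 := norm_dynkin_le m hC' hT h hc.2.le hb
    have h3 : ‖((timeStep T N * N : ℝ) : ℂ) * ∑ c' ∈ Finset.Ico c b,
        insideMean T N c' (sectorFun m (radialOp m (radialOp m g)))‖ ≤ t * A := by
      rw [norm_mul, Complex.norm_real, Real.norm_of_nonneg hδ]
      have h4 := norm_sum_le_of_le (Finset.Ico c b) fun c' _ => norm_insideMean_le
        (φ := sectorFun m (radialOp m (radialOp m g))) h hA0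
        (fun z hz => norm_sectorFun_le_of_unitBounded hA hz) c'
      rw [Finset.sum_const, Nat.card_Ico, nsmul_eq_mul] at h4
      have h5 : ((b - c : ℕ) : ℝ) ≤ ((b - a : ℕ) : ℝ) := by
        exact_mod_cast Nat.sub_le_sub_left hc.1 b
      calc _ ≤ timeStep T N * N * ((b - a : ℕ) * A) := by gcongr; exact h4.trans (by gcongr)
        _ = t * A := by rw [ht]; ring
    have h6 : ‖stoppedMean T N c (sectorFun m (radialOp m g)) -
        stoppedMean T N b (sectorFun m (radialOp m g))‖ ≤ 2 * itoError C' T N + t * A := by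
      rw [norm_sub_rev]
      have := (norm_add_le _ _).trans (add_le_add h2 h3)
      rwa [sub_add_cancel] at this
    have := (norm_add_le _ _).trans (add_le_add h1 h6)
    rwa [sub_add_sub_cancel] at this
  have hsum : ‖((timeStep T N * N : ℝ) : ℂ) * ∑ c ∈ Finset.Ico a b,
      (insideMean T N c (sectorFun m (radialOp m g)) -
      stoppedMean T N b (sectorFun m (radialOp m g)))‖ ≤
      t * ((|(radialOp m g).eval 1| + 2 * Λ * (N : ℝ)⁻¹) + (2 * itoError C' T N + t * A)) := by
    rw [norm_mul, Complex.norm_real, Real.norm_of_nonneg hδ]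
    have h4 := norm_sum_le_of_le (Finset.Ico a b) hter
    rw [Finset.sum_const, Nat.card_Ico, nsmul_eq_mul] at h4
    calc _ ≤ _ := mul_le_mul_of_nonneg_left h4 hδ
      _ = _ := by rw [ht]; ring
  have hdyn := norm_dynkin_le m hC hT h hab hb
  have hfin := (norm_add_le _ _).trans (add_le_add hdyn hsum)
  have e : stoppedMean T N b (sectorFun m g) - stoppedMean T N a (sectorFun m g) -
        t * stoppedMean T N b (sectorFun m (radialOp m g)) =
      stoppedMean T N b (sectorFun m g) - stoppedMean T N a (sectorFun m g) -
      (timeStep T N * N : ℝ) * ∑ c ∈ Finset.Ico a b,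
        insideMean T N c (sectorFun m (radialOp m g)) +
      ((timeStep T N * N : ℝ) : ℂ) * ∑ c ∈ Finset.Ico a b,
      (insideMean T N c (sectorFun m (radialOp m g)) -
      stoppedMean T N b (sectorFun m (radialOp m g))) := by
    rw [Finset.sum_sub_distrib, Finset.sum_const, Nat.card_Ico, nsmul_eq_mul, ht]
    push_cast
    ring
  rw [e]
  refine hfin.trans ?_
  have hx : t * (2 * Λ * (N : ℝ)⁻¹ + 2 * itoError C' T N) ≤
      T * (2 * Λ * (N : ℝ)⁻¹ + 2 * itoError C' T N) := by
    have := hIto hC'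
    gcongr
  calc _ = 2 * itoError C T N + t * (2 * Λ * (N : ℝ)⁻¹ + 2 * itoError C' T N) +
        t * |(radialOp m g).eval 1| + t ^ 2 * A := by ring
    _ ≤ _ := by gcongr

end DyadicWalk

/-! ### The backward Euler scheme and the limit for fixed `T`. -/

namespace DyadicWalk

open Polynomial

variable {T : ℝ} {N : ℕ}

lemma stoppedMean_zero (T : ℝ) (N : ℕ) (φ : ℂ → ℂ) : stoppedMean T N 0 φ = φ 0 := by
  simp [stoppedMean, stoppedWalk_zero]

lemma timeStep_mul_div (hN : 0 < N) (T k : ℝ) : timeStep T N * N * k = T * k / (N : ℝ) ^ 4 := by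
  have : (0 : ℝ) < N := by exact_mod_cast hN
  unfold timeStep; field_simp

lemma tendsto_const_div_pow_four (T : ℝ) :
    Tendsto (fun N : ℕ => T / (N : ℝ) ^ 4) atTop (𝓝 0) :=
  tendsto_const_nhds.div_atTop
    ((tendsto_pow_atTop (by norm_num)).comp tendsto_natCast_atTop_atTop)

/-- Passing from `u` to the next function `g` of the backward Euler scheme of step `T / n`. -/
lemma exists_next_euler (hT : 0 < T) (m : ℕ) {n : ℕ} (hn : 0 < n) {η A B : ℝ}
    (hη0 : 0 < η) (hη1 : η ≤ (T / n) ^ 2 / 4) (hη2 : η ≤ (T / n) / 2) {u : ℝ[X]}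
    (hu0 : u.eval 1 = 0) (hu1 : |(radialOp m u).eval 1| ≤ η / (T / n))
    (hu2 : UnitBounded (radialOp m (radialOp m u)) B) (hB : 1 ≤ B) (hBA : B + η ≤ A) :
    ∃ g : ℝ[X], g.eval 1 = 0 ∧ |(radialOp m g).eval 1| ≤ η / (T / n) ∧
      UnitBounded (radialOp m (radialOp m g)) (B + η) ∧
      ∀ᶠ N : ℕ in atTop, ∀ a b, a + N ^ 4 / n = b → b ≤ N ^ 4 →
        ‖stoppedMean T N b (sectorFun m u) - stoppedMean T N a (sectorFun m g)‖ ≤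
          (T / n) ^ 2 * (A + 2) := by
  have hn' : (0 : ℝ) < n := by exact_mod_cast hn
  set τ := T / n with hτd
  have hτ : 0 < τ := by positivity
  obtain ⟨g, e, hg1, hge, he0, he1, he2⟩ := exists_approx_resolvent m hτ hη0 u
  have hLg1 : |(radialOp m g).eval 1| ≤ η / τ := by
    have := congrArg (eval 1) hge
    simp only [eval_sub, eval_smul, eval_add, hg1, hu0, smul_eq_mul] at this
    have h2 : (radialOp m g).eval 1 = -(e.eval 1) / τ := by
      field_simp; linarith
    rw [h2, abs_div, abs_neg, abs_of_pos hτ]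
    gcongr
    exact he0 1 (by simp)
  have hL : radialOp m g - τ • radialOp m (radialOp m g) = radialOp m u + radialOp m e := by
    rw [← map_add, ← hge, map_sub, map_smul]
  have hLL : radialOp m (radialOp m g) - τ • radialOp m (radialOp m (radialOp m g)) =
      radialOp m (radialOp m u) + radialOp m (radialOp m e) := by
    rw [← map_add, ← hL, map_sub, map_smul]
  -- At `s = 1` the equation for `L g` gives `L² g(1)` as a quotient by `τ`. Its numerator is at
  -- most `τ/4 + τ/4 + τ/2`, by `η ≤ τ²/4` and `η ≤ τ/2`.
  have hLLg1 : |(radialOp m (radialOp m g)).eval 1| ≤ 1 := by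
    have := congrArg (eval 1) hL
    simp only [eval_sub, eval_smul, eval_add, smul_eq_mul] at this
    have h2 : (radialOp m (radialOp m g)).eval 1 = ((radialOp m g).eval 1 -
        (radialOp m u).eval 1 - (radialOp m e).eval 1) / τ := by
      field_simp; linarith
    rw [h2, abs_div, abs_of_pos hτ, div_le_one hτ]
    have h3 := he1 1 (by simp)
    have h4 : η / τ ≤ τ / 4 := by rw [div_le_iff₀ hτ]; linarith [sq τ]
    have h5 := abs_sub ((radialOp m g).eval 1 - (radialOp m u).eval 1) ((radialOp m e).eval 1)
    have h6 := abs_sub ((radialOp m g).eval 1) ((radialOp m u).eval 1)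
    linarith
  -- `L² g` solves the same resolvent equation with right side `L² u + L² e`, so the maximum
  -- principle lets its bound grow only by `η` per step.
  have hLLg : UnitBounded (radialOp m (radialOp m g)) (B + η) := by
    refine UnitBounded.of_resolvent (m := m) hτ.le ?_ (hLLg1.trans (by linarith))
    rw [hLL]
    intro s hs
    rw [eval_add]
    exact (abs_add_le _ _).trans (add_le_add (hu2 s hs) (he2 s hs))
  refine ⟨g, hg1, hLg1, hLLg, ?_⟩
  obtain ⟨M, hM0, hM⟩ := exists_unitBounded (radialOp m g)
  obtain ⟨ρ, hρ, hstep⟩ := exists_euler_step hT.le m g (hLLg.mono hBA)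
  have hsmall : ∀ᶠ N : ℕ in atTop, ρ N + T / (N : ℝ) ^ 4 * M ≤ τ ^ 2 := by
    have := hρ.add ((tendsto_const_div_pow_four T).mul_const M)
    rw [zero_mul, add_zero] at this
    exact this.eventually_le_const (by positivity)
  filter_upwards [hsmall, hstep, eventually_smallStep T] with N h1 h2 h a b hab hb
  have hN : (0 : ℝ) < N := by exact_mod_cast h.pos
  have hba : b - a = N ^ 4 / n := by rw [← hab, Nat.add_sub_cancel_left]
  -- Rounding down to whole blocks makes the elapsed time `t` fall short of `τ` by at most `T/N⁴`.
  set J := N ^ 4 / n with hJ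
  set t := timeStep T N * N * (b - a : ℕ) with ht
  have htJ : t = T * J / (N : ℝ) ^ 4 := by rw [ht, timeStep_mul_div h.pos, hba]
  have hJ1 : (J : ℝ) * n ≤ (N : ℝ) ^ 4 := by exact_mod_cast Nat.div_mul_le_self (N ^ 4) n
  have hJ2 : (N : ℝ) ^ 4 ≤ (J + 1) * n := by
    have := Nat.lt_div_mul_add (a := N ^ 4) hn
    have h3 : N ^ 4 ≤ (J + 1) * n := by rw [hJ, add_mul, one_mul]; exact this.le
    exact_mod_cast h3
  have ht0 : 0 ≤ t := by rw [htJ]; positivity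
  have htτ : t ≤ τ := by
    rw [htJ, hτd, div_le_div_iff₀ (by positivity) hn']
    calc _ = T * (J * n) := by ring
      _ ≤ _ := by gcongr
  have hτt : τ - t ≤ T / (N : ℝ) ^ 4 := by
    rw [htJ, hτd, sub_le_iff_le_add, ← add_div, div_le_div_iff₀ hn' (by positivity)]
    calc T * (N : ℝ) ^ 4 ≤ T * ((J + 1) * n) := by gcongr
      _ = _ := by ring
  have hA0 : 0 ≤ A := by linarith
  have hs := h2 a b (hab ▸ Nat.le_add_right a _) hb t ht
  have hu : u = g - τ • radialOp m g - e := by rw [hge]; ring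
  have hE : stoppedMean T N b (sectorFun m u) - stoppedMean T N a (sectorFun m g) =
      (stoppedMean T N b (sectorFun m g) - stoppedMean T N a (sectorFun m g) -
        t * stoppedMean T N b (sectorFun m (radialOp m g))) -
      ((τ - t : ℝ) : ℂ) * stoppedMean T N b (sectorFun m (radialOp m g)) -
      stoppedMean T N b (sectorFun m e) := by
    conv_lhs => rw [hu]
    rw [stoppedMean_sectorFun_sub h.pos, stoppedMean_sectorFun_sub h.pos,
      stoppedMean_sectorFun_smul]
    push_cast
    ring
  have h3 : ‖((τ - t : ℝ) : ℂ) * stoppedMean T N b (sectorFun m (radialOp m g))‖ ≤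
      T / (N : ℝ) ^ 4 * M := by
    rw [norm_mul, Complex.norm_real, Real.norm_of_nonneg (by linarith)]
    gcongr
    exact norm_stoppedMean_le h (fun z hz => norm_sectorFun_le_of_unitBounded hM hz) b
  have h4 : ‖stoppedMean T N b (sectorFun m e)‖ ≤ η :=
    norm_stoppedMean_le h (fun z hz => norm_sectorFun_le_of_unitBounded he0 hz) b
  rw [hE]
  refine (norm_sub_le _ _).trans ?_
  have h5 := (norm_sub_le (stoppedMean T N b (sectorFun m g) - stoppedMean T N a (sectorFun m g) -
        t * stoppedMean T N b (sectorFun m (radialOp m g)))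
      (((τ - t : ℝ) : ℂ) * stoppedMean T N b (sectorFun m (radialOp m g))))
  have h6 : t * |(radialOp m g).eval 1| ≤ η := by
    calc _ ≤ τ * (η / τ) := by gcongr
      _ = η := by field_simp
  have h7 : t ^ 2 * A ≤ τ ^ 2 * A := by gcongr
  nlinarith

/-- The backward Euler scheme with `n` steps, up to the step `j`. -/
lemma exists_euler_chain (hT : 0 < T) (m : ℕ) {n : ℕ} (hn : 0 < n) {η C : ℝ}
    (hη0 : 0 < η) (hη1 : η ≤ (T / n) ^ 2 / 4) (hη2 : η ≤ (T / n) / 2) (hη3 : n * η ≤ 1)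
    {h : ℝ[X]} (h0 : h.eval 1 = 0) (h1 : (radialOp m h).eval 1 = 0) (hC0 : 0 ≤ C)
    (hC : UnitBounded (radialOp m (radialOp m h)) C) :
    ∀ j ≤ n, ∃ u : ℝ[X], u.eval 1 = 0 ∧ |(radialOp m u).eval 1| ≤ η / (T / n) ∧
      UnitBounded (radialOp m (radialOp m u)) (C + 1 + j * η) ∧
      ∀ᶠ N : ℕ in atTop, ‖stoppedMean T N (N ^ 4) (sectorFun m h) -
        stoppedMean T N (N ^ 4 - j * (N ^ 4 / n)) (sectorFun m u)‖ ≤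
          j * ((T / n) ^ 2 * (C + 4)) := by
  intro j
  induction j with
  | zero =>
    intro _
    refine ⟨h, h0, by rw [h1, abs_zero]; positivity, hC.mono (by simp), ?_⟩
    simp
  | succ j ih =>
    intro hj
    obtain ⟨u, hu0, hu1, hu2, hu3⟩ := ih (by omega)
    have hj' : ((j : ℝ) + 1) * η ≤ 1 := by
      refine le_trans ?_ hη3
      gcongr
      exact_mod_cast hj
    have hj0 : 0 ≤ (j : ℝ) * η := by positivity
    obtain ⟨g, hg0, hg1, hg2, hg3⟩ := exists_next_euler hT m hn (A := C + 2) hη0 hη1 hη2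
      hu0 hu1 hu2 (by linarith) (by linarith)
    refine ⟨g, hg0, hg1, hg2.mono (by push_cast; linarith), ?_⟩
    filter_upwards [hu3, hg3] with N hN1 hN2
    have hle : (j + 1) * (N ^ 4 / n) ≤ N ^ 4 :=
      (Nat.mul_le_mul_right _ hj).trans (Nat.mul_div_le _ _)
    have h3 := hN2 (N ^ 4 - (j + 1) * (N ^ 4 / n)) (N ^ 4 - j * (N ^ 4 / n))
      (by rw [add_mul, one_mul] at hle ⊢; generalize N ^ 4 / n = J at hle ⊢; omega)
      (Nat.sub_le _ _)
    have h4 := (norm_add_le _ _).trans (add_le_add hN1 h3)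
    rw [sub_add_sub_cancel] at h4
    refine h4.trans (le_of_eq ?_)
    push_cast; ring

/-- In a bounded number of blocks the mean does not move. -/
lemma eventually_norm_stoppedMean_sub_le (hT : 0 < T) (m : ℕ) (u : ℝ[X]) (n : ℕ) {ε : ℝ} (hε : 0 < ε) :
    ∀ᶠ N : ℕ in atTop, ∀ b ≤ n, b ≤ N ^ 4 →
      ‖stoppedMean T N b (sectorFun m u) - sectorFun m u 0‖ ≤ ε := by
  obtain ⟨A, hA0, hA⟩ := exists_unitBounded (radialOp m (radialOp m u))
  obtain ⟨ρ, hρ, hstep⟩ := exists_euler_step hT.le m u hA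
  obtain ⟨M, hM0, hM⟩ := exists_unitBounded (radialOp m u)
  have hsmall : ∀ᶠ N : ℕ in atTop, ρ N + T * n / (N : ℝ) ^ 4 * |(radialOp m u).eval 1| +
      (T * n / (N : ℝ) ^ 4) ^ 2 * A + T * n / (N : ℝ) ^ 4 * M ≤ ε := by
    have h2 := tendsto_const_div_pow_four (T * n)
    have := ((hρ.add (h2.mul_const |(radialOp m u).eval 1|)).add
      ((h2.pow 2).mul_const A)).add (h2.mul_const M)
    simp only [zero_mul, add_zero, ne_eq, OfNat.ofNat_ne_zero, not_false_eq_true, zero_pow] at this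
    exact this.eventually_le_const hε
  filter_upwards [hsmall, hstep, eventually_smallStep T] with N hN2 hN3 hs b hbn hbN
  have hNp : (0 : ℝ) < N := by exact_mod_cast hs.pos
  have hN4 := hN3 0 b (Nat.zero_le _) hbN _ rfl
  have ht : timeStep T N * N * (b - 0 : ℕ) = T * b / (N : ℝ) ^ 4 := by
    rw [timeStep_mul_div hs.pos, Nat.sub_zero]
  rw [ht, stoppedMean_zero] at hN4
  have ht0 : 0 ≤ T * b / (N : ℝ) ^ 4 := by positivity
  have htn : T * b / (N : ℝ) ^ 4 ≤ T * n / (N : ℝ) ^ 4 := by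
    have : (b : ℝ) ≤ n := by exact_mod_cast hbn
    gcongr
  generalize T * b / (N : ℝ) ^ 4 = t at hN4 ht0 htn
  generalize T * n / (N : ℝ) ^ 4 = t' at htn hN2
  have hb2 : ‖(t : ℂ) * stoppedMean T N b (sectorFun m (radialOp m u))‖ ≤ t' * M := by
    rw [norm_mul, Complex.norm_real, Real.norm_of_nonneg ht0]
    exact mul_le_mul htn (norm_stoppedMean_le hs
      (fun z hz => norm_sectorFun_le_of_unitBounded hM hz) b) (norm_nonneg _) (ht0.trans htn)
  have h5 := (norm_add_le _ _).trans (add_le_add hN4 hb2)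
  rw [sub_add_cancel] at h5
  have h8 : t * |(radialOp m u).eval 1| ≤ t' * |(radialOp m u).eval 1| := by gcongr
  have h9 : t ^ 2 * A ≤ t' ^ 2 * A := by gcongr
  linarith

/-- The `n` Euler steps lose `n τ² (C + 4) = T² (C + 4)/n`, at most `ε/2` by the choice of `n`. The
limit candidate is the last function of the scheme at the origin. -/
lemma exists_eventually_near (hT : 0 < T) (m : ℕ) {h : ℝ[X]} (h0 : h.eval 1 = 0)
    (h1 : (radialOp m h).eval 1 = 0) {ε : ℝ} (hε : 0 < ε) :
    ∃ l : ℂ, ∀ᶠ N : ℕ in atTop, ‖stoppedMean T N (N ^ 4) (sectorFun m h) - l‖ ≤ ε := by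
  obtain ⟨C, hC0, hC⟩ := exists_unitBounded (radialOp m (radialOp m h))
  obtain ⟨n, hn⟩ := exists_nat_gt (2 * T ^ 2 * (C + 4) / ε)
  have hn' : (0 : ℝ) < n := lt_of_le_of_lt (by positivity) hn
  have hn0 : 0 < n := by exact_mod_cast hn'
  have hτ : 0 < T / n := by positivity
  obtain ⟨η, hη0, hη1, hη2, hη3⟩ : ∃ η : ℝ, 0 < η ∧ η ≤ (T / n) ^ 2 / 4 ∧ η ≤ (T / n) / 2 ∧
      n * η ≤ 1 := by
    refine ⟨min (min ((T / n) ^ 2 / 4) ((T / n) / 2)) (1 / n), by positivity,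
      (min_le_left _ _).trans (min_le_left _ _), (min_le_left _ _).trans (min_le_right _ _), ?_⟩
    rw [← le_div_iff₀' hn']
    exact min_le_right _ _
  obtain ⟨u, -, -, -, hu3⟩ := exists_euler_chain hT m hn0 hη0 hη1 hη2 hη3 h0 h1 hC0 hC n le_rfl
  refine ⟨sectorFun m u 0, ?_⟩
  filter_upwards [hu3, eventually_norm_stoppedMean_sub_le hT m u n (half_pos hε)] with N hN1 hN2
  -- `n` need not divide `N⁴`: at most `n` blocks remain at the start, and in them the mean stays
  -- near its value at the origin.
  have hbn : N ^ 4 - n * (N ^ 4 / n) ≤ n := by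
    rw [Nat.sub_le_iff_le_add']
    have h2 := Nat.div_add_mod (N ^ 4) n
    have h3 := Nat.mod_lt (N ^ 4) hn0
    exact h2.symm.le.trans (Nat.add_le_add_left h3.le _)
  have h6 := (norm_add_le _ _).trans (add_le_add hN1 (hN2 _ hbn (Nat.sub_le _ _)))
  rw [sub_add_sub_cancel] at h6
  refine h6.trans ?_
  have e : n * ((T / n) ^ 2 * (C + 4)) = T ^ 2 * (C + 4) / n := by field_simp
  have h7 : T ^ 2 * (C + 4) / n ≤ ε / 2 := by
    rw [div_lt_iff₀ hε] at hn
    rw [div_le_iff₀ hn']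
    linarith
  rw [e]
  linarith

/-- A sequence that is eventually near some point at every scale converges. -/
lemma exists_tendsto_of_eventually_near {u : ℕ → ℂ}
    (h : ∀ ε > 0, ∃ l : ℂ, ∀ᶠ N in atTop, ‖u N - l‖ ≤ ε) : ∃ l, Tendsto u atTop (𝓝 l) := by
  apply cauchySeq_tendsto_of_complete
  rw [Metric.cauchySeq_iff']
  intro ε hε
  obtain ⟨l, hl⟩ := h (ε / 3) (by positivity)
  obtain ⟨N0, hN0⟩ := eventually_atTop.1 hl
  refine ⟨N0, fun n hn => ?_⟩
  have h1 := hN0 n hn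
  have h2 := hN0 N0 le_rfl
  rw [← dist_eq_norm] at h1 h2
  rw [dist_comm] at h2
  linarith [dist_triangle (u n) l (u N0)]

lemma exists_tendsto_stoppedMean (hT : 0 < T) (m : ℕ) {h : ℝ[X]} (h0 : h.eval 1 = 0)
    (h1 : (radialOp m h).eval 1 = 0) :
    ∃ l, Tendsto (fun N : ℕ => stoppedMean T N (N ^ 4) (sectorFun m h)) atTop (𝓝 l) :=
  exists_tendsto_of_eventually_near fun _ hε => exists_eventually_near hT m h0 h1 hε

end DyadicWalk

/-! ### Survival probability and functions with an exit limit. -/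

namespace DyadicWalk

open Polynomial

variable {T : ℝ} {N : ℕ}

/-- The probability that the walk has not been stopped before the block of index `c`. -/
noncomputable def insideProb (T : ℝ) (N c : ℕ) : ℝ :=
  ∫ x in Set.Ico (0 : ℝ) 1, driftTerm (fun _ => (1 : ℝ)) (timeStep T N) N c x

lemma insideProb_anti (hN : 0 < N) {c c' : ℕ} (hc : c ≤ c') :
    insideProb T N c' ≤ insideProb T N c := by
  refine integral_mono (dyadicAt_driftTerm _ _ hN c').integrableOn
    (dyadicAt_driftTerm _ _ hN c).integrableOn fun x => ?_
  exact Set.indicator_le_indicator_of_subset (fun y hy => Inside.mono hy hc)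
    (fun _ => zero_le_one) x

lemma insideMean_const (T : ℝ) (N c : ℕ) (a : ℂ) :
    insideMean T N c (fun _ => a) = a * (insideProb T N c : ℝ) := by
  rw [insideMean, insideProb, ← integral_complex_ofReal, ← integral_const_mul]
  congr 1 with x
  rw [driftTerm, driftTerm]
  by_cases hc : x ∈ {x | Inside (timeStep T N) N c x}
  · rw [Set.indicator_of_mem hc, Set.indicator_of_mem hc]; simp
  · rw [Set.indicator_of_notMem hc, Set.indicator_of_notMem hc]; simp

/-- Dynkin's formula for `1 - |z|²`, whose drift is `-2` while the walk runs. The mean stays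
nonnegative, so twice the expected running time is at most `1` up to the error, and the survival
probability decreases in time. -/
lemma mul_insideProb_le {C : ℝ} (hC : SecondOrderBound (sectorFun 0 (1 - X)) C)
    (hT : 0 ≤ T) (h : SmallStep (timeStep T N) N) :
    2 * T * insideProb T N (N ^ 4) ≤ 1 + 2 * itoError C T N := by
  have hN : (0 : ℝ) < N := by exact_mod_cast h.pos
  have hL : radialOp 0 (1 - X : ℝ[X]) = Polynomial.C (-2) := by
    rw [radialOp_apply]; simp
  have hs : sectorFun 0 (Polynomial.C (-2)) = fun _ => (-2 : ℂ) := by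
    ext z; simp [sectorFun]
  have hE : stoppedMean T N (N ^ 4) (sectorFun 0 (1 - X)) = ((∫ x in Set.Ico (0 : ℝ) 1,
      (1 - Complex.normSq (stoppedWalk (timeStep T N) N (N * N ^ 4) x)) : ℝ) : ℂ) := by
    rw [stoppedMean, ← integral_complex_ofReal]
    simp [sectorFun]
  have hE0 : 0 ≤ ∫ x in Set.Ico (0 : ℝ) 1,
      (1 - Complex.normSq (stoppedWalk (timeStep T N) N (N * N ^ 4) x)) :=
    integral_nonneg fun x => by
      have := h.stoppedWalk_mem_ball (N * N ^ 4) x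
      rw [mem_ball_zero_iff] at this
      change (0 : ℝ) ≤ 1 - _
      rw [Complex.normSq_eq_norm_sq]
      linarith [pow_le_one₀ (n := 2) (norm_nonneg _) this.le]
  have hd := norm_dynkin_le 0 hC hT h (Nat.zero_le _) le_rfl
  rw [hL, hs, stoppedMean_zero, hE] at hd
  simp only [insideMean_const, ← Finset.mul_sum] at hd
  have h1 : sectorFun 0 (1 - X) 0 = 1 := by simp [sectorFun]
  rw [h1] at hd
  set e := ∫ x in Set.Ico (0 : ℝ) 1,
      (1 - Complex.normSq (stoppedWalk (timeStep T N) N (N * N ^ 4) x))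
  have hre : (e : ℂ) - 1 - ((timeStep T N * N : ℝ) : ℂ) *
      (-2 * ∑ c ∈ Finset.Ico 0 (N ^ 4), ((insideProb T N c : ℝ) : ℂ)) =
      ((e - 1 + 2 * (timeStep T N * N * ∑ c ∈ Finset.Ico 0 (N ^ 4), insideProb T N c) : ℝ) : ℂ) := by
    push_cast; ring
  rw [hre, Complex.norm_real] at hd
  have hsum : (N : ℝ) ^ 4 * insideProb T N (N ^ 4) ≤
      ∑ c ∈ Finset.Ico 0 (N ^ 4), insideProb T N c := by
    have := Finset.card_nsmul_le_sum (Finset.Ico 0 (N ^ 4)) (insideProb T N)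
      (insideProb T N (N ^ 4)) fun c hc => insideProb_anti h.pos (Finset.mem_Ico.1 hc).2.le
    rw [Nat.card_Ico, nsmul_eq_mul] at this
    simpa using this
  have hδ : 0 ≤ timeStep T N * N := by unfold timeStep; positivity
  have hT4 : timeStep T N * N * (N : ℝ) ^ 4 = T := by unfold timeStep; field_simp
  have h2 := mul_le_mul_of_nonneg_left hsum hδ
  rw [← mul_assoc, hT4] at h2
  have h3 := (abs_le.1 hd).2
  linarith

/-- A path either has not been stopped, or satisfies `1 - |z|² ≤ 2/N`. -/
lemma norm_stoppedMean_le_insideProb {φ : ℂ → ℂ} {K : ℝ} (hK : 0 ≤ K)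
    (h : SmallStep (timeStep T N) N)
    (hφ : ∀ z ∈ Metric.ball (0 : ℂ) 1, ‖φ z‖ ≤ K * (1 - Complex.normSq z)) (c : ℕ) :
    ‖stoppedMean T N c φ‖ ≤ K * (insideProb T N c + 2 / N) := by
  have hI : IntegrableOn (driftTerm (fun _ => (1 : ℝ)) (timeStep T N) N c) (Set.Ico (0 : ℝ) 1) :=
    (dyadicAt_driftTerm _ _ h.pos c).integrableOn
  have h1 : ∫ x in Set.Ico (0 : ℝ) 1,
      K * (driftTerm (fun _ => (1 : ℝ)) (timeStep T N) N c x + 2 / N) =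
      K * (insideProb T N c + 2 / N) := by
    rw [integral_const_mul, integral_add hI (integrable_const _), insideProb]
    simp
  rw [← h1]
  refine norm_integral_le_of_norm_le ((hI.add (integrable_const _)).const_mul K)
    (ae_of_all _ fun x => ?_)
  have hm := h.stoppedWalk_mem_ball (N * c) x
  refine (hφ _ hm).trans ?_
  gcongr
  rw [driftTerm]
  by_cases hc : Inside (timeStep T N) N c x
  · rw [Set.indicator_of_mem (by exact hc)]
    have : (0 : ℝ) ≤ 2 / N := by positivity
    linarith [Complex.normSq_nonneg (stoppedWalk (timeStep T N) N (N * c) x)]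
  · rw [Set.indicator_of_notMem (by exact hc), zero_add]
    exact one_sub_normSq_le h (h.le_norm_stoppedWalk hc)

/-- The means of `φ` along the stopped walks converge for every terminal time `T`, to a limit that
tends to the mean of `φ` over the unit circle as `T → ∞`. -/
def HasExitLimit (φ : ℂ → ℂ) : Prop :=
  ContinuousOn φ (Metric.closedBall (0 : ℂ) 1) ∧ ∃ L : ℝ → ℂ,
    (∀ T > 0, Tendsto (fun N : ℕ => stoppedMean T N (N ^ 4) φ) atTop (𝓝 (L T))) ∧
    Tendsto L atTop (𝓝 (Real.circleAverage φ 0 1))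

lemma circleIntegrable_of_continuousOn_closedBall {E : Type*} [NormedAddCommGroup E] {φ : ℂ → E}
    (hφ : ContinuousOn φ (Metric.closedBall (0 : ℂ) 1)) : CircleIntegrable φ 0 1 :=
  (hφ.mono Metric.sphere_subset_closedBall).circleIntegrable zero_le_one

lemma norm_circleAverage_le {E : Type*} [NormedAddCommGroup E] [NormedSpace ℝ E] {φ : ℂ → E}
    {η : ℝ} (h : ∀ z ∈ Metric.closedBall (0 : ℂ) 1, ‖φ z‖ ≤ η) :
    ‖Real.circleAverage φ 0 1‖ ≤ η := by
  rw [Real.circleAverage_def, norm_smul, Real.norm_of_nonneg (by positivity)]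
  have := intervalIntegral.norm_integral_le_of_norm_le_const (a := 0) (b := 2 * Real.pi)
    (f := fun θ => φ (circleMap 0 1 θ)) (C := η) fun θ _ =>
      h _ (circleMap_mem_closedBall 0 zero_le_one θ)
  rw [sub_zero, abs_of_pos Real.two_pi_pos] at this
  calc _ ≤ (2 * Real.pi)⁻¹ * (η * (2 * Real.pi)) := by gcongr
    _ = η := by field_simp

lemma norm_stoppedMean_sub_le {φ ψ : ℂ → ℂ} {η : ℝ} (h : SmallStep (timeStep T N) N)
    (hφ : ∀ z ∈ Metric.closedBall (0 : ℂ) 1, ‖φ z - ψ z‖ ≤ η) (b : ℕ) :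
    ‖stoppedMean T N b φ - stoppedMean T N b ψ‖ ≤ η := by
  rw [stoppedMean, stoppedMean, ← integral_sub (integrableOn_stoppedWalk T h.pos b φ)
    (integrableOn_stoppedWalk T h.pos b ψ)]
  exact norm_setIntegral_Ico_le fun x =>
    hφ _ (Metric.ball_subset_closedBall (h.stoppedWalk_mem_ball _ x))

namespace HasExitLimit

/-- Means and circle averages are contractions for the uniform norm, so both limits survive uniform
approximation. -/
lemma of_uniform {φ : ℂ → ℂ} (hφ : ContinuousOn φ (Metric.closedBall (0 : ℂ) 1))
    (h : ∀ η > 0, ∃ ψ, HasExitLimit ψ ∧ ∀ z ∈ Metric.closedBall (0 : ℂ) 1, ‖φ z - ψ z‖ ≤ η) :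
    HasExitLimit φ := by
  have hex : ∀ T : ℝ, ∃ l, Tendsto (fun N : ℕ => stoppedMean T N (N ^ 4) φ) atTop (𝓝 l) ∨ T ≤ 0 := by
    intro T
    rcases le_or_gt T 0 with hT | hT
    · exact ⟨0, Or.inr hT⟩
    obtain ⟨l, hl⟩ := exists_tendsto_of_eventually_near
      (u := fun N : ℕ => stoppedMean T N (N ^ 4) φ) fun ε hε => by
        obtain ⟨ψ, ⟨-, L, hL, -⟩, hψ⟩ := h (ε / 2) (by positivity)
        refine ⟨L T, ?_⟩
        filter_upwards [eventually_smallStep T,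
          (tendsto_iff_norm_sub_tendsto_zero.1 (hL T hT)).eventually_le_const (half_pos hε)]
          with N hN h2
        have := (norm_add_le _ _).trans (add_le_add (norm_stoppedMean_sub_le hN hψ (N ^ 4)) h2)
        rw [sub_add_sub_cancel] at this
        linarith
    exact ⟨l, Or.inl hl⟩
  choose L hL using hex
  have hL' : ∀ T > 0, Tendsto (fun N : ℕ => stoppedMean T N (N ^ 4) φ) atTop (𝓝 (L T)) :=
    fun T hT => (hL T).resolve_right hT.not_ge
  refine ⟨hφ, L, hL', ?_⟩
  rw [tendsto_iff_norm_sub_tendsto_zero]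
  refine squeeze_zero_norm' (a := fun T => ‖L T - Real.circleAverage φ 0 1‖) (by simp) ?_
  rw [Metric.tendsto_nhds]
  intro ε hε
  obtain ⟨ψ, ⟨hψc, M, hM, hM'⟩, hψ⟩ := h (ε / 4) (by positivity)
  have hc : ‖Real.circleAverage ψ 0 1 - Real.circleAverage φ 0 1‖ ≤ ε / 4 := by
    rw [norm_sub_rev, ← Real.circleAverage_fun_sub (circleIntegrable_of_continuousOn_closedBall hφ)
      (circleIntegrable_of_continuousOn_closedBall hψc)]
    exact norm_circleAverage_le hψ
  filter_upwards [eventually_gt_atTop 0,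
    (tendsto_iff_norm_sub_tendsto_zero.1 hM').eventually_le_const
      (by positivity : (0 : ℝ) < ε / 4)] with T hT h2
  have h1 : ‖L T - M T‖ ≤ ε / 4 := le_of_tendsto ((hL' T hT).sub (hM T hT)).norm (by
    filter_upwards [eventually_smallStep T] with N hN
    exact norm_stoppedMean_sub_le hN hψ (N ^ 4))
  have h3 := (norm_add_le _ _).trans (add_le_add h1 h2)
  rw [sub_add_sub_cancel] at h3
  have h4 := (norm_add_le _ _).trans (add_le_add h3 hc)
  rw [sub_add_sub_cancel] at h4
  rw [dist_zero_right, norm_norm]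
  linarith

lemma add {φ ψ : ℂ → ℂ} (hφ : HasExitLimit φ) (hψ : HasExitLimit ψ) :
    HasExitLimit fun z => φ z + ψ z := by
  obtain ⟨hφc, L, hL, hL'⟩ := hφ
  obtain ⟨hψc, M, hM, hM'⟩ := hψ
  refine ⟨hφc.add hψc, fun T => L T + M T, fun T hT => ?_, ?_⟩
  · refine ((hL T hT).add (hM T hT)).congr' ?_
    filter_upwards [eventually_gt_atTop 0] with N hN using (stoppedMean_add hN _ _ _).symm
  · have := Real.circleAverage_add (circleIntegrable_of_continuousOn_closedBall hφc)
      (circleIntegrable_of_continuousOn_closedBall hψc)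
    have e : (fun z => φ z + ψ z) = φ + ψ := rfl
    rw [e, this]
    exact hL'.add hM'

lemma const_mul {φ : ℂ → ℂ} (hφ : HasExitLimit φ) (c : ℂ) : HasExitLimit fun z => c * φ z := by
  obtain ⟨hφc, L, hL, hL'⟩ := hφ
  refine ⟨continuousOn_const.mul hφc, fun T => c * L T, fun T hT => ?_, ?_⟩
  · simp only [stoppedMean_const_mul]
    exact (hL T hT).const_mul c
  · have e : (fun z => c * φ z) = c • φ := rfl
    rw [e, Real.circleAverage_smul]
    exact hL'.const_mul c

lemma conj {φ : ℂ → ℂ} (hφ : HasExitLimit φ) : HasExitLimit fun z => starRingEnd ℂ (φ z) := by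
  obtain ⟨hφc, L, hL, hL'⟩ := hφ
  have hcont : Continuous (starRingEnd ℂ) := Complex.continuous_conj
  refine ⟨hcont.comp_continuousOn hφc, fun T => starRingEnd ℂ (L T), fun T hT => ?_, ?_⟩
  · have e : ∀ N : ℕ, stoppedMean T N (N ^ 4) (fun z => starRingEnd ℂ (φ z)) =
      starRingEnd ℂ (stoppedMean T N (N ^ 4) φ) := fun N => integral_conj
    simp only [e]
    exact (hcont.tendsto _).comp (hL T hT)
  · have := (Complex.conjCLE : ℂ →L[ℝ] ℂ).circleAverage_comp_comm
      (circleIntegrable_of_continuousOn_closedBall hφc)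
    have e : (fun z => starRingEnd ℂ (φ z)) = (Complex.conjCLE : ℂ →L[ℝ] ℂ) ∘ φ := by
      ext z; simp
    rw [e, this]
    exact (hcont.tendsto _).comp hL'

/-- Functions that vanish on the circle only need the limits for fixed `T`. -/
lemma of_vanishing {φ : ℂ → ℂ} (hφ : ContinuousOn φ (Metric.closedBall (0 : ℂ) 1)) {K : ℝ}
    (hK : 0 ≤ K) (hφK : ∀ z ∈ Metric.closedBall (0 : ℂ) 1, ‖φ z‖ ≤ K * (1 - Complex.normSq z))
    (h : ∀ T > 0, ∃ l, Tendsto (fun N : ℕ => stoppedMean T N (N ^ 4) φ) atTop (𝓝 l)) :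
    HasExitLimit φ := by
  have hex : ∀ T : ℝ, ∃ l, 0 < T →
      Tendsto (fun N : ℕ => stoppedMean T N (N ^ 4) φ) atTop (𝓝 l) := fun T => by
    by_cases hT : 0 < T
    · obtain ⟨l, hl⟩ := h T hT
      exact ⟨l, fun _ => hl⟩
    · exact ⟨0, fun h => absurd h hT⟩
  choose L hL using hex
  refine ⟨hφ, L, hL, ?_⟩
  have h0 : Real.circleAverage φ 0 1 = 0 := Real.circleAverage_const_on_circle fun z hz => by
    rw [abs_one] at hz
    have h1 := hφK z (Metric.sphere_subset_closedBall hz)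
    rw [mem_sphere_zero_iff_norm] at hz
    rw [Complex.normSq_eq_norm_sq, hz] at h1
    simpa using h1
  rw [h0]
  obtain ⟨C, hC⟩ := exists_secondOrderBound_sectorFun 0 (1 - X)
  have hlim : Tendsto (fun T : ℝ => K * (1 / (2 * T))) atTop (𝓝 0) := by
    have := ((tendsto_const_nhds (x := (1 : ℝ))).div_atTop
      ((tendsto_id (α := ℝ)).const_mul_atTop (zero_lt_two (α := ℝ)))).const_mul K
    simpa using this
  refine squeeze_zero_norm' ?_ hlim
  filter_upwards [eventually_gt_atTop 0] with T hT
  have hb : Tendsto (fun N : ℕ => K * ((1 + 2 * itoError C T N) / (2 * T) + 2 / N)) atTop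
      (𝓝 (K * (1 / (2 * T)))) := by
    have h1 : Tendsto (fun N : ℕ => (2 : ℝ) / N) atTop (𝓝 0) := tendsto_const_div_atTop_nhds_zero_nat 2
    have := (((((tendsto_itoError C T).const_mul 2).const_add 1).div_const (2 * T)).add
      h1).const_mul K
    simpa using this
  refine le_of_tendsto_of_tendsto (hL T hT).norm hb ?_
  filter_upwards [eventually_smallStep T] with N hN
  refine (norm_stoppedMean_le_insideProb hK hN
    (fun z hz => hφK z (Metric.ball_subset_closedBall hz)) _).trans ?_
  gcongr
  rw [le_div_iff₀ (by positivity)]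
  linarith [mul_insideProb_le hC hT.le hN]

/-- `z^m` is harmonic, so there is no drift and the mean stays near `0^m`, which is also the circle
average by the mean value property; for `m = 0` both equal `1`. -/
lemma pow (m : ℕ) : HasExitLimit fun z => z ^ m := by
  have hcont : Continuous fun z : ℂ => z ^ m := continuous_pow m
  have hs : sectorFun m 1 = fun z => z ^ m := by ext z; simp [sectorFun]
  refine ⟨hcont.continuousOn, fun _ => 0 ^ m, fun T hT => ?_, ?_⟩
  · obtain ⟨C, hC⟩ := exists_secondOrderBound_sectorFun m 1
    rw [tendsto_iff_norm_sub_tendsto_zero]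
    have h2 := (tendsto_itoError C T).const_mul 2
    rw [mul_zero] at h2
    refine squeeze_zero' (Eventually.of_forall fun _ => norm_nonneg _) ?_ h2
    filter_upwards [eventually_smallStep T] with N hN
    have := norm_dynkin_le m hC hT.le hN (Nat.zero_le _) (le_refl (N ^ 4))
    have hL : radialOp m (1 : ℝ[X]) = 0 := by simp [radialOp_apply]
    have h0 : sectorFun m 0 = fun _ => 0 := by ext z; simp [sectorFun]
    rw [hL, h0, hs, stoppedMean_zero] at this
    simpa [insideMean_const] using this
  · have hd : DiffContOnCl ℂ (fun z : ℂ => z ^ m) (Metric.ball 0 |1|) :=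
      (differentiable_pow m).diffContOnCl
    rw [hd.circleAverage]
    exact tendsto_const_nhds

end HasExitLimit

end DyadicWalk

/-! ### From sector functions to all continuous functions. -/

namespace DyadicWalk

open Polynomial

namespace HasExitLimit

/-- `L` is of second order, so a triple zero at `1` makes both `h` and `L h` vanish there, as the
Euler scheme requires. -/
lemma sectorFun_cube (m : ℕ) (r : ℝ[X]) : HasExitLimit (sectorFun m ((1 - X) ^ 3 * r)) := by
  have h0 : ((1 - X) ^ 3 * r).eval 1 = 0 := by simp
  have h1 : (radialOp m ((1 - X) ^ 3 * r)).eval 1 = 0 := by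
    rw [eval_radialOp]
    simp [derivative_mul, derivative_pow]
  obtain ⟨K, hK, hb⟩ := exists_abs_eval_le_add ((1 - X) ^ 3 * r)
  refine of_vanishing (contDiff_sectorFun (n := 0) m _).continuous.continuousOn hK
    (fun z hz => ?_) fun T hT => exists_tendsto_stoppedMean hT m h0 h1
  rw [mem_closedBall_zero_iff] at hz
  refine norm_sectorFun_le hz ?_
  have := hb (Complex.normSq z) ⟨Complex.normSq_nonneg z, by
    rw [Complex.normSq_eq_norm_sq]; exact pow_le_one₀ (norm_nonneg _) hz⟩
  rwa [h0, abs_zero, zero_add] at this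

lemma exists_mul_one_sub_sq_pow_le {η : ℝ} (hη : 0 < η) :
    ∃ k : ℕ, ∀ y ∈ Set.Icc (0 : ℝ) 1, y * (1 - y ^ 2) ^ k ≤ η := by
  rcases le_or_gt 1 η with h1 | h1
  · refine ⟨0, fun y hy => ?_⟩
    rw [pow_zero, mul_one]; exact hy.2.trans h1
  obtain ⟨k, hk⟩ := exists_pow_lt_of_lt_one hη (by nlinarith : 1 - η ^ 2 < 1)
  refine ⟨k, fun y hy => ?_⟩
  have hy2 : 0 ≤ 1 - y ^ 2 := by nlinarith [hy.1, hy.2]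
  rcases le_or_gt y η with h | h
  · refine (mul_le_of_le_one_right hy.1 (pow_le_one₀ hy2 ?_)).trans h
    linarith [sq_nonneg y]
  · refine (mul_le_of_le_one_left (by positivity) hy.2).trans (le_trans ?_ hk.le)
    gcongr

/-- With `y = 1 - s`, multiples `y q` are uniform limits of multiples of `y³`: the part `y (1 -
y²)^k q` is uniformly small for large `k`, and the rest has the factor `y (1 - (1 - y²)^k)`,
divisible by `y³`. -/
lemma sectorFun_of_eval_one (m : ℕ) {g : ℝ[X]} (hg : g.eval 1 = 0) :
    HasExitLimit (sectorFun m g) := by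
  obtain ⟨q, rfl⟩ : ∃ q, g = (1 - X) * q := by
    obtain ⟨q, hq⟩ := dvd_iff_isRoot.2 hg
    exact ⟨-q, by rw [hq, C_1]; ring⟩
  refine of_uniform (contDiff_sectorFun (n := 0) m _).continuous.continuousOn fun η hη => ?_
  obtain ⟨M, hM0, hM⟩ := exists_unitBounded q
  obtain ⟨k, hk⟩ := exists_mul_one_sub_sq_pow_le (by positivity : 0 < η / (M + 1))
  obtain ⟨r, hr⟩ := sub_dvd_pow_sub_pow (1 : ℝ[X]) (1 - (1 - X) ^ 2) k
  rw [one_pow, sub_sub_cancel] at hr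
  refine ⟨_, sectorFun_cube m (r * q), fun z hz => ?_⟩
  rw [mem_closedBall_zero_iff] at hz
  have e : (1 - X) * q = (1 - X) ^ 3 * (r * q) + (1 - X) * (1 - (1 - X) ^ 2) ^ k * q := by
    linear_combination (1 - X) * q * hr
  rw [e, sectorFun_add]
  simp only [add_sub_cancel_left]
  refine norm_sectorFun_le hz ?_
  set s := Complex.normSq z
  have hs : s ∈ Set.Icc (0 : ℝ) 1 := ⟨Complex.normSq_nonneg z, by
    simp only [s]
    rw [Complex.normSq_eq_norm_sq]; exact pow_le_one₀ (norm_nonneg _) hz⟩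
  have hy : 1 - s ∈ Set.Icc (0 : ℝ) 1 := ⟨by linarith [hs.2], by linarith [hs.1]⟩
  simp only [eval_mul, eval_sub, eval_one, eval_X, eval_pow, abs_mul]
  have hy2 : 0 ≤ 1 - (1 - s) ^ 2 := by nlinarith [hy.1, hy.2]
  rw [abs_of_nonneg hy.1, abs_of_nonneg (pow_nonneg hy2 k)]
  calc _ ≤ η / (M + 1) * M := by
        gcongr
        · exact hk _ hy
        · exact hM s hs
    _ ≤ η / (M + 1) * (M + 1) := by gcongr; linarith
    _ = η := by field_simp

/-- Subtracting `g(1) z^m`, the harmonic function with the same boundary values, reduces to `g(1) =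
0`. -/
lemma of_sectorFun (m : ℕ) (g : ℝ[X]) : HasExitLimit (sectorFun m g) := by
  have h1 : HasExitLimit (sectorFun m (g - C (g.eval 1))) :=
    sectorFun_of_eval_one m (by simp)
  have h2 := (pow m).const_mul ((g.eval 1 : ℝ) : ℂ)
  have e : sectorFun m g = fun z =>
      sectorFun m (g - C (g.eval 1)) z + ((g.eval 1 : ℝ) : ℂ) * z ^ m := by
    ext z; simp [sectorFun]; ring
  rw [e]
  exact h1.add h2

lemma of_conjMonomial (a b : ℕ) : HasExitLimit (conjMonomial a b) := by
  wlog h : b ≤ a generalizing a b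
  · have := (this b a (not_le.1 h).le).conj
    have e : conjMonomial a b = fun z => starRingEnd ℂ (conjMonomial b a z) := by
      ext z; simp [conjMonomial, mul_comm]
    rwa [e]
  · have := of_sectorFun (a - b) (monomial b 1)
    rw [sectorFun_monomial, Nat.sub_add_cancel h] at this
    simpa using this

/-- The span of the monomials `z ^ a (conj z) ^ b`. -/
noncomputable def conjPolynomials : Submodule ℂ (ℂ → ℂ) :=
  Submodule.span ℂ (Set.range fun p : ℕ × ℕ => conjMonomial p.1 p.2)

lemma conjMonomial_mem (a b : ℕ) : conjMonomial a b ∈ conjPolynomials :=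
  Submodule.subset_span ⟨(a, b), rfl⟩

lemma of_mem_conjPolynomials {ψ : ℂ → ℂ} (h : ψ ∈ conjPolynomials) : HasExitLimit ψ := by
  induction h using Submodule.span_induction with
  | mem x hx => obtain ⟨p, rfl⟩ := hx; exact of_conjMonomial p.1 p.2
  | zero =>
    have e : (0 : ℂ → ℂ) = fun z => 0 * z ^ 0 := by ext z; simp
    rw [e]
    exact (pow 0).const_mul 0
  | add x y _ _ hx hy => exact hx.add hy
  | smul c x _ hx => exact hx.const_mul c

lemma mul_mem_conjPolynomials {φ ψ : ℂ → ℂ} (hφ : φ ∈ conjPolynomials)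
    (hψ : ψ ∈ conjPolynomials) : φ * ψ ∈ conjPolynomials := by
  have h := Submodule.mul_mem_mul hφ hψ
  rw [conjPolynomials, Submodule.span_mul_span] at h
  refine Submodule.span_mono ?_ h
  rintro _ ⟨_, ⟨p, rfl⟩, _, ⟨q, rfl⟩, rfl⟩
  refine ⟨(p.1 + q.1, p.2 + q.2), ?_⟩
  ext z
  simp [conjMonomial]
  ring

lemma star_mem_conjPolynomials {φ : ℂ → ℂ} (hφ : φ ∈ conjPolynomials) :
    star φ ∈ conjPolynomials := by
  induction hφ using Submodule.span_induction with
  | mem x hx =>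
    obtain ⟨p, rfl⟩ := hx
    have e : star (conjMonomial p.1 p.2) = conjMonomial p.2 p.1 := by
      ext z; simp [conjMonomial, mul_comm]
    simp only [e]
    exact conjMonomial_mem _ _
  | zero => simp
  | add x y _ _ hx hy => rw [star_add]; exact add_mem hx hy
  | smul c x _ hx => rw [star_smul]; exact Submodule.smul_mem _ _ hx

theorem of_continuousOn {φ : ℂ → ℂ} (hφ : ContinuousOn φ (Metric.closedBall (0 : ℂ) 1)) :
    HasExitLimit φ := by
  set S := Metric.closedBall (0 : ℂ) 1
  have : CompactSpace S := isCompact_iff_compactSpace.1 (isCompact_closedBall 0 1)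
  refine of_uniform hφ fun η hη => ?_
  let F : C(S, ℂ) := ⟨S.domRestrict φ, hφ.domRestrict⟩
  -- Stone-Weierstrass: the identity generates the continuous functions on the compact disc as a
  -- closed star algebra.
  have hF : F ∈ StarAlgebra.elemental ℂ (ContinuousMap.restrict S (.id ℂ)) := by
    rw [ContinuousMap.elemental_id_eq_top]; trivial
  have hF' : F ∈ closure (StarAlgebra.adjoin ℂ {ContinuousMap.restrict S (.id ℂ)} : Set C(S, ℂ)) :=
    hF
  obtain ⟨G, hG, hGF⟩ := Metric.mem_closure_iff.1 hF' η hη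
  have hG' : ∃ ψ ∈ conjPolynomials, ∀ z : S, G z = ψ z := by
    clear hGF
    induction hG using StarAlgebra.adjoin_induction with
    | mem x hx =>
      rw [Set.mem_singleton_iff] at hx
      subst hx
      exact ⟨_, conjMonomial_mem 1 0, fun z => by simp [conjMonomial]⟩
    | algebraMap r =>
      exact ⟨_, Submodule.smul_mem _ r (conjMonomial_mem 0 0), fun z => by simp [conjMonomial]⟩
    | add x y _ _ hx hy =>
      obtain ⟨φ, h1, h2⟩ := hx
      obtain ⟨ψ, h3, h4⟩ := hy
      exact ⟨_, add_mem h1 h3, fun z => by simp [h2, h4]⟩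
    | mul x y _ _ hx hy =>
      obtain ⟨φ, h1, h2⟩ := hx
      obtain ⟨ψ, h3, h4⟩ := hy
      exact ⟨_, mul_mem_conjPolynomials h1 h3, fun z => by simp [h2, h4]⟩
    | star x _ hx =>
      obtain ⟨φ, h1, h2⟩ := hx
      exact ⟨_, star_mem_conjPolynomials h1, fun z => by simp [h2]⟩
  obtain ⟨ψ, hψ, hψG⟩ := hG'
  refine ⟨ψ, of_mem_conjPolynomials hψ, fun z hz => ?_⟩
  have := (ContinuousMap.dist_apply_le_dist (f := F) (g := G) ⟨z, hz⟩).trans hGF.le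
  rwa [hψG, dist_eq_norm] at this

end HasExitLimit

end DyadicWalk

/-! ### Moments of the martingale transform. -/

lemma abs_rpow_sub_rpow_le {p : ℝ} (hp : 1 ≤ p) {B a b : ℝ} (ha : a ∈ Set.Icc 0 B)
    (hb : b ∈ Set.Icc 0 B) : |a ^ p - b ^ p| ≤ p * B ^ (p - 1) * |a - b| := by
  refine (convex_Icc (0 : ℝ) B).norm_image_sub_le_of_norm_hasDerivWithin_le
    (f := fun x : ℝ => x ^ p) (f' := fun x => p * x ^ (p - 1))
    (fun x _ => (Real.hasDerivAt_rpow_const (Or.inr hp)).hasDerivWithinAt) (fun x hx => ?_) hb ha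
  rw [Real.norm_of_nonneg (mul_nonneg (by linarith) (Real.rpow_nonneg hx.1 _))]
  gcongr
  · exact hx.1
  · exact hx.2

namespace DyadicWalk

variable {X : Type*} [NormedAddCommGroup X] [NormedSpace ℝ X]

lemma martingaleTransform_eq {f : ℂ → X}
    (hf : ∀ z ∈ Metric.ball (0 : ℂ) 1, planarLaplacian f z = 0) {T : ℝ} {N : ℕ}
    (h : SmallStep (timeStep T N) N) (x : ℝ) :
    martingaleTransform f T N x = f (stoppedWalk (timeStep T N) N (N * N ^ 4) x) -
      itoRemainder f (timeStep T N) N (N ^ 4) x := by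
  have h0 : ∀ c, driftTerm (planarLaplacian f) (timeStep T N) N c x = 0 := fun c => by
    rw [driftTerm]
    exact Set.indicator_apply_eq_zero.2 fun _ => hf _ (h.stoppedWalk_mem_ball _ x)
  simp only [itoRemainder, martingaleTransform, transformStep, h0, smul_zero,
    Finset.sum_const_zero, sub_zero, pow_succ' N 4]
  abel

lemma dyadicAt_martingaleTransform (f : ℂ → X) (T : ℝ) {N : ℕ} (hN : 0 < N) :
    DyadicAt (N ^ 5 + 1) (martingaleTransform f T N) :=
  (DyadicAt.sum (s := Finset.range (N ^ 5)) fun k hk =>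
    (dyadicAt_transformStep f (timeStep T N) hN k).mono
      (by have := Finset.mem_range.1 hk; omega)).comp fun y => f 0 + y

/-- Both norms stay below `B`, where `t ↦ t^p` has Lipschitz constant `p B^(p-1)`; smallness of the
Itô remainder in mean therefore suffices for every `p`. -/
lemma tendsto_integral_rpow_martingaleTransform_sub {f : ℂ → X} {p : ℝ} (hp : 1 ≤ p)
    (hsmooth : ContDiffOn ℝ (⊤ : ℕ∞) f (Metric.closedBall (0 : ℂ) 1))
    (hf : ∀ z ∈ Metric.ball (0 : ℂ) 1, planarLaplacian f z = 0) {T : ℝ} (hT : 0 ≤ T) :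
    Tendsto (fun N : ℕ => (∫ x in Set.Ico (0 : ℝ) 1, ‖martingaleTransform f T N x‖ ^ p) -
      ∫ x in Set.Ico (0 : ℝ) 1, ‖f (stoppedWalk (timeStep T N) N (N * N ^ 4) x)‖ ^ p)
      atTop (𝓝 0) := by
  obtain ⟨C, hC⟩ := exists_secondOrderBound hsmooth
  have hC0 := hC.nonneg
  set B := C + (C * T + 1) with hB
  have hlim := (tendsto_itoError C T).const_mul (p * B ^ (p - 1))
  rw [mul_zero] at hlim
  refine squeeze_zero_norm' ?_ hlim
  filter_upwards [eventually_smallStep T, (tendsto_itoError C T).eventually_le_const zero_lt_one]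
    with N h h1
  have hI1 : IntegrableOn (fun x => ‖martingaleTransform f T N x‖ ^ p) (Set.Ico (0 : ℝ) 1) :=
    ((dyadicAt_martingaleTransform f T h.pos).comp fun y => ‖y‖ ^ p).integrableOn
  have hI2 := integrableOn_stoppedWalk T h.pos (N ^ 4) fun z => ‖f z‖ ^ p
  rw [← integral_sub hI1 hI2]
  calc _ ≤ ∫ x in Set.Ico (0 : ℝ) 1,
        p * B ^ (p - 1) * ‖itoRemainder f (timeStep T N) N (N ^ 4) x‖ := by
        refine norm_integral_le_of_norm_le
          ((dyadicAt_itoRemainder f (timeStep T N) h.pos (N ^ 4)).integrableOn.norm.const_mul _)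
          (ae_of_all _ fun x => ?_)
        have hY := hC.bound _ (h.stoppedWalk_mem_ball (N * N ^ 4) x)
        have hR := norm_itoRemainder_le_const hC hT h le_rfl x
        have hCT : 0 ≤ C * T := by positivity
        rw [martingaleTransform_eq hf h]
        refine (abs_rpow_sub_rpow_le hp (B := B) ⟨norm_nonneg _, ?_⟩ ⟨norm_nonneg _, ?_⟩).trans ?_
        · exact (norm_sub_le _ _).trans (by linarith)
        · linarith
        · have hB0 : 0 ≤ B := by linarith
          gcongr
          refine (abs_norm_sub_norm_le _ _).trans (le_of_eq ?_)
          rw [sub_sub_cancel_left, norm_neg]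
    _ ≤ p * B ^ (p - 1) * itoError C T N := by
        rw [integral_const_mul]
        have : 0 ≤ p * B ^ (p - 1) := by positivity
        gcongr
        exact integral_norm_itoRemainder_le hC hT h le_rfl

/-- Convergence of the `p`-th moments of the martingale transforms. -/
theorem exists_tendsto_integral_rpow_martingaleTransform {f : ℂ → X} {p : ℝ} (hp : 1 ≤ p)
    (hsmooth : ContDiffOn ℝ (⊤ : ℕ∞) f (Metric.closedBall (0 : ℂ) 1))
    (hharm : InnerProductSpace.HarmonicOnNhd f (Metric.ball (0 : ℂ) 1)) :
    ∃ L : ℝ → ℝ,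
      (∀ T : ℝ, 0 < T → Tendsto
        (fun N : ℕ => ∫ x in Set.Ico (0 : ℝ) 1, ‖martingaleTransform f T N x‖ ^ p)
        atTop (𝓝 (L T))) ∧
      Tendsto L atTop (𝓝 (Real.circleAverage (fun z => ‖f z‖ ^ p) 0 1)) := by
  have hcont : ContinuousOn (fun z => ‖f z‖ ^ p) (Metric.closedBall (0 : ℂ) 1) :=
    hsmooth.continuousOn.norm.rpow_const fun _ _ => Or.inr (by linarith)
  obtain ⟨-, L, hL, hL'⟩ := HasExitLimit.of_continuousOn
    (φ := fun z => ((‖f z‖ ^ p : ℝ) : ℂ)) (Complex.continuous_ofReal.comp_continuousOn hcont)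
  refine ⟨fun T => (L T).re, fun T hT => ?_, ?_⟩
  · have h1 := tendsto_integral_rpow_martingaleTransform_sub hp hsmooth
      (fun z hz => planarLaplacian_eq_zero_of_harmonicAt (hharm z hz)) hT.le
    have h2 := (Complex.continuous_re.tendsto _).comp (hL T hT)
    have h3 := h1.add h2
    rw [zero_add] at h3
    refine h3.congr fun N => ?_
    have e : stoppedMean T N (N ^ 4) (fun z => ((‖f z‖ ^ p : ℝ) : ℂ)) =
        ((∫ x in Set.Ico (0 : ℝ) 1,
          ‖f (stoppedWalk (timeStep T N) N (N * N ^ 4) x)‖ ^ p : ℝ) : ℂ) :=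
      integral_complex_ofReal
    simp only [Function.comp_apply, e, Complex.ofReal_re, sub_add_cancel]
  · have h2 := (Complex.continuous_re.tendsto _).comp hL'
    have e := Complex.ofRealCLM.circleAverage_comp_comm
      (circleIntegrable_of_continuousOn_closedBall hcont)
    have e' : (fun z => ((‖f z‖ ^ p : ℝ) : ℂ)) = Complex.ofRealCLM ∘ fun z => ‖f z‖ ^ p := rfl
    rw [e', e] at h2
    simpa [Function.comp_def] using h2

end DyadicWalk

/-! ### Rotation invariance of planar Brownian motion. -/

section RotationInvariance

variable {Ω : Type*} [MeasurableSpace Ω] {P : Measure Ω}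

/-- Equality in law passes to almost sure limits. -/
lemma identDistrib_of_tendsto_ae [IsFiniteMeasure P] {E : Type*} [PseudoEMetricSpace E]
    [MeasurableSpace E] [BorelSpace E] {Y Z : ℕ → Ω → E} {Y' Z' : Ω → E}
    (h : ∀ n, IdentDistrib (Y n) (Z n) P P)
    (hY : ∀ᵐ ω ∂P, Tendsto (fun n => Y n ω) atTop (𝓝 (Y' ω)))
    (hZ : ∀ᵐ ω ∂P, Tendsto (fun n => Z n ω) atTop (𝓝 (Z' ω))) : IdentDistrib Y' Z' P P := by
  have hY' := aemeasurable_of_tendsto_metrizable_ae atTop (fun n => (h n).aemeasurable_fst) hY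
  have hZ' := aemeasurable_of_tendsto_metrizable_ae atTop (fun n => (h n).aemeasurable_snd) hZ
  refine ⟨hY', hZ', ext_of_forall_integral_eq_of_IsFiniteMeasure fun φ => ?_⟩
  have key : ∀ {V : ℕ → Ω → E} {V' : Ω → E}, (∀ n, AEMeasurable (V n) P) → AEMeasurable V' P →
      (∀ᵐ ω ∂P, Tendsto (fun n => V n ω) atTop (𝓝 (V' ω))) →
      Tendsto (fun n => ∫ x, φ x ∂(P.map (V n))) atTop (𝓝 (∫ x, φ x ∂(P.map V'))) := by
    intro V V' hV hV' hlim
    have e : ∀ {U : Ω → E}, AEMeasurable U P → ∫ x, φ x ∂(P.map U) = ∫ ω, φ (U ω) ∂P :=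
      fun hU => integral_map hU φ.continuous.measurable.aestronglyMeasurable
    simp only [e hV', e (hV _)]
    refine tendsto_integral_of_dominated_convergence (fun _ => ‖φ‖)
      (fun n => (φ.continuous.measurable.comp_aemeasurable (hV n)).aestronglyMeasurable)
      (integrable_const _) (fun n => ae_of_all _ fun ω => φ.norm_coe_le_norm _) ?_
    filter_upwards [hlim] with ω hω using (φ.continuous.tendsto _).comp hω
  refine tendsto_nhds_unique (key (fun n => (h n).aemeasurable_fst) hY' hY) ?_
  simp only [(h _).map_eq]
  exact key (fun n => (h n).aemeasurable_snd) hZ' hZ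

namespace IsPlanarBrownian

variable {W : ℝ≥0 → Ω → ℂ}

lemma aemeasurable (hW : IsPlanarBrownian W P) (t : ℝ≥0) : AEMeasurable (W t) P := by
  have h := ((Complex.measurable_ofReal.comp_aemeasurable (hW.re.aemeasurable t)).add
    ((Complex.measurable_ofReal.comp_aemeasurable (hW.im.aemeasurable t)).mul_const Complex.I))
  exact h.congr (ae_of_all _ fun ω => Complex.re_add_im _)

/-- The finite-dimensional distributions of a planar Brownian motion are rotation invariant. -/
lemma identDistrib_restrict_rotation (hW : IsPlanarBrownian W P) (I : Finset ℝ≥0) (θ : ℝ) :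
    IdentDistrib (fun ω (t : I) => Complex.exp (-(θ * Complex.I)) * W t ω)
      (fun ω (t : I) => W t ω) P P := by
  have hX := hW.re.hasLaw I
  have hY := hW.im.hasLaw I
  have := hX.isProbabilityMeasure
  set V : Ω → (I → ℝ) × (I → ℝ) := fun ω => (fun t => (W t ω).re, fun t => (W t ω).im) with hV
  have hVm : AEMeasurable V P := hX.aemeasurable.prodMk hY.aemeasurable
  have hind : IndepFun (fun ω (t : I) => (W t ω).re) (fun ω (t : I) => (W t ω).im) P :=
    hW.indep.comp (φ := I.restrict) (ψ := I.restrict) (by fun_prop) (by fun_prop)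
  have hlaw : P.map V =
      (BrownianReal.projectiveFamily I).prod
        (BrownianReal.projectiveFamily I) := by
    exact ((indepFun_iff_map_prod_eq_prod_map_map hX.aemeasurable hY.aemeasurable).1 hind).trans
      (congrArg₂ Measure.prod hX.map_eq hY.map_eq)
  -- The product of a centred Gaussian measure with itself is invariant under rotations mixing the
  -- two factors.
  have hrot := IsGaussian.map_rotation_eq_self
    (BrownianReal.integral_id_projectiveFamily' I) θ
  have hid : IdentDistrib (ContinuousLinearMap.rotation θ ∘ V) V P P := by
    refine ⟨(by fun_prop : Measurable _).comp_aemeasurable hVm, hVm, ?_⟩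
    rw [← AEMeasurable.map_map_of_aemeasurable (by fun_prop) hVm, hlaw, hrot]
  have hu : Measurable fun (x : (I → ℝ) × (I → ℝ)) (t : I) => (⟨x.1 t, x.2 t⟩ : ℂ) := by
    refine measurable_pi_lambda _ fun t => ?_
    exact Complex.measurableEquivRealProd.symm.measurable.comp
      (f := fun x : (I → ℝ) × (I → ℝ) => (x.1 t, x.2 t)) (by fun_prop)
  suffices h : (fun ω (t : I) => Complex.exp (-(θ * Complex.I)) * W t ω) =
      (fun x t => (⟨x.1 t, x.2 t⟩ : ℂ)) ∘ ContinuousLinearMap.rotation θ ∘ V from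
    h ▸ hid.comp hu
  ext ω t
  have e : Complex.exp (-(θ * Complex.I)) = ⟨Real.cos θ, -Real.sin θ⟩ := by
    apply Complex.ext <;> simp [Complex.exp_re, Complex.exp_im]
  simp only [e, hV, Function.comp, ContinuousLinearMap.rotation_apply]
  refine Complex.ext (by simp) ?_
  simp
  ring

lemma identDistrib_rotation (hW : IsPlanarBrownian W P) {ι : Type*} [Countable ι] (t : ι → ℝ≥0)
    (θ : ℝ) :
    IdentDistrib (fun ω i => Complex.exp (-(θ * Complex.I)) * W (t i) ω)
      (fun ω i => W (t i) ω) P P := by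
  classical
  have := (hW.re.hasLaw ∅).isProbabilityMeasure
  refine (identDistrib_iff_forall_finset_identDistrib
    (X := fun i ω => Complex.exp (-(θ * Complex.I)) * W (t i) ω) (Y := fun i ω => W (t i) ω)
    (aemeasurable_pi_lambda _ fun i => (hW.aemeasurable _).const_mul _)
    (aemeasurable_pi_lambda _ fun i => hW.aemeasurable _)).2 fun I => ?_
  exact (hW.identDistrib_restrict_rotation (I.image t) θ).comp
    (u := fun x (i : I) => x ⟨t i, Finset.mem_image_of_mem t i.2⟩) (by fun_prop)

end IsPlanarBrownian

end RotationInvariance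

/-! ### First passage positions as limits along dyadic grids. -/

section FirstPassage

/-- The value of the sequence `w` at its first passage above level `r` in norm, if this happens
before time `n`, and `0` otherwise. -/
noncomputable def firstPassageValue (r : ℝ) (n : ℕ) (w : ℕ → ℂ) : ℂ :=
  ∑ k ∈ Finset.range n, if (∀ j < k, ‖w j‖ ≤ r) ∧ r < ‖w k‖ then w k else 0

lemma measurable_firstPassageValue (r : ℝ) (n : ℕ) : Measurable (firstPassageValue r n) := by
  refine Finset.measurable_fun_sum _ fun k _ => Measurable.ite ?_ (measurable_pi_apply k)
    measurable_const
  have h1 : MeasurableSet {w : ℕ → ℂ | ∀ j < k, ‖w j‖ ≤ r} := by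
    simp only [Set.ofPred_forall]
    exact MeasurableSet.iInter fun j => MeasurableSet.iInter fun _ =>
      measurableSet_le (measurable_pi_apply j).norm measurable_const
  exact h1.inter (measurableSet_lt measurable_const (measurable_pi_apply k).norm)

/-- Passage depends only on norms, so a rotation changes the value at passage but not the index. -/
lemma firstPassageValue_mul (r : ℝ) (n : ℕ) (w : ℕ → ℂ) {c : ℂ} (hc : ‖c‖ = 1) :
    firstPassageValue r n (fun k => c * w k) = c * firstPassageValue r n w := by
  simp [firstPassageValue, Finset.mul_sum, hc]

lemma firstPassageValue_eq {r : ℝ} {n k : ℕ} {w : ℕ → ℂ} (hk : k < n)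
    (h : ∀ j < k, ‖w j‖ ≤ r) (hr : r < ‖w k‖) : firstPassageValue r n w = w k := by
  rw [firstPassageValue, Finset.sum_eq_single k, if_pos ⟨h, hr⟩]
  · intro l _ hl
    refine if_neg fun h' => ?_
    rcases lt_or_gt_of_ne hl with hl | hl
    · exact absurd h'.2 (h l hl).not_gt
    · exact absurd hr (h'.1 k hl).not_gt
  · simp [hk]

/-- Along finer and finer dyadic grids, the first passage value of a continuous path converges to
its value at the infimum of the passage times. -/
lemma tendsto_firstPassageValue {w : ℝ≥0 → ℂ} (hw : Continuous w) {r : ℝ} {t₀ : ℝ≥0}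
    (ht₀ : r < ‖w t₀‖) :
    Tendsto (fun m : ℕ => firstPassageValue r (4 ^ m) fun k => w (k / 2 ^ m)) atTop
      (𝓝 (w (sInf {t | r < ‖w t‖}))) := by
  set U : Set ℝ≥0 := {t | r < ‖w t‖} with hU
  -- Strict passage gives an open set, so fine grids do hit it close to its infimum.
  have hUo : IsOpen U := isOpen_lt continuous_const hw.norm
  rw [Metric.tendsto_nhds]
  intro ε hε
  obtain ⟨δ, hδ, hwδ⟩ := Metric.continuousAt_iff.1 (hw.continuousAt (x := sInf U)) ε hε
  obtain ⟨t, htU, ht⟩ := exists_lt_of_csInf_lt (s := U) ⟨t₀, ht₀⟩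
    (lt_add_of_pos_right (sInf U) (Real.toNNReal_pos.2 hδ))
  have hgrid : Tendsto (fun m : ℕ => ((⌊(t : ℝ) * 2 ^ m⌋₊ : ℝ≥0) / 2 ^ m : ℝ≥0)) atTop (𝓝 t) := by
    rw [← NNReal.tendsto_coe]
    push_cast
    exact (tendsto_nat_floor_mul_div_atTop t.2).comp (tendsto_pow_atTop_atTop_of_one_lt one_lt_two)
  -- A grid of `4^m` points with mesh `2^(-m)` reaches up to time `2^m`, eventually beyond `t`.
  have hlarge : ∀ᶠ m : ℕ in atTop, (t : ℝ) < 2 ^ m :=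
    (tendsto_pow_atTop_atTop_of_one_lt one_lt_two).eventually_gt_atTop _
  filter_upwards [hgrid.eventually (hUo.mem_nhds htU), hgrid.eventually (gt_mem_nhds ht), hlarge]
    with m hm hm' hml
  classical
  have hex : ∃ k : ℕ, r < ‖w (k / 2 ^ m)‖ := ⟨_, hm⟩
  have hle : Nat.find hex ≤ ⌊(t : ℝ) * 2 ^ m⌋₊ := Nat.find_min' hex hm
  rw [firstPassageValue_eq (k := Nat.find hex) ?_
    (fun j hj => not_lt.1 (Nat.find_min hex hj)) (Nat.find_spec hex)]
  · apply hwδ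
    have h1 : sInf U ≤ (Nat.find hex : ℝ≥0) / 2 ^ m := csInf_le (OrderBot.bddBelow _)
      (Nat.find_spec hex)
    have h2 : (Nat.find hex : ℝ≥0) / 2 ^ m < sInf U + δ.toNNReal := by
      refine lt_of_le_of_lt ?_ hm'
      gcongr
    have h1' := NNReal.coe_le_coe.2 h1
    have h2' := NNReal.coe_lt_coe.2 h2
    rw [NNReal.coe_add, Real.coe_toNNReal _ hδ.le] at h2'
    rw [NNReal.dist_eq, abs_of_nonneg (sub_nonneg.2 h1')]
    linarith
  · refine hle.trans_lt ((Nat.floor_lt (by positivity)).2 ?_)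
    have : ((4 ^ m : ℕ) : ℝ) = 2 ^ m * 2 ^ m := by
      rw [← mul_pow]; norm_num
    rw [this]
    gcongr

variable {w : ℝ≥0 → ℂ}

lemma exitSet_eq (h0 : w 0 = 0) :
    {t : ℝ≥0 | 0 < t ∧ w t ∉ Metric.ball (0 : ℂ) 1} = {t | 1 ≤ ‖w t‖} := by
  ext t
  simp only [Set.mem_ofPred_eq, mem_ball_zero_iff, not_lt, and_iff_right_iff_imp]
  intro h
  refine pos_iff_ne_zero.2 fun h' => ?_
  rw [h', h0, norm_zero] at h
  linarith

lemma sInf_exitSet_mem (hw : Continuous w) {t₀ : ℝ≥0} (ht₀ : 1 ≤ ‖w t₀‖) :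
    1 ≤ ‖w (sInf {t | 1 ≤ ‖w t‖})‖ :=
  (isClosed_le continuous_const hw.norm).csInf_mem (s := {t | 1 ≤ ‖w t‖}) ⟨t₀, ht₀⟩
    (OrderBot.bddBelow _)

lemma norm_sInf_exitSet (hw : Continuous w) (h0 : w 0 = 0) {t₀ : ℝ≥0} (ht₀ : 1 ≤ ‖w t₀‖) :
    ‖w (sInf {t | 1 ≤ ‖w t‖})‖ = 1 := by
  have hmem := sInf_exitSet_mem hw ht₀
  set τ := sInf {t | 1 ≤ ‖w t‖} with hτ
  refine le_antisymm ?_ hmem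
  have hpos : 0 < τ := pos_iff_ne_zero.2 fun h' => by
    rw [h', h0, norm_zero] at hmem
    linarith
  have : (𝓝[<] τ).NeBot := nhdsLT_neBot_of_exists_lt ⟨0, hpos⟩
  refine le_of_tendsto (hw.norm.continuousWithinAt (s := Set.Iio τ) (x := τ)) ?_
  filter_upwards [self_mem_nhdsWithin] with t ht
  by_contra! h
  exact absurd (csInf_le (OrderBot.bddBelow _) (show t ∈ {t | 1 ≤ ‖w t‖} from h.le)) ht.not_ge

/-- The passage times above levels increasing to `1` converge to the exit time. -/
lemma tendsto_sInf_passage (hw : Continuous w) {t₀ : ℝ≥0} (ht₀ : 1 ≤ ‖w t₀‖)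
    {r : ℕ → ℝ} (hr : ∀ j, r j < 1) (hlim : Tendsto r atTop (𝓝 1)) :
    Tendsto (fun j => sInf {t | r j < ‖w t‖}) atTop (𝓝 (sInf {t | 1 ≤ ‖w t‖})) := by
  have hmem := sInf_exitSet_mem hw ht₀
  set τ := sInf {t | 1 ≤ ‖w t‖} with hτ
  refine tendsto_order.2 ⟨fun a ha => ?_, fun b hb => Eventually.of_forall fun j =>
    (csInf_le (OrderBot.bddBelow _)
      (show τ ∈ {t | r j < ‖w t‖} from (hr j).trans_le hmem)).trans_lt hb⟩
  obtain ⟨b, hab, hbτ⟩ := exists_between ha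
  obtain ⟨s, hs, hmax⟩ := isCompact_Icc.exists_isMaxOn (s := Set.Icc 0 b) ⟨0, by simp⟩
    hw.norm.continuousOn
  have hs1 : ‖w s‖ < 1 := by
    by_contra! h
    exact absurd (csInf_le (OrderBot.bddBelow _) (show s ∈ {t | 1 ≤ ‖w t‖} from h))
      (hs.2.trans_lt hbτ).not_ge
  filter_upwards [hlim.eventually (lt_mem_nhds hs1)] with j hj
  refine hab.trans_le (le_csInf ⟨τ, (hr j).trans_le hmem⟩ fun t ht => ?_)
  by_contra! h
  have h1 : ‖w t‖ ≤ ‖w s‖ := hmax (show t ∈ Set.Icc 0 b from ⟨zero_le, h.le⟩)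
  have h2 : r j < ‖w t‖ := ht
  linarith

end FirstPassage

/-! ### The Brownian exit position: existence and uniform law. -/

lemma gaussianReal_Icc_le {v : ℝ≥0} (hv : v ≠ 0) (a b : ℝ) :
    gaussianReal 0 v (Set.Icc a b) ≤
      ENNReal.ofReal ((√(2 * Real.pi * v))⁻¹) * ENNReal.ofReal (b - a) := by
  rw [gaussianReal_apply _ hv, ← Real.volume_Icc, ← setLIntegral_const]
  refine lintegral_mono fun x => ENNReal.ofReal_le_ofReal ?_
  rw [gaussianPDFReal]
  refine mul_le_of_le_one_right (by positivity) (Real.exp_le_one_iff.2 ?_)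
  rw [neg_div]
  exact neg_nonpos.2 (by positivity)

namespace IsPlanarBrownian

variable {Ω : Type*} [MeasurableSpace Ω] {P : Measure Ω} {W : ℝ≥0 → Ω → ℂ}

lemma ae_continuous (hW : IsPlanarBrownian W P) : ∀ᵐ ω ∂P, Continuous (W · ω) := by
  filter_upwards [hW.re.cont, hW.im.cont] with ω h1 h2
  have : (W · ω) = fun t => Complex.equivRealProdCLM.symm ((W t ω).re, (W t ω).im) := by
    ext t
    rfl
  rw [this]
  exact Complex.equivRealProdCLM.symm.continuous.comp (h1.prodMk h2)

lemma ae_zero (hW : IsPlanarBrownian W P) : ∀ᵐ ω ∂P, W 0 ω = 0 := by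
  filter_upwards [hW.re.eval_zero_ae_eq_zero, hW.im.eval_zero_ae_eq_zero] with ω h1 h2
  exact Complex.ext h1 h2

/-- A planar Brownian motion almost surely leaves the unit disc. -/
lemma ae_exists_one_le_norm (hW : IsPlanarBrownian W P) : ∀ᵐ ω ∂P, ∃ t, 1 ≤ ‖W t ω‖ := by
  rw [ae_iff]
  refine le_antisymm (ge_of_tendsto' (f := fun n : ℕ => ENNReal.ofReal
    ((√(2 * Real.pi * ((n + 1 : ℕ) : ℝ≥0)))⁻¹) * ENNReal.ofReal (1 - -1)) (x := atTop) ?_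
    fun n => ?_) zero_le
  · have h : Tendsto (fun n : ℕ => (√(2 * Real.pi * ((n + 1 : ℕ) : ℝ≥0)))⁻¹) atTop (𝓝 0) := by
      refine tendsto_inv_atTop_zero.comp (Real.tendsto_sqrt_atTop.comp
        (Tendsto.const_mul_atTop (by positivity) ?_))
      simpa [Function.comp_def] using
        (tendsto_natCast_atTop_atTop (R := ℝ)).comp (tendsto_add_atTop_nat 1)
    have h' := ENNReal.Tendsto.mul_const (b := ENNReal.ofReal (1 - -1))
      (ENNReal.tendsto_ofReal h) (Or.inr ENNReal.ofReal_ne_top)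
    simpa using h'
  · have hlaw := hW.re.hasLaw_eval ((n + 1 : ℕ) : ℝ≥0)
    refine le_trans ?_ (gaussianReal_Icc_le (by positivity) (-1) 1)
    rw [← hlaw.map_eq, Measure.map_apply_of_aemeasurable hlaw.aemeasurable measurableSet_Icc]
    refine measure_mono fun ω hω => ?_
    simp only [Set.mem_ofPred_eq, not_exists, not_le] at hω
    exact abs_le.1 ((Complex.abs_re_le_norm _).trans (hω _).le)

end IsPlanarBrownian

namespace IsPlanarBrownian

variable {Ω : Type*} [MeasurableSpace Ω] {P : Measure Ω} {W : ℝ≥0 → Ω → ℂ}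

lemma ae_exitTime_eq (hW : IsPlanarBrownian W P) :
    ∀ᵐ ω ∂P, exitTime W ω = sInf {t | 1 ≤ ‖W t ω‖} := by
  filter_upwards [hW.ae_zero] with ω h0
  rw [exitTime, exitSet_eq (w := fun t => W t ω) h0]

lemma ae_exists_notMem_ball (hW : IsPlanarBrownian W P) :
    ∀ᵐ ω ∂P, ∃ t : ℝ≥0, 0 < t ∧ W t ω ∉ Metric.ball (0 : ℂ) 1 := by
  filter_upwards [hW.ae_zero, hW.ae_exists_one_le_norm] with ω h0 ⟨t, ht⟩
  exact ⟨t, (exitSet_eq (w := fun t => W t ω) h0).ge ht⟩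

lemma ae_norm_exitTime (hW : IsPlanarBrownian W P) : ∀ᵐ ω ∂P, ‖W (exitTime W ω) ω‖ = 1 := by
  filter_upwards [hW.ae_zero, hW.ae_exists_one_le_norm, hW.ae_continuous, hW.ae_exitTime_eq]
    with ω h0 ⟨t, ht⟩ hc he
  rw [he]
  exact norm_sInf_exitSet hc h0 ht

/-- The law of the exit position of a planar Brownian motion is rotation invariant. -/
lemma identDistrib_exitTime_rotation (hW : IsPlanarBrownian W P) (θ : ℝ) :
    IdentDistrib (fun ω => Complex.exp (-(θ * Complex.I)) * W (exitTime W ω) ω)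
      (fun ω => W (exitTime W ω) ω) P P := by
  have := (hW.re.hasLaw ∅).isProbabilityMeasure
  set c := Complex.exp (-(θ * Complex.I)) with hc
  have hc1 : ‖c‖ = 1 := by
    rw [hc, ← neg_mul, ← Complex.ofReal_neg, Complex.norm_exp_ofReal_mul_I]
  -- Levels `r < 1` come first, since strict passage above `r` is certain on paths reaching the
  -- circle and is detected by grids; afterwards `r` increases to `1`.
  have hpass : ∀ r < 1, IdentDistrib (fun ω => c * W (sInf {t | r < ‖W t ω‖}) ω)
      (fun ω => W (sInf {t | r < ‖W t ω‖}) ω) P P := fun r hr => by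
    have hlim : ∀ᵐ ω ∂P, Tendsto
        (fun m : ℕ => firstPassageValue r (4 ^ m) fun k => W (k / 2 ^ m) ω) atTop
        (𝓝 (W (sInf {t | r < ‖W t ω‖}) ω)) := by
      filter_upwards [hW.ae_exists_one_le_norm, hW.ae_continuous] with ω ⟨t, ht⟩ hcont
      exact tendsto_firstPassageValue hcont (hr.trans_le ht)
    refine identDistrib_of_tendsto_ae
      (Y := fun m ω => c * firstPassageValue r (4 ^ m) fun k => W (k / 2 ^ m) ω)
      (fun m => ?_) (hlim.mono fun ω hω => hω.const_mul c) hlim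
    simp only [← firstPassageValue_mul _ _ _ hc1]
    exact (hW.identDistrib_rotation (fun k : ℕ => (k / 2 ^ m : ℝ≥0)) θ).comp
      (measurable_firstPassageValue r (4 ^ m))
  have hr : ∀ j : ℕ, (1 - 1 / ((j : ℝ) + 1)) < 1 := fun j => sub_lt_self _ (by positivity)
  have hlim : ∀ᵐ ω ∂P, Tendsto
      (fun j : ℕ => W (sInf {t | 1 - 1 / ((j : ℝ) + 1) < ‖W t ω‖}) ω) atTop
      (𝓝 (W (exitTime W ω) ω)) := by
    filter_upwards [hW.ae_exists_one_le_norm, hW.ae_continuous, hW.ae_exitTime_eq]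
      with ω ⟨t, ht⟩ hcont he
    rw [he]
    refine (hcont.tendsto _).comp (tendsto_sInf_passage hcont ht hr ?_)
    simpa using tendsto_one_div_add_atTop_nhds_zero_nat.const_sub (1 : ℝ)
  exact identDistrib_of_tendsto_ae (fun j => hpass _ (hr j))
    (hlim.mono fun ω hω => hω.const_mul c) hlim

lemma aemeasurable_exitTime (hW : IsPlanarBrownian W P) :
    AEMeasurable (fun ω => W (exitTime W ω) ω) P :=
  (hW.identDistrib_exitTime_rotation 0).aemeasurable_snd

/-- Harmonic measure of the disc from its centre: the exit position of a planar Brownian motion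
is uniformly distributed on the circle. -/
lemma integral_exitTime_of_bounded (hW : IsPlanarBrownian W P) {φ : ℂ → ℝ} (hφ : Continuous φ)
    {C : ℝ} (hC : ∀ z, ‖φ z‖ ≤ C) :
    ∫ ω, φ (W (exitTime W ω) ω) ∂P = Real.circleAverage φ 0 1 := by
  have := (hW.re.hasLaw ∅).isProbabilityMeasure
  set Z := fun ω => W (exitTime W ω) ω with hZ
  have hZm : AEMeasurable Z P := hW.aemeasurable_exitTime
  have hrot : ∀ θ : ℝ, ∫ ω, φ (Complex.exp (θ * Complex.I) * Z ω) ∂P = ∫ ω, φ (Z ω) ∂P :=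
    fun θ => by
      have h := ((hW.identDistrib_exitTime_rotation (-θ)).comp hφ.measurable).integral_eq
      simpa using h
  -- For a fixed exit point on the circle, averaging over all rotations gives the circle average,
  -- the argument of the point being only a shift of `θ`.
  have hcirc : ∀ᵐ ω ∂P, (2 * Real.pi)⁻¹ •
      ∫ θ in 0..2 * Real.pi, φ (Complex.exp (θ * Complex.I) * Z ω) = Real.circleAverage φ 0 1 := by
    filter_upwards [hW.ae_norm_exitTime] with ω hω
    rw [Real.circleAverage_eq_integral_add (Complex.arg (Z ω))]
    congr 2
    ext θ
    have h1 : Complex.exp (Complex.arg (Z ω) * Complex.I) = Z ω := by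
      simpa [hZ, hω] using Complex.norm_mul_exp_arg_mul_I (Z ω)
    rw [circleMap_zero, Complex.ofReal_add, add_mul, Complex.exp_add, h1]
    simp
  have hswap := intervalIntegral_integral_swap (μ := P) (a := 0) (b := 2 * Real.pi)
    (f := fun θ ω => φ (Complex.exp (θ * Complex.I) * Z ω)) (by
      rw [Set.uIoc_of_le Real.two_pi_pos.le]
      refine Integrable.of_bound (C := C) ?_ (ae_of_all _ fun x => hC _)
      refine (hφ.measurable.comp_aemeasurable ?_).aestronglyMeasurable
      exact (by fun_prop : Measurable fun x : ℝ × Ω =>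
        Complex.exp (x.1 * Complex.I)).aemeasurable.mul hZm.comp_snd)
  calc ∫ ω, φ (Z ω) ∂P
      = (2 * Real.pi)⁻¹ • ∫ _ in 0..2 * Real.pi, ∫ ω, φ (Z ω) ∂P := by
        rw [intervalIntegral.integral_const, smul_smul, sub_zero,
          inv_mul_cancel₀ Real.two_pi_pos.ne', one_smul]
    _ = ∫ ω, ((2 * Real.pi)⁻¹ •
          ∫ θ in 0..2 * Real.pi, φ (Complex.exp (θ * Complex.I) * Z ω)) ∂P := by
        rw [integral_smul, ← hswap]
        simp only [hrot]
    _ = Real.circleAverage φ 0 1 := by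
        rw [integral_congr_ae hcirc]
        simp

/-- For the exit position, continuity of `φ` is only needed on the closed disc. -/
lemma integral_exitTime (hW : IsPlanarBrownian W P) {φ : ℂ → ℝ}
    (hφ : ContinuousOn φ (Metric.closedBall 0 1)) :
    Integrable (fun ω => φ (W (exitTime W ω) ω)) P ∧
      ∫ ω, φ (W (exitTime W ω) ω) ∂P = Real.circleAverage φ 0 1 := by
  have := (hW.re.hasLaw ∅).isProbabilityMeasure
  -- The radial retraction onto the closed disc extends `φ` to a bounded continuous function on the
  -- plane without changing it on the circle.
  set π : ℂ → ℂ := fun z => (max 1 ‖z‖)⁻¹ • z with hπ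
  have hmax : ∀ z : ℂ, 0 < max 1 ‖z‖ := fun z => lt_max_of_lt_left one_pos
  have hπc : Continuous π :=
    ((continuous_const.max continuous_norm).inv₀ fun z => (hmax z).ne').smul continuous_id
  have hπm : ∀ z, π z ∈ Metric.closedBall (0 : ℂ) 1 := fun z => by
    rw [mem_closedBall_zero_iff, hπ, norm_smul, norm_inv, Real.norm_of_nonneg (hmax z).le]
    exact inv_mul_le_one_of_le₀ (le_max_right _ _) (hmax z).le
  have hπ1 : ∀ z, ‖z‖ = 1 → π z = z := fun z hz => by simp [hπ, hz]
  obtain ⟨C, hC⟩ := (isCompact_closedBall (0 : ℂ) 1).exists_bound_of_continuousOn hφ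
  have hcont : Continuous (φ ∘ π) := hφ.comp_continuous hπc hπm
  have hae : (fun ω => (φ ∘ π) (W (exitTime W ω) ω)) =ᵐ[P] fun ω => φ (W (exitTime W ω) ω) := by
    filter_upwards [hW.ae_norm_exitTime] with ω hω
    simp [hπ1 _ hω]
  have hb : ∀ z, ‖(φ ∘ π) z‖ ≤ C := fun z => hC _ (hπm z)
  refine ⟨Integrable.congr (Integrable.of_bound (C := C) ?_ (ae_of_all _ fun ω => hb _)) hae, ?_⟩
  · exact (hcont.measurable.comp_aemeasurable hW.aemeasurable_exitTime).aestronglyMeasurable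
  · rw [← integral_congr_ae hae, hW.integral_exitTime_of_bounded hcont hb]
    refine Real.circleAverage_congr_sphere fun z hz => ?_
    rw [Function.comp, hπ1 z (by simpa using hz)]

end IsPlanarBrownian

theorem theorem2 {X : Type*} [NormedAddCommGroup X] [NormedSpace ℝ X] [CompleteSpace X]
    (p : ℝ) (hp : 1 ≤ p)
    (f : ℂ → X) (hsmooth : ContDiffOn ℝ (⊤ : ℕ∞) f (Metric.closedBall (0 : ℂ) 1))
    (hharm : InnerProductSpace.HarmonicOnNhd f (Metric.ball (0 : ℂ) 1))
    {Ω : Type*} [MeasurableSpace Ω] (P : Measure Ω) [IsProbabilityMeasure P]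
    (W : ℝ≥0 → Ω → ℂ) (hW : IsPlanarBrownian W P) :
    (∀ᵐ ω ∂P, ∃ t : ℝ≥0, 0 < t ∧ W t ω ∉ Metric.ball (0 : ℂ) 1) ∧
    Integrable (fun ω => ‖f (W (exitTime W ω) ω)‖ ^ p) P ∧
    (∃ L : ℝ → ℝ,
      (∀ T : ℝ, 0 < T →
        Tendsto
          (fun N : ℕ => ∫ x in Set.Ico (0 : ℝ) 1, ‖DyadicWalk.martingaleTransform f T N x‖ ^ p)
          atTop (𝓝 (L T))) ∧
      Tendsto L atTop (𝓝 (∫ ω, ‖f (W (exitTime W ω) ω)‖ ^ p ∂P))) ∧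
    ∫ ω, ‖f (W (exitTime W ω) ω)‖ ^ p ∂P =
      Real.circleAverage (fun z => ‖f z‖ ^ p) 0 1 := by
  have hφ : ContinuousOn (fun z => ‖f z‖ ^ p) (Metric.closedBall (0 : ℂ) 1) :=
    hsmooth.continuousOn.norm.rpow_const fun _ _ => Or.inr (by linarith)
  obtain ⟨hint, heq⟩ := hW.integral_exitTime hφ
  refine ⟨hW.ae_exists_notMem_ball, hint, ?_, heq⟩
  rw [heq]
  exact DyadicWalk.exists_tendsto_integral_rpow_martingaleTransform hp hsmooth hharm
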